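/- **Conventions.** Let $q=e^{h}$ ($h\in\mathbb C$) be not a root of unity, put $q^z=e^{hz}$ for $z\in\mathbb C$, and $$[z]_q=\frac{q^z-q^{-z}}{q-q^{-1}},\qquad [n]_q!=\prod_{k=1}^n[k]_q,\qquad [p;n]_q!=\prod_{k=0}^{n-1}[p-k]_q .$$ Fix any function $s:\mathbb C\to\mathbb C$ with $s(z)^2=z$. A square root of a product or quotient of $q$-numbers means the corresponding product or quotient of the roots $s([\,\cdot\,]_q)$ of the individual $q$-numbers. *Representations.* The infinite-dimensional color representation $V^{(p)}$ ($p\in\mathbb C$) of $U_q(sl(2))$ has the basis $e_0,e_1,\dots$, and matrix elements (row $a$, column $b$) $$(X^+)^a_b=\sqrt{[2p-a]_q[a+1]_q}\,\delta_{a+1,b},\quad (X^-)^a_b=\sqrt{[2p-a+1]_q[a]_q}\,\delta_{a-1,b},\quad (q^{tH})^a_b=q^{t(2p-2a)}\delta_{ab}.$$ For $2j\in\mathbb Z_{\ge0}$ the spin $j$ representation $V^{(j)}$ has the basis $e_0,\dots,e_{2j}$ and the same matrix elements with $p=j$. Put $\hat X_1^\pm=X^\pm$, $\hat X_0^\pm=X^\mp$,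 $\hat H_1=H$, $\hat H_0=-H$. *Clebsch–Gordan coefficients.* For $n,z_1,z_2,z_3\in\mathbb Z_{\ge0}$, $$\begin{aligned}&C(\mu_1,\mu_2,\mu_1+\mu_2-n;z_1,z_2,z_3)_q=\delta(z_3,z_1+z_2-n)\sqrt{[2\mu_1+2\mu_2-2n+1]_q}\,\sqrt{[n]_q![z_1]_q![z_2]_q![z_3]_q!}\\&\quad\times q^{(n-n^2)/2+(n-z_2)\mu_1+(n+z_1)\mu_2}\sum_\nu\frac{(-1)^\nu q^{-\nu(2\mu_1+2\mu_2-n+1)}}{[\nu]_q![n-\nu]_q![z_1-\nu]_q![z_2-n+\nu]_q!}\\&\quad\times\sqrt{\frac{[2\mu_1-n;z_1-\nu]_q!\,[2\mu_1-z_1;n-\nu]_q!\,[2\mu_2-n;z_2+\nu-n]_q!\,[2\mu_2-z_2;\nu]_q!}{[2\mu_1+2\mu_2-n+1;z_1+z_2+1]_q!}}\;,\end{aligned}$$ where $\max\{0,n-z_2\}\le\nu\le\min\{n,z_1\}$ when $\mu_1,\mu_2$ are both color parameters. If $\mu_2=j_2$ is a spin, in addition $\nu\le 2j_2-z_2$;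 if $\mu_1=j_1$ is a spin, in addition $\nu\ge n+z_1-2j_1$. *R matrices.* For $u\in\mathbb C$ let $$g(p_1,p_2,n;u)_q=(-1)^n\prod_{k=0}^{n-1}\frac{[u-p_1-p_2+k]_q}{[u+p_1+p_2-k]_q},$$ $$R_{p_1p_2}(q;u)^{a_1a_2}_{b_1b_2}=\sum_{n\ge0}\sum_{z\ge0}g(p_1,p_2,n;u)_q\,C(p_1,p_2,p_1+p_2-n;b_1,b_2,z)_q\,C(p_2,p_1,p_1+p_2-n;a_2,a_1,z)_q$$ for $a_i,b_i\in\mathbb Z_{\ge0}$. (Only $z=b_1+b_2-n=a_1+a_2-n$ contributes.) For a spin $j_2$, $a_1,b_1\in\mathbb Z_{\ge0}$ and $0\le a_2,b_2\le 2j_2$, $$R_{p_1j_2}(q;u)^{a_1a_2}_{b_1b_2}=\sum_{n=0}^{2j_2}\sum_{z\ge0}g(p_1,j_2,n;u)_q\,C(p_1,j_2,p_1+j_2-n;b_1,b_2,z)_q\,C(j_2,p_1,p_1+j_2-n;a_2,a_1,z)_q .$$ *Non-degeneracy.* Whenever $R_{\mu_1\mu_2}(q;u)$ occurs below, the denominators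 are assumed not to vanish: $[2\mu_1+2\mu_2+1-k]_q\ne0$ for all integers $k\ge0$, and $[u+\mu_1+\mu_2-k]_q\neq0$ for all integers $k\ge0$ (only for $0\le k<2j_2$ if $\mu_2=j_2$ is a spin). **Theorem.** 1. For $p_1,p_2\in\mathbb C$ the double sum defining each matrix element of $R=R_{p_1p_2}(q;u)$ has finitely many nonzero terms, $R^{a_1a_2}_{b_1b_2}=0$ unless $a_1+a_2=b_1+b_2$, and $R$ satisfies, with $x=q^{-2u}$ and for $i=0,1$, the linear equations on $V^{(p_1)}\otimes V^{(p_2)}$ $$R\,(q^{\hat H_i/2}\otimes q^{\hat H_i/2})=(q^{\hat H_i/2}\otimes q^{\hat H_i/2})\,R,$$ $$R\,(x^{\pm\delta_{i0}}\hat X_i^\pm\otimes q^{\hat H_i/2}+q^{-\hat H_i/2}\otimes\hat X_i^\pm)=(x^{\pm\delta_{i0}}\hat X_i^\pm\otimes q^{-\hat H_i/2}+q^{\hat H_i/2}\otimes\hat X_i^\pm)\,R$$ (as equations between matrix elements, all sums being finite). 2. For $p_1,p_2,p_3\in\mathbb C$ and all indices the Yang–Baxter equation holds, all sums being finite: $$\sum_{c_1c_2c_3}R_{p_1p_2}(u)^{c_1c_2}_{b_1b_2}R_{p_1p_3}(u+v)^{a_1c_3}_{c_1b_3}R_{p_2p_3}(v)^{a_2a_3}_{c_2c_3}=\sum_{c_1c_2c_3}R_{p_1p_2}(u)^{a_1a_2}_{c_1c_2}R_{p_1p_3}(u+v)^{c_1a_3}_{b_1c_3}R_{p_2p_3}(v)^{c_2c_3}_{b_2b_3}.$$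 3. The Boltzmann weights $X_{\alpha\beta}(u)^{ab}_{cd}=R_{p_1p_2}(q;u)^{ba}_{cd}$ depend on $p_1,p_2$ only through the colors $\alpha=q^{p_2}$, $\beta=q^{p_1}$, and they satisfy the Yang–Baxter relation of colored vertex models (all sums being finite) $$\begin{aligned}&\sum_{c_1,c_2,c_3}X_{\alpha_1\alpha_2}(u_1-u_2)^{a_1a_2}_{c_2c_1}X_{\alpha_1\alpha_3}(u_1-u_3)^{c_1a_3}_{c_3b_1}X_{\alpha_2\alpha_3}(u_2-u_3)^{c_2c_3}_{b_3b_2}\\&=\sum_{c_1,c_2,c_3}X_{\alpha_2\alpha_3}(u_2-u_3)^{a_2a_3}_{c_3c_2}X_{\alpha_1\alpha_3}(u_1-u_3)^{a_1c_3}_{b_3c_1}X_{\alpha_1\alpha_2}(u_1-u_2)^{c_1c_2}_{b_2b_1}.\end{aligned}$$ 4. (Mixed case.) For $p_1\in\mathbb C$ and $2j_2\in\mathbb Z_{\ge0}$, the statements of part 1 hold for $R_{p_1j_2}(q;u)$ on $V^{(p_1)}\otimes V^{(j_2)}$. For $p_1,p_2\in\mathbb C$ and $2j_3\in\mathbb Z_{\ge0}$,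 the Yang–Baxter equation of part 2 holds for $R_{p_1p_2}(u)$, $R_{p_1j_3}(u+v)$, $R_{p_2j_3}(v)$. -/

import Mathlib

open scoped Kronecker

namespace ColoredVertex

noncomputable section

/-! ### q-numbers

The deformation parameter is `q = exp h`, with powers `q ^ z = exp (h * z)` for complex `z`
(so every choice of a logarithm of `q` is covered).  The parameter `s : ℂ → ℂ` is a choice of square
roots, `s z ^ 2 = z`; a radical of a product or a quotient of q-numbers is the corresponding
product or quotient of the roots of the individual q-numbers. -/

/-- `q ^ z`, where `q = exp h`. -/
def qpow (h z : ℂ) : ℂ := Complex.exp (h * z)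

/-- `[z]_q = (q ^ z - q ^ (-z)) / (q - q⁻¹)`. -/
def qnum (h z : ℂ) : ℂ := (qpow h z - qpow h (-z)) / (qpow h 1 - qpow h (-1))

/-- `[n]_q! = ∏_{k=1}^n [k]_q`. -/
def qfact (h : ℂ) (n : ℕ) : ℂ := ∏ k ∈ Finset.range n, qnum h ((k : ℂ) + 1)

/-- `√([n]_q!)`. -/
def sqrtFact (h : ℂ) (s : ℂ → ℂ) (n : ℕ) : ℂ :=
  ∏ k ∈ Finset.range n, s (qnum h ((k : ℂ) + 1))

/-- `√([p; n]_q!)`, where `[p; n]_q! = ∏_{k=0}^{n-1} [p - k]_q`. -/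
def sqrtFall (h : ℂ) (s : ℂ → ℂ) (p : ℂ) (n : ℕ) : ℂ :=
  ∏ k ∈ Finset.range n, s (qnum h (p - k))

/-! ### Clebsch-Gordan coefficients -/

/-- The explicit expression of `C(μ₁, μ₂, μ₁ + μ₂ - n; z₁, z₂, z₃)_q`, with the summation over `ν`
ranging over the set `I`.  It vanishes unless `z₃ = z₁ + z₂ - n`.  (In all sums below `ν ∈ I` implies
`ν ≤ n`, `ν ≤ z₁` and `n ≤ z₂ + ν`, so the natural number subtractions are not truncated.) -/
def cgOn (h : ℂ) (s : ℂ → ℂ) (I : Finset ℕ) (μ₁ μ₂ : ℂ) (n z₁ z₂ z₃ : ℕ) : ℂ :=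
  if z₃ + n = z₁ + z₂ then
    s (qnum h (2 * μ₁ + 2 * μ₂ - 2 * n + 1))
      * (sqrtFact h s n * sqrtFact h s z₁ * sqrtFact h s z₂ * sqrtFact h s z₃)
      * qpow h (((n : ℂ) - (n : ℂ) ^ 2) / 2 + ((n : ℂ) - z₂) * μ₁ + ((n : ℂ) + z₁) * μ₂)
      * ∑ ν ∈ I,
          (-1) ^ ν * qpow h (-(ν : ℂ) * (2 * μ₁ + 2 * μ₂ - n + 1))
            / (qfact h ν * qfact h (n - ν) * qfact h (z₁ - ν) * qfact h (z₂ + ν - n))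
            * (sqrtFall h s (2 * μ₁ - n) (z₁ - ν) * sqrtFall h s (2 * μ₁ - z₁) (n - ν)
                * sqrtFall h s (2 * μ₂ - n) (z₂ + ν - n) * sqrtFall h s (2 * μ₂ - z₂) ν
                / sqrtFall h s (2 * μ₁ + 2 * μ₂ - n + 1) (z₁ + z₂ + 1))
  else 0

/-- `C(p₁, p₂, p₁ + p₂ - n; z₁, z₂, z₃)_q` for two infinite dimensional color representations:
`max {0, n - z₂} ≤ ν ≤ min {n, z₁}`. -/
def cgPP (h : ℂ) (s : ℂ → ℂ) (p₁ p₂ : ℂ) (n z₁ z₂ z₃ : ℕ) : ℂ :=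
  cgOn h s (Finset.Icc (n - z₂) (min n z₁)) p₁ p₂ n z₁ z₂ z₃

/-- `C(p₁, j₂, p₁ + j₂ - n; z₁, z₂, z₃)_q` for a color representation and the spin `j₂ = m / 2`
representation: `max {0, n - z₂} ≤ ν ≤ min {n, z₁, 2 j₂ - z₂}`. -/
def cgPJ (h : ℂ) (s : ℂ → ℂ) (p₁ : ℂ) (m : ℕ) (n z₁ z₂ z₃ : ℕ) : ℂ :=
  cgOn h s (Finset.Icc (n - z₂) (min (min n z₁) (m - z₂))) p₁ ((m : ℂ) / 2) n z₁ z₂ z₃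

/-- `C(j₁, p₂, j₁ + p₂ - n; z₁, z₂, z₃)_q` for the spin `j₁ = m / 2` representation and a color
representation: `max {0, n - z₂, n + z₁ - 2 j₁} ≤ ν ≤ min {n, z₁}`. -/
def cgJP (h : ℂ) (s : ℂ → ℂ) (m : ℕ) (p₂ : ℂ) (n z₁ z₂ z₃ : ℕ) : ℂ :=
  cgOn h s (Finset.Icc (max (n - z₂) (n + z₁ - m)) (min n z₁)) ((m : ℂ) / 2) p₂ n z₁ z₂ z₃

/-- No q-number in the denominators of the Clebsch-Gordan coefficients of `p₁`, `p₂` vanishes. -/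
def CGRegular (h p₁ p₂ : ℂ) : Prop := ∀ k : ℕ, qnum h (2 * p₁ + 2 * p₂ + 1 - k) ≠ 0

/-! ### The R matrices

The matrix element `R^{a₁ a₂}_{b₁ b₂}` is the entry in row `(a₁, a₂)` and column `(b₁, b₂)`. -/

/-- `g(p₁, p₂, n; u)_q = (-1)^n ∏_{k<n} [u - p₁ - p₂ + k]_q / [u + p₁ + p₂ - k]_q`. -/
def gfun (h p₁ p₂ : ℂ) (n : ℕ) (u : ℂ) : ℂ :=
  (-1) ^ n * ∏ k ∈ Finset.range n, qnum h (u - p₁ - p₂ + k) / qnum h (u + p₁ + p₂ - k)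

/-- The contribution of the basis vector `|p₁, p₂; p₁ + p₂ - n, z⟩`, `x = (n, z)`, to the matrix
element `R_{p₁ p₂}(q; u)^{a₁ a₂}_{b₁ b₂}`. -/
def termPP (h : ℂ) (s : ℂ → ℂ) (p₁ p₂ u : ℂ) (a b x : ℕ × ℕ) : ℂ :=
  gfun h p₁ p₂ x.1 u * cgPP h s p₁ p₂ x.1 b.1 b.2 x.2 * cgPP h s p₂ p₁ x.1 a.2 a.1 x.2

/-- `R_{p₁ p₂}(q; u)` for two infinite dimensional color representations.  The Clebsch-Gordan
coefficients force `z = b₁ + b₂ - n = a₁ + a₂ - n`. -/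
def RPP (h : ℂ) (s : ℂ → ℂ) (p₁ p₂ u : ℂ) : Matrix (ℕ × ℕ) (ℕ × ℕ) ℂ :=
  Matrix.of fun a b => ∑ᶠ x : ℕ × ℕ, termPP h s p₁ p₂ u a b x

/-- The contribution of `|p₁, j₂; p₁ + j₂ - n, z⟩`, `j₂ = m / 2`, `0 ≤ n ≤ m`, `x = (n, z)`, to the
matrix element `R_{p₁ j₂}(q; u)^{a₁ a₂}_{b₁ b₂}`. -/
def termPJ (h : ℂ) (s : ℂ → ℂ) (p₁ : ℂ) (m : ℕ) (u : ℂ) (a b : ℕ × Fin (m + 1))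
    (x : Fin (m + 1) × ℕ) : ℂ :=
  gfun h p₁ ((m : ℂ) / 2) x.1 u * cgPJ h s p₁ m x.1 b.1 b.2 x.2 * cgJP h s m p₁ x.1 a.2 a.1 x.2

/-- `R_{p₁ j₂}(q; u)` for a color representation and the spin `j₂ = m / 2` representation. -/
def RPJ (h : ℂ) (s : ℂ → ℂ) (p₁ : ℂ) (m : ℕ) (u : ℂ) :
    Matrix (ℕ × Fin (m + 1)) (ℕ × Fin (m + 1)) ℂ :=
  Matrix.of fun a b => ∑ᶠ x : Fin (m + 1) × ℕ, termPJ h s p₁ m u a b x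

/-! ### Representation matrices -/

/-- The representation matrices of `X⁺`, `X⁻` and `q ^ (t H)`, for `t ∈ ℂ`, in a basis indexed by
`ι`; rows are indexed by the output. -/
structure RepMatrices (ι : Type) where
  Xp : Matrix ι ι ℂ
  Xm : Matrix ι ι ℂ
  K : ℂ → Matrix ι ι ℂ

/-- The infinite dimensional color representation `V^{(p)}_q` of `U_q(sl(2))`. -/
def colorRep (h : ℂ) (s : ℂ → ℂ) (p : ℂ) : RepMatrices ℕ where
  Xp := Matrix.of fun a b =>
    if a + 1 = b then s (qnum h (2 * p - a)) * s (qnum h ((a : ℂ) + 1)) else 0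
  Xm := Matrix.of fun a b =>
    if a = b + 1 then s (qnum h (2 * p - a + 1)) * s (qnum h (a : ℂ)) else 0
  K t := Matrix.diagonal fun a => qpow h (t * (2 * p - 2 * a))

/-- The spin `j = m / 2` representation of `U_q(sl(2))`, of dimension `2 j + 1 = m + 1`. -/
def spinRep (h : ℂ) (s : ℂ → ℂ) (m : ℕ) : RepMatrices (Fin (m + 1)) where
  Xp := (colorRep h s ((m : ℂ) / 2)).Xp.submatrix (fun a => (a : ℕ)) (fun a => (a : ℕ))
  Xm := (colorRep h s ((m : ℂ) / 2)).Xm.submatrix (fun a => (a : ℕ)) (fun a => (a : ℕ))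
  K t := ((colorRep h s ((m : ℂ) / 2)).K t).submatrix (fun a => (a : ℕ)) (fun a => (a : ℕ))

/-- `φ(X_i⁺)`, where `φ(X_0⁺) = X⁻` and `φ(X_1⁺) = X⁺`. -/
def RepMatrices.hatXp {ι : Type} (ρ : RepMatrices ι) (i : Fin 2) : Matrix ι ι ℂ :=
  if i = 0 then ρ.Xm else ρ.Xp

/-- `φ(X_i⁻)`, where `φ(X_0⁻) = X⁺` and `φ(X_1⁻) = X⁻`. -/
def RepMatrices.hatXm {ι : Type} (ρ : RepMatrices ι) (i : Fin 2) : Matrix ι ι ℂ :=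
  if i = 0 then ρ.Xp else ρ.Xm

/-- `q ^ (t φ(H_i))`, where `φ(H_0) = -H` and `φ(H_1) = H`. -/
def RepMatrices.hatK {ι : Type} (ρ : RepMatrices ι) (i : Fin 2) (t : ℂ) : Matrix ι ι ℂ :=
  if i = 0 then ρ.K (-t) else ρ.K t

/-! ### The intertwining and Yang-Baxter equations -/

/-- `A B = C D` for possibly infinite matrices, where every entry of both products is a finite
sum. -/
def ProdEq {ι : Type} (A B C D : Matrix ι ι ℂ) : Prop :=
  ∀ a b : ι,
    (Function.support fun c => A a c * B c b).Finite ∧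
    (Function.support fun c => C a c * D c b).Finite ∧
    ∑ᶠ c, A a c * B c b = ∑ᶠ c, C a c * D c b

/-- The linear equations for an R matrix of `U_q(ŝl(2))` on `ρ₁ ⊗ ρ₂`, with spectral variable
`x`: for `i = 0, 1`,
`R (q^{Ĥ_i/2} ⊗ q^{Ĥ_i/2}) = (q^{Ĥ_i/2} ⊗ q^{Ĥ_i/2}) R` and
`R (x^{±δ_{i0}} X̂_i^± ⊗ q^{Ĥ_i/2} + q^{-Ĥ_i/2} ⊗ X̂_i^±)
  = (x^{±δ_{i0}} X̂_i^± ⊗ q^{-Ĥ_i/2} + q^{Ĥ_i/2} ⊗ X̂_i^±) R`. -/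
def SolvesIntertwining {ι κ : Type} (x : ℂ) (ρ₁ : RepMatrices ι) (ρ₂ : RepMatrices κ)
    (R : Matrix (ι × κ) (ι × κ) ℂ) : Prop :=
  ∀ i : Fin 2,
    ProdEq R (ρ₁.hatK i (1 / 2) ⊗ₖ ρ₂.hatK i (1 / 2))
      (ρ₁.hatK i (1 / 2) ⊗ₖ ρ₂.hatK i (1 / 2)) R ∧
    ProdEq R
      ((if i = 0 then x else 1) • (ρ₁.hatXp i ⊗ₖ ρ₂.hatK i (1 / 2))
        + ρ₁.hatK i (-(1 / 2)) ⊗ₖ ρ₂.hatXp i)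
      ((if i = 0 then x else 1) • (ρ₁.hatXp i ⊗ₖ ρ₂.hatK i (-(1 / 2)))
        + ρ₁.hatK i (1 / 2) ⊗ₖ ρ₂.hatXp i) R ∧
    ProdEq R
      ((if i = 0 then x⁻¹ else 1) • (ρ₁.hatXm i ⊗ₖ ρ₂.hatK i (1 / 2))
        + ρ₁.hatK i (-(1 / 2)) ⊗ₖ ρ₂.hatXm i)
      ((if i = 0 then x⁻¹ else 1) • (ρ₁.hatXm i ⊗ₖ ρ₂.hatK i (-(1 / 2)))
        + ρ₁.hatK i (1 / 2) ⊗ₖ ρ₂.hatXm i) R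

/-- The Yang-Baxter equation in matrix elements,
`∑ R₁₂^{c₁c₂}_{b₁b₂} R₁₃^{a₁c₃}_{c₁b₃} R₂₃^{a₂a₃}_{c₂c₃}
  = ∑ R₁₂^{a₁a₂}_{c₁c₂} R₁₃^{c₁a₃}_{b₁c₃} R₂₃^{c₂c₃}_{b₂b₃}`,
where all sums over `(c₁, c₂, c₃)` are finite. -/
def YangBaxter {α β γ : Type} (R₁₂ : Matrix (α × β) (α × β) ℂ)
    (R₁₃ : Matrix (α × γ) (α × γ) ℂ) (R₂₃ : Matrix (β × γ) (β × γ) ℂ) : Prop :=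
  ∀ (a₁ b₁ : α) (a₂ b₂ : β) (a₃ b₃ : γ),
    (Function.support fun c : α × β × γ =>
      R₁₂ (c.1, c.2.1) (b₁, b₂) * R₁₃ (a₁, c.2.2) (c.1, b₃) * R₂₃ (a₂, a₃) (c.2.1, c.2.2)).Finite ∧
    (Function.support fun c : α × β × γ =>
      R₁₂ (a₁, a₂) (c.1, c.2.1) * R₁₃ (c.1, a₃) (b₁, c.2.2) * R₂₃ (c.2.1, c.2.2) (b₂, b₃)).Finite ∧
    ∑ᶠ c : α × β × γ,
      R₁₂ (c.1, c.2.1) (b₁, b₂) * R₁₃ (a₁, c.2.2) (c.1, b₃) * R₂₃ (a₂, a₃) (c.2.1, c.2.2) =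
    ∑ᶠ c : α × β × γ,
      R₁₂ (a₁, a₂) (c.1, c.2.1) * R₁₃ (c.1, a₃) (b₁, c.2.2) * R₂₃ (c.2.1, c.2.2) (b₂, b₃)

/-- No denominator of `g(p₁, p₂, n; u)_q`, `n ∈ ℕ`, vanishes. -/
def GRegular (h p₁ p₂ u : ℂ) : Prop := ∀ k : ℕ, qnum h (u + p₁ + p₂ - k) ≠ 0

/-- No denominator of `g(p₁, j₂, n; u)_q`, `0 ≤ n ≤ m = 2 j₂`, vanishes. -/
def GRegularSpin (h p₁ : ℂ) (m : ℕ) (u : ℂ) : Prop :=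
  ∀ k : ℕ, k < m → qnum h (u + p₁ + (m : ℂ) / 2 - k) ≠ 0

/-! ### The infinite state colored vertex model -/

/-- The Boltzmann weight `X_{αβ}(u)^{ab}_{cd} = R_{p₁ p₂}(q; u)^{ba}_{cd}`, where the colors
`α = q ^ p₂`, `β = q ^ p₁` are given through their exponents `p₂ = pα` and `p₁ = pβ`. -/
def vertexWeight (h : ℂ) (s : ℂ → ℂ) (pα pβ u : ℂ) (a b c d : ℕ) : ℂ :=
  RPP h s pβ pα u (b, a) (c, d)

/-- The Yang-Baxter relation of colored vertex models, for weights `X α β u a b c d` of the form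
`X_{αβ}(u)^{ab}_{cd}`, colors `α₁, α₂, α₃` and spectral parameters `u₁, u₂, u₃`; all sums over
`(c₁, c₂, c₃)` are finite. -/
def VertexYangBaxter (X : ℂ → ℂ → ℂ → ℕ → ℕ → ℕ → ℕ → ℂ) (α₁ α₂ α₃ u₁ u₂ u₃ : ℂ) : Prop :=
  ∀ a₁ a₂ a₃ b₁ b₂ b₃ : ℕ,
    (Function.support fun c : ℕ × ℕ × ℕ =>
      X α₁ α₂ (u₁ - u₂) a₁ a₂ c.2.1 c.1 * X α₁ α₃ (u₁ - u₃) c.1 a₃ c.2.2 b₁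
        * X α₂ α₃ (u₂ - u₃) c.2.1 c.2.2 b₃ b₂).Finite ∧
    (Function.support fun c : ℕ × ℕ × ℕ =>
      X α₂ α₃ (u₂ - u₃) a₂ a₃ c.2.2 c.2.1 * X α₁ α₃ (u₁ - u₃) a₁ c.2.2 b₃ c.1
        * X α₁ α₂ (u₁ - u₂) c.1 c.2.1 b₂ b₁).Finite ∧
    ∑ᶠ c : ℕ × ℕ × ℕ,
      X α₁ α₂ (u₁ - u₂) a₁ a₂ c.2.1 c.1 * X α₁ α₃ (u₁ - u₃) c.1 a₃ c.2.2 b₁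
        * X α₂ α₃ (u₂ - u₃) c.2.1 c.2.2 b₃ b₂ =
    ∑ᶠ c : ℕ × ℕ × ℕ,
      X α₂ α₃ (u₂ - u₃) a₂ a₃ c.2.2 c.2.1 * X α₁ α₃ (u₁ - u₃) a₁ c.2.2 b₃ c.1
        * X α₁ α₂ (u₁ - u₂) c.1 c.2.1 b₂ b₁

end

end ColoredVertex

open ColoredVertex

namespace ColoredVertex

noncomputable section

open Finset

/-! ### Elementary properties of q-numbers -/

section QNumbers

variable (h : ℂ)

/-! Removing the radicals. After a rescaling of the basis vectors, X⁺ and X⁻ act with coefficients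
[k+1] and [2p-k], the Clebsch-Gordan coefficient becomes the root-free function `cgFun`, and R
becomes `rOp`, the sum over n of g_n |n,z>'<n,z| divided by square norms, for the bilinear form that
makes X⁺ and X⁻ adjoint. Here |n,z>' is built with the two factors exchanged. The grading is by the
degree a+b: X⁻ increases it by one and X⁺ decreases it by one.

Finite part. For fixed n the values of `cgFun` in all degrees form one module with highest weight
p₁+p₂-n (`cgFun_raise`, `cgFun_lower`). Adjointness then gives orthogonality and the norms
(`form_cgFun_of_ne`, `form_cgFun_self`), hence completeness in each degree, and R intertwines X_1^±
whatever the scalars g_n are.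

Affine part. X_0^+ maps the top vector of component n into the components n-1, n, n+1
(`lowerOp_cgFun_succ`). Comparing coefficients, intertwining on top vectors amounts to
g_{n+1}[u+p₁+p₂-n] = -g_n[u-p₁-p₂+n], which the product defining g satisfies. As X_0^+ commutes with
X_1^-, the relation spreads from the top vector to the whole component (`rOp_affineLowerOp`). X_0^-
follows by transposition (`rOp_affineRaiseOp`).

Yang-Baxter. Instead of a Schur-type argument on triple tensor products, the proof uses monodromy
matrices. The entries A, C, D of a two-site monodromy matrix are expressions in the affine
generators and the degree, so R followed by the flip intertwines them (`braidOp_monC`,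
`braidOp_monA`, `braidOp_monD`). Consequently both sides of the braid relation intertwine the
three-site entry C(y) for every y. C(y) lowers the degree by one, and a vector of positive degree
killed by all C(y) is zero (`monC3_injective`); induction on the degree finishes the proof
(`braidOp_yangBaxter`).

Removing genericity. The argument needs [2p_i-k] ≠ 0 and a little more than the stated regularity.
Each identity between matrix elements is a finite sum, so it is proved at p_i+ε for ε outside a
countable set and ε tends to 0. Since s may be discontinuous, R is first generalised to arbitrary
roots of [2p_i-k] (`rootR`), chosen to converge to the prescribed ones.

Spin and colors. At p = m/2 the vanishing of [2p-m] decouples the first m+1 basis vectors, and R for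
a spin is the corresponding block of R for colors (`RPJ_eq_RPP`); the weaker assumption on u is
reached by a limit in u. Dependence on the colors alone is invariance under shifts w with q^w = 1
(`RPP_add_period`). -/

theorem qpow_add (x y : ℂ) : qpow h (x + y) = qpow h x * qpow h y := by
  simp [qpow, mul_add, Complex.exp_add]

theorem qpow_neg (x : ℂ) : qpow h (-x) = (qpow h x)⁻¹ := by
  simp [qpow, Complex.exp_neg]

theorem qpow_sub (x y : ℂ) : qpow h (x - y) = qpow h x * (qpow h y)⁻¹ := by
  rw [sub_eq_add_neg, qpow_add, qpow_neg]

theorem qpow_zero : qpow h 0 = 1 := by simp [qpow]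

theorem qpow_ne_zero (x : ℂ) : qpow h x ≠ 0 := Complex.exp_ne_zero _

theorem qpow_two_mul (x : ℂ) : qpow h (2 * x) = qpow h x ^ 2 := by
  rw [two_mul, qpow_add, sq]

theorem qpow_two : qpow h 2 = qpow h 1 ^ 2 := by
  rw [← qpow_two_mul, mul_one]

theorem qpow_three : qpow h 3 = qpow h 1 ^ 3 := by
  rw [show (3 : ℂ) = 1 + 1 + 1 by norm_num, qpow_add, qpow_add]; ring

theorem qpow_natCast (n : ℕ) : qpow h n = Complex.exp h ^ n := by
  rw [qpow, mul_comm, Complex.exp_nat_mul]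

theorem qnum_zero : qnum h 0 = 0 := by simp [qnum]

theorem qnum_neg (x : ℂ) : qnum h (-x) = -qnum h x := by
  simp only [qnum, neg_neg, ← neg_div, neg_sub]

theorem qnum_add (x y : ℂ) : qnum h (x + y) = qpow h (-y) * qnum h x + qpow h x * qnum h y := by
  simp only [qnum, neg_add, qpow_add]
  ring

theorem qnum_add' (x y : ℂ) : qnum h (x + y) = qpow h y * qnum h x + qpow h (-x) * qnum h y := by
  simp only [qnum, neg_add, qpow_add]
  ring

/-- The falling product `[p; n]_q! = ∏_{k=0}^{n-1} [p - k]_q`. -/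
def qfall (p : ℂ) (n : ℕ) : ℂ := ∏ k ∈ range n, qnum h (p - k)

theorem qfall_zero (p : ℂ) : qfall h p 0 = 1 := by simp [qfall]

theorem qfall_succ (p : ℂ) (n : ℕ) : qfall h p (n + 1) = qfall h p n * qnum h (p - n) := by
  simp [qfall, prod_range_succ]

theorem qfact_zero : qfact h 0 = 1 := by simp [qfact]

theorem qfact_succ (n : ℕ) : qfact h (n + 1) = qfact h n * qnum h ((n : ℂ) + 1) := by
  simp [qfact, prod_range_succ]

end QNumbers

section Generic

variable {h : ℂ} (hq : ∀ n : ℕ, 0 < n → Complex.exp h ^ n ≠ 1)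

include hq

theorem qpow_sq_natCast_ne_one {n : ℕ} (hn : 0 < n) : qpow h n ^ 2 ≠ 1 := by
  rw [qpow_natCast, ← pow_mul]
  exact hq _ (by omega)

theorem q_sub_inv_ne_zero : qpow h 1 - qpow h (-1) ≠ 0 := by
  intro hz
  apply qpow_sq_natCast_ne_one hq one_pos
  have h1 := qpow_ne_zero h 1
  rw [qpow_neg] at hz
  field_simp at hz
  push_cast
  linear_combination hz

theorem qnum_eq_zero_iff (z : ℂ) : qnum h z = 0 ↔ qpow h (2 * z) = 1 := by
  have h1 := qpow_ne_zero h z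
  rw [qnum, div_eq_zero_iff, or_iff_left (q_sub_inv_ne_zero hq), qpow_neg, qpow_two_mul]
  field_simp
  rw [mul_zero, sub_eq_zero]

theorem qnum_natCast_ne_zero {n : ℕ} (hn : 0 < n) : qnum h n ≠ 0 := by
  rw [Ne, qnum_eq_zero_iff hq, qpow_two_mul]
  exact qpow_sq_natCast_ne_one hq hn

theorem qnum_natCast_add_one_ne_zero (n : ℕ) : qnum h ((n : ℂ) + 1) ≠ 0 := by
  exact_mod_cast qnum_natCast_ne_zero hq n.succ_pos

theorem qnum_one : qnum h 1 = 1 := by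
  rw [qnum, div_self (q_sub_inv_ne_zero hq)]

theorem qfact_ne_zero (n : ℕ) : qfact h n ≠ 0 :=
  prod_ne_zero_iff.2 fun k _ => qnum_natCast_add_one_ne_zero hq k

end Generic

/-! ### The radical-free Clebsch-Gordan functions -/

/-- `1 / [z - ν]_q!`, which is zero for `ν > z`. -/
def qrecip (h : ℂ) (z ν : ℕ) : ℂ := if ν ≤ z then (qfact h (z - ν))⁻¹ else 0

section Recip

variable {h : ℂ} (hq : ∀ n : ℕ, 0 < n → Complex.exp h ^ n ≠ 1)

theorem qrecip_succ_succ (z ν : ℕ) : qrecip h (z + 1) (ν + 1) = qrecip h z ν := by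
  simp [qrecip]

theorem qrecip_of_lt {z ν : ℕ} (hz : z < ν) : qrecip h z ν = 0 := by
  simp [qrecip, hz]

include hq

/-- The recursion holds with no restriction on ν: at ν = z+1 the factor [0] supplies the zero on the
right. This is what makes all boundary terms of the later sums disappear. -/
theorem qrecip_eq_mul (z ν : ℕ) :
    qrecip h z ν = qnum h ((z : ℂ) + 1 - ν) * qrecip h (z + 1) ν := by
  rcases lt_trichotomy ν (z + 1) with hlt | heq | hgt
  · obtain ⟨k, rfl⟩ := Nat.exists_eq_add_of_le (Nat.lt_succ_iff.1 hlt)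
    have h1 := qfact_ne_zero hq k
    have h2 := qnum_natCast_add_one_ne_zero hq k
    rw [qrecip, qrecip, if_pos (by omega), if_pos (by omega), show ν + k - ν = k by omega,
      show ν + k + 1 - ν = k + 1 by omega, qfact_succ, mul_inv,
      show ((ν + k : ℕ) : ℂ) + 1 - ν = k + 1 by push_cast; ring]
    field_simp
  · subst heq
    rw [qrecip_of_lt (by omega)]
    simp [qnum_zero]
  · rw [qrecip_of_lt (by omega), qrecip_of_lt hgt, mul_zero]

/-- The factors [ν] and [ν'] cancel the last factor of the respective factorials, so both halves
become sums over ν+ν' = n-1, where they cancel term by term. This is the discrete integration by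
parts behind the raising and lowering identities. -/
theorem sum_antidiagonal_telescope {n : ℕ} (U V : ℕ → ℕ → ℂ)
    (hUV : ∀ a b, a + b + 1 = n → U (a + 1) b + V a (b + 1) = 0) :
    ∑ x ∈ antidiagonal n, (qfact h x.1)⁻¹ * (qfact h x.2)⁻¹ *
      (qnum h x.1 * U x.1 x.2 + qnum h x.2 * V x.1 x.2) = 0 := by
  simp only [mul_add, sum_add_distrib]
  rcases n with _ | n
  · simp [qnum_zero]
  rw [Nat.sum_antidiagonal_succ, Nat.sum_antidiagonal_succ']
  simp only [Nat.cast_zero, qnum_zero, zero_mul, mul_zero, zero_add]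
  rw [← sum_add_distrib]
  refine sum_eq_zero fun x hx => ?_
  rw [HasAntidiagonal.mem_antidiagonal] at hx
  have h1 := qnum_natCast_add_one_ne_zero hq x.1
  have h2 := qnum_natCast_add_one_ne_zero hq x.2
  have h3 := hUV x.1 x.2 (by omega)
  rw [qfact_succ, qfact_succ, mul_inv, mul_inv]
  push_cast
  field_simp
  linear_combination (qfact h x.1)⁻¹ * (qfact h x.2)⁻¹ * h3

end Recip

/-- The summand of the radical-free Clebsch-Gordan function, without `1 / ([ν]_q! [ν']_q!)`. -/
def cgTerm (h p₁ p₂ : ℂ) (n z₁ z₂ ν ν' : ℕ) : ℂ :=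
  (-1) ^ ν * qpow h (-(ν : ℂ) * (2 * p₁ + 2 * p₂ - n + 1)) * (qrecip h z₁ ν * qrecip h z₂ ν')
    * (qfall h (2 * p₁) (z₁ + ν') * qfall h (2 * p₂) (z₂ + ν))

/-- The Clebsch-Gordan coefficient of `p₁`, `p₂`, `p₁ + p₂ - n`, up to normalization and up to a
rescaling of the basis that removes all radicals. -/
def cgFun (h p₁ p₂ : ℂ) (n z₁ z₂ : ℕ) : ℂ :=
  qpow h (((n : ℂ) - (n : ℂ) ^ 2) / 2 + ((n : ℂ) - z₂) * p₁ + ((n : ℂ) + z₁) * p₂) *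
    ∑ x ∈ antidiagonal n, (qfact h x.1)⁻¹ * (qfact h x.2)⁻¹ * cgTerm h p₁ p₂ n z₁ z₂ x.1 x.2

section CGFun

variable {h : ℂ} (hq : ∀ n : ℕ, 0 < n → Complex.exp h ^ n ≠ 1) (p₁ p₂ : ℂ)

theorem cgTerm_of_lt {n z₁ z₂ ν ν' : ℕ} (hn : ν + ν' = n) (hz : z₁ + z₂ < n) :
    cgTerm h p₁ p₂ n z₁ z₂ ν ν' = 0 := by
  have : z₁ < ν ∨ z₂ < ν' := by omega
  rcases this with h1 | h1 <;> simp [cgTerm, qrecip_of_lt h1]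

theorem cgFun_of_lt {n z₁ z₂ : ℕ} (hz : z₁ + z₂ < n) : cgFun h p₁ p₂ n z₁ z₂ = 0 := by
  rw [cgFun, sum_eq_zero, mul_zero]
  intro x hx
  rw [cgTerm_of_lt p₁ p₂ (HasAntidiagonal.mem_antidiagonal.1 hx) hz, mul_zero]

include hq

/-- In each summand [z₁+1] is split along ν and (z₁+1-ν), and [z₂+1] along ν' and (z₂+1-ν'). The
parts with z_i+1-ν reproduce the summand of the right side, and the parts with [ν], [ν'] telescope.
-/
theorem cgFun_raise (n z₁ z₂ : ℕ) :
    qnum h ((z₁ : ℂ) + 1) * qpow h (p₂ - z₂) * cgFun h p₁ p₂ n (z₁ + 1) z₂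
      + qpow h (-(p₁ - z₁)) * qnum h ((z₂ : ℂ) + 1) * cgFun h p₁ p₂ n z₁ (z₂ + 1)
      = qnum h (2 * p₁ + 2 * p₂ - n - ((z₁ + z₂ : ℕ) : ℂ)) * cgFun h p₁ p₂ n z₁ z₂ := by
  have key : ∑ x ∈ antidiagonal n, (qfact h x.1)⁻¹ * (qfact h x.2)⁻¹ *
      (qpow h (2 * p₂ - z₂) * qnum h ((z₁ : ℂ) + 1) * cgTerm h p₁ p₂ n (z₁ + 1) z₂ x.1 x.2
        + qpow h (z₁ - 2 * p₁) * qnum h ((z₂ : ℂ) + 1) * cgTerm h p₁ p₂ n z₁ (z₂ + 1) x.1 x.2)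
      = ∑ x ∈ antidiagonal n, (qfact h x.1)⁻¹ * (qfact h x.2)⁻¹ *
        (qnum h (2 * p₁ + 2 * p₂ - n - ((z₁ + z₂ : ℕ) : ℂ)) * cgTerm h p₁ p₂ n z₁ z₂ x.1 x.2) := by
    rw [← sub_eq_zero, ← sum_sub_distrib]
    simp only [← mul_sub]
    rw [← sum_antidiagonal_telescope hq (n := n)
      (fun a b => qpow h (2 * p₂ - z₂) * qpow h ((z₁ : ℂ) + 1 - a)
        * cgTerm h p₁ p₂ n (z₁ + 1) z₂ a b)
      (fun a b => qpow h (z₁ - 2 * p₁) * qpow h (-((z₂ : ℂ) + 1 - b))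
        * cgTerm h p₁ p₂ n z₁ (z₂ + 1) a b)]
    · refine sum_congr rfl fun x hx => ?_
      congr 1
      obtain ⟨a, b⟩ := x
      have hn : a + b = n := by simpa using hx
      have e1 := qnum_add h ((z₁ : ℂ) + 1 - a) a
      have e2 := qnum_add' h ((z₂ : ℂ) + 1 - b) b
      rw [sub_add_cancel] at e1 e2
      have m1 : qnum h ((z₁ : ℂ) + 1 - a) * cgTerm h p₁ p₂ n (z₁ + 1) z₂ a b
          = qnum h (2 * p₁ - z₁ - b) * cgTerm h p₁ p₂ n z₁ z₂ a b := by
        simp only [cgTerm]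
        rw [show z₁ + 1 + b = z₁ + b + 1 by omega, qfall_succ, qrecip_eq_mul hq z₁ a]
        push_cast
        rw [show 2 * p₁ - ((z₁ : ℂ) + b) = 2 * p₁ - z₁ - b by ring]
        ring
      have m2 : qnum h ((z₂ : ℂ) + 1 - b) * cgTerm h p₁ p₂ n z₁ (z₂ + 1) a b
          = qnum h (2 * p₂ - z₂ - a) * cgTerm h p₁ p₂ n z₁ z₂ a b := by
        simp only [cgTerm]
        rw [show z₂ + 1 + a = z₂ + a + 1 by omega, qfall_succ, qrecip_eq_mul hq z₂ b]
        push_cast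
        rw [show 2 * p₂ - ((z₂ : ℂ) + a) = 2 * p₂ - z₂ - a by ring]
        ring
      have m3 : qnum h (2 * p₁ + 2 * p₂ - n - ((z₁ + z₂ : ℕ) : ℂ))
          = qpow h (2 * p₂ - z₂) * qpow h (-(a : ℂ)) * qnum h (2 * p₁ - z₁ - b)
            + qpow h (z₁ - 2 * p₁) * qpow h b * qnum h (2 * p₂ - z₂ - a) := by
        rw [← hn, ← qpow_add, ← qpow_add]
        push_cast
        rw [show 2 * p₁ + 2 * p₂ - ((a : ℂ) + b) - (z₁ + z₂)
          = (2 * p₁ - z₁ - b) + (2 * p₂ - z₂ - a) by ring, qnum_add']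
        congr 3; ring_nf
      rw [e1, e2, m3]
      linear_combination qpow h (2 * p₂ - z₂) * qpow h (-(a : ℂ)) * m1
        + qpow h (z₁ - 2 * p₁) * qpow h b * m2
    · intro a b hab
      have hn : (n : ℂ) = a + b + 1 := by exact_mod_cast hab.symm
      simp only [cgTerm, qrecip_succ_succ, ← qpow_add, pow_succ]
      -- At (ν+1, ν') and (ν, ν'+1) the falling factorials and reciprocals agree; the signs are
      -- opposite, so only the two powers of q have to match.
      rw [show z₁ + 1 + b = z₁ + (b + 1) by omega, show z₂ + 1 + a = z₂ + (a + 1) by omega]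
      have hexp : qpow h (2 * p₂ - z₂ + ((z₁ : ℂ) + 1 - (a + 1 : ℕ)))
            * qpow h (-((a + 1 : ℕ) : ℂ) * (2 * p₁ + 2 * p₂ - n + 1))
          = qpow h (z₁ - 2 * p₁ + -((z₂ : ℂ) + 1 - (b + 1 : ℕ)))
            * qpow h (-(a : ℂ) * (2 * p₁ + 2 * p₂ - n + 1)) := by
        rw [← qpow_add, ← qpow_add, hn]
        congr 1
        push_cast
        ring
      linear_combination (-(-1) ^ a * (qrecip h z₁ a * qrecip h z₂ b)
        * (qfall h (2 * p₁) (z₁ + (b + 1)) * qfall h (2 * p₂) (z₂ + (a + 1)))) * hexp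
  have pre1 : qpow h (((n : ℂ) - (n : ℂ) ^ 2) / 2 + ((n : ℂ) - z₂) * p₁
        + ((n : ℂ) + (z₁ + 1 : ℕ)) * p₂) * qpow h (p₂ - z₂)
      = qpow h (((n : ℂ) - (n : ℂ) ^ 2) / 2 + ((n : ℂ) - z₂) * p₁ + ((n : ℂ) + z₁) * p₂)
        * qpow h (2 * p₂ - z₂) := by
    rw [← qpow_add, ← qpow_add]; congr 1; push_cast; ring
  have pre2 : qpow h (((n : ℂ) - (n : ℂ) ^ 2) / 2 + ((n : ℂ) - (z₂ + 1 : ℕ)) * p₁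
        + ((n : ℂ) + z₁) * p₂) * qpow h (-(p₁ - z₁))
      = qpow h (((n : ℂ) - (n : ℂ) ^ 2) / 2 + ((n : ℂ) - z₂) * p₁ + ((n : ℂ) + z₁) * p₂)
        * qpow h (z₁ - 2 * p₁) := by
    rw [← qpow_add, ← qpow_add]; congr 1; push_cast; ring
  simp only [mul_add, sum_add_distrib, mul_left_comm _ (_ * qnum h _), ← mul_sum] at key
  simp only [mul_left_comm _ (qnum h _), ← mul_sum] at key
  simp only [cgFun]
  linear_combination qpow h (((n : ℂ) - (n : ℂ) ^ 2) / 2 + ((n : ℂ) - z₂) * p₁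
      + ((n : ℂ) + z₁) * p₂) * key
    + qnum h ((z₁ : ℂ) + 1) * (∑ x ∈ antidiagonal n, (qfact h x.1)⁻¹ * (qfact h x.2)⁻¹ *
      cgTerm h p₁ p₂ n (z₁ + 1) z₂ x.1 x.2) * pre1
    + qnum h ((z₂ : ℂ) + 1) * (∑ x ∈ antidiagonal n, (qfact h x.1)⁻¹ * (qfact h x.2)⁻¹ *
      cgTerm h p₁ p₂ n z₁ (z₂ + 1) x.1 x.2) * pre2

end CGFun

/-- The sequence `f` shifted by one, `0, f 0, f 1, …`. -/
def prev (f : ℕ → ℂ) : ℕ → ℂ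
  | 0 => 0
  | k + 1 => f k

@[simp] theorem prev_zero (f : ℕ → ℂ) : prev f 0 = 0 := rfl

@[simp] theorem prev_succ (f : ℕ → ℂ) (k : ℕ) : prev f (k + 1) = f k := rfl

theorem prev_sum {ι : Type*} (t : Finset ι) (c : ι → ℂ) (f : ι → ℕ → ℂ) (k : ℕ) :
    prev (fun w => ∑ x ∈ t, c x * f x w) k = ∑ x ∈ t, c x * prev (f x) k := by
  cases k <;> simp

section CGFunLower

variable {h : ℂ} (hq : ∀ n : ℕ, 0 < n → Complex.exp h ^ n ≠ 1) (p₁ p₂ : ℂ)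

include hq

theorem cgTerm_lower_left (n z₁ z₂ a b : ℕ) :
    qnum h (2 * p₁ - z₁ + 1) * prev (fun w => cgTerm h p₁ p₂ n w z₂ a b) z₁
      = qpow h b * (qnum h ((z₁ : ℂ) - a) * cgTerm h p₁ p₂ n z₁ z₂ a b)
        + qnum h b * (qpow h (-(2 * p₁ - z₁ + 1 - b))
          * prev (fun w => cgTerm h p₁ p₂ n w z₂ a b) z₁) := by
  rcases z₁ with _ | w
  · rcases a with _ | a
    · simp [qnum_zero]
    · simp [cgTerm, qrecip]
  · have e := qnum_add' h (2 * p₁ - (w + 1 : ℕ) + 1 - b) b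
    rw [sub_add_cancel] at e
    have m : qnum h (2 * p₁ - (w + 1 : ℕ) + 1 - b) * cgTerm h p₁ p₂ n w z₂ a b
        = qnum h (((w + 1 : ℕ) : ℂ) - a) * cgTerm h p₁ p₂ n (w + 1) z₂ a b := by
      simp only [cgTerm]
      rw [show w + 1 + b = w + b + 1 by omega, qfall_succ, qrecip_eq_mul hq w a]
      push_cast
      rw [show 2 * p₁ - ((w : ℂ) + b) = 2 * p₁ - (w + 1) + 1 - b by ring]
      ring
    rw [e, prev_succ]
    linear_combination qpow h b * m

theorem cgTerm_lower_right (n z₁ z₂ a b : ℕ) :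
    qnum h (2 * p₂ - z₂ + 1) * prev (fun w => cgTerm h p₁ p₂ n z₁ w a b) z₂
      = qpow h (-a) * (qnum h ((z₂ : ℂ) - b) * cgTerm h p₁ p₂ n z₁ z₂ a b)
        + qnum h a * (qpow h (2 * p₂ - z₂ + 1 - a)
          * prev (fun w => cgTerm h p₁ p₂ n z₁ w a b) z₂) := by
  rcases z₂ with _ | w
  · rcases b with _ | b
    · simp [qnum_zero]
    · simp [cgTerm, qrecip]
  · have e := qnum_add h (2 * p₂ - (w + 1 : ℕ) + 1 - a) a
    rw [sub_add_cancel] at e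
    have m : qnum h (2 * p₂ - (w + 1 : ℕ) + 1 - a) * cgTerm h p₁ p₂ n z₁ w a b
        = qnum h (((w + 1 : ℕ) : ℂ) - b) * cgTerm h p₁ p₂ n z₁ (w + 1) a b := by
      simp only [cgTerm]
      rw [show w + 1 + a = w + a + 1 by omega, qfall_succ, qrecip_eq_mul hq w b]
      push_cast
      rw [show 2 * p₂ - ((w : ℂ) + a) = 2 * p₂ - (w + 1) + 1 - a by ring]
      ring
    rw [e, prev_succ]
    linear_combination qpow h (-a) * m

/-- Same mechanism as `cgFun_raise`, with [2p_i-z_i+1] split instead of [z_i+1]. The use of `prev`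
includes z_i = 0, where X⁻ has no preimage. -/
theorem cgFun_lower (n z₁ z₂ : ℕ) :
    qnum h (2 * p₁ - z₁ + 1) * qpow h (p₂ - z₂) * prev (fun w => cgFun h p₁ p₂ n w z₂) z₁
      + qpow h (-(p₁ - z₁)) * qnum h (2 * p₂ - z₂ + 1) * prev (cgFun h p₁ p₂ n z₁) z₂
      = qnum h (((z₁ + z₂ : ℕ) : ℂ) - n) * cgFun h p₁ p₂ n z₁ z₂ := by
  have key : ∑ x ∈ antidiagonal n, (qfact h x.1)⁻¹ * (qfact h x.2)⁻¹ *
      (qpow h (-(z₂ : ℂ)) * (qnum h (2 * p₁ - z₁ + 1)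
          * prev (fun w => cgTerm h p₁ p₂ n w z₂ x.1 x.2) z₁)
        + qpow h z₁ * (qnum h (2 * p₂ - z₂ + 1)
          * prev (fun w => cgTerm h p₁ p₂ n z₁ w x.1 x.2) z₂))
      = ∑ x ∈ antidiagonal n, (qfact h x.1)⁻¹ * (qfact h x.2)⁻¹ *
        (qnum h (((z₁ + z₂ : ℕ) : ℂ) - n) * cgTerm h p₁ p₂ n z₁ z₂ x.1 x.2) := by
    rw [← sub_eq_zero, ← sum_sub_distrib]
    simp only [← mul_sub]
    rw [← sum_antidiagonal_telescope hq (n := n)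
      (fun a b => qpow h z₁ * (qpow h (2 * p₂ - z₂ + 1 - a)
          * prev (fun w => cgTerm h p₁ p₂ n z₁ w a b) z₂))
      (fun a b => qpow h (-(z₂ : ℂ)) * (qpow h (-(2 * p₁ - z₁ + 1 - b))
          * prev (fun w => cgTerm h p₁ p₂ n w z₂ a b) z₁))]
    · refine sum_congr rfl fun x hx => ?_
      congr 1
      obtain ⟨a, b⟩ := x
      have hn : a + b = n := by simpa using hx
      have m3 : qnum h (((z₁ + z₂ : ℕ) : ℂ) - n)
          = qpow h (-(z₂ : ℂ)) * qpow h b * qnum h ((z₁ : ℂ) - a)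
            + qpow h z₁ * qpow h (-a) * qnum h ((z₂ : ℂ) - b) := by
        rw [← hn, ← qpow_add, ← qpow_add]
        push_cast
        rw [show (z₁ : ℂ) + z₂ - (a + b) = (z₁ - a) + (z₂ - b) by ring, qnum_add]
        congr 3; ring_nf
      rw [cgTerm_lower_left hq, cgTerm_lower_right hq, m3]
      ring
    · intro a b hab
      have hn : (n : ℂ) = a + b + 1 := by exact_mod_cast hab.symm
      rcases z₁ with _ | y
      · rcases z₂ with _ | w
        · simp
        · simp [cgTerm, qrecip]
      rcases z₂ with _ | w
      · simp [cgTerm, qrecip]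
      simp only [cgTerm, qrecip_succ_succ, prev_succ, pow_succ]
      rw [show y + 1 + b = y + (b + 1) by omega, show w + 1 + a = w + (a + 1) by omega]
      have hexp : qpow h (y + 1 : ℕ) * (qpow h (2 * p₂ - (w + 1 : ℕ) + 1 - (a + 1 : ℕ))
            * qpow h (-((a + 1 : ℕ) : ℂ) * (2 * p₁ + 2 * p₂ - n + 1)))
          = qpow h (-((w + 1 : ℕ) : ℂ)) * (qpow h (-(2 * p₁ - (y + 1 : ℕ) + 1 - (b + 1 : ℕ)))
            * qpow h (-(a : ℂ) * (2 * p₁ + 2 * p₂ - n + 1))) := by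
        rw [← qpow_add, ← qpow_add, ← qpow_add, ← qpow_add, hn]
        congr 1
        push_cast
        ring
      linear_combination (-(-1) ^ a * (qrecip h y a * qrecip h w b)
        * (qfall h (2 * p₁) (y + (b + 1)) * qfall h (2 * p₂) (w + (a + 1)))) * hexp
  set X := qpow h (((n : ℂ) - (n : ℂ) ^ 2) / 2 + ((n : ℂ) - z₂) * p₁ + ((n : ℂ) + z₁) * p₂)
  have pre1 : qpow h (p₂ - z₂) * prev (fun w => cgFun h p₁ p₂ n w z₂) z₁ = X * qpow h (-(z₂ : ℂ)) *
      ∑ x ∈ antidiagonal n, (qfact h x.1)⁻¹ * (qfact h x.2)⁻¹ *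
        prev (fun w => cgTerm h p₁ p₂ n w z₂ x.1 x.2) z₁ := by
    rw [← prev_sum]
    rcases z₁ with _ | w
    · simp
    simp only [prev_succ, cgFun, X]
    rw [← qpow_add, ← mul_assoc, ← qpow_add]
    congr 2; push_cast; ring
  have pre2 : qpow h (-(p₁ - z₁)) * prev (cgFun h p₁ p₂ n z₁) z₂ = X * qpow h z₁ *
      ∑ x ∈ antidiagonal n, (qfact h x.1)⁻¹ * (qfact h x.2)⁻¹ *
        prev (fun w => cgTerm h p₁ p₂ n z₁ w x.1 x.2) z₂ := by
    rw [← prev_sum]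
    rcases z₂ with _ | w
    · simp
    simp only [prev_succ, cgFun, X]
    rw [← qpow_add, ← mul_assoc, ← qpow_add]
    congr 2; push_cast; ring
  simp only [mul_add, sum_add_distrib, mul_left_comm _ (qnum h _), ← mul_sum] at key
  simp only [mul_left_comm _ (qpow h _), ← mul_sum] at key
  rw [show cgFun h p₁ p₂ n z₁ z₂ = X * _ from rfl]
  linear_combination X * key + qnum h (2 * p₁ - z₁ + 1) * pre1 + qnum h (2 * p₂ - z₂ + 1) * pre2

end CGFunLower

end

end ColoredVertex

namespace ColoredVertex

noncomputable section

open Finset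

/-! ### Raising and lowering operators on `V^{(p₁)} ⊗ V^{(p₂)}`

Vectors are functions of two indices, in the basis in which `X⁺ e_{k+1} = [k+1]_q e_k` and
`X⁻ e_k = [2p - k]_q e_{k+1}`. -/

/-- `r₁ X⁺ ⊗ q^{εH/2} + r₂ q^{-εH/2} ⊗ X⁺`. -/
def raiseOp (h p₁ p₂ ε r₁ r₂ : ℂ) : (ℕ → ℕ → ℂ) →ₗ[ℂ] (ℕ → ℕ → ℂ) where
  toFun f a b := r₁ * qpow h (ε * (p₂ - b)) * qnum h ((a : ℂ) + 1) * f (a + 1) b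
    + r₂ * qpow h (-ε * (p₁ - a)) * qnum h ((b : ℂ) + 1) * f a (b + 1)
  map_add' f g := by ext a b; simp; ring
  map_smul' c f := by ext a b; simp; ring

/-- `r₁ X⁻ ⊗ q^{εH/2} + r₂ q^{-εH/2} ⊗ X⁻`. -/
def lowerOp (h p₁ p₂ ε r₁ r₂ : ℂ) : (ℕ → ℕ → ℂ) →ₗ[ℂ] (ℕ → ℕ → ℂ) where
  toFun f a b := r₁ * qpow h (ε * (p₂ - b)) * qnum h (2 * p₁ - a + 1) * prev (fun w => f w b) a
    + r₂ * qpow h (-ε * (p₁ - a)) * qnum h (2 * p₂ - b + 1) * prev (f a) b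
  map_add' f g := by ext a b; cases a <;> cases b <;> simp <;> ring
  map_smul' c f := by ext a b; cases a <;> cases b <;> simp <;> ring

theorem raiseOp_apply (h p₁ p₂ ε r₁ r₂ : ℂ) (f : ℕ → ℕ → ℂ) (a b : ℕ) :
    raiseOp h p₁ p₂ ε r₁ r₂ f a b = r₁ * qpow h (ε * (p₂ - b)) * qnum h ((a : ℂ) + 1) * f (a + 1) b
    + r₂ * qpow h (-ε * (p₁ - a)) * qnum h ((b : ℂ) + 1) * f a (b + 1) := rfl

theorem lowerOp_apply (h p₁ p₂ ε r₁ r₂ : ℂ) (f : ℕ → ℕ → ℂ) (a b : ℕ) :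
    lowerOp h p₁ p₂ ε r₁ r₂ f a b
      = r₁ * qpow h (ε * (p₂ - b)) * qnum h (2 * p₁ - a + 1) * prev (fun w => f w b) a
    + r₂ * qpow h (-ε * (p₁ - a)) * qnum h (2 * p₂ - b + 1) * prev (f a) b := rfl

/-- Exchange of the tensor factors. -/
def swapFun (f : ℕ → ℕ → ℂ) : ℕ → ℕ → ℂ := fun a b => f b a

/-- The sign change of ε is the passage between the coproduct and the opposite coproduct, which is
what R has to intertwine. -/
theorem raiseOp_swap (h p₁ p₂ ε r₁ r₂ : ℂ) (f : ℕ → ℕ → ℂ) :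
    raiseOp h p₁ p₂ ε r₁ r₂ (swapFun f) = swapFun (raiseOp h p₂ p₁ (-ε) r₂ r₁ f) := by
  ext a b
  simp only [raiseOp_apply, swapFun, neg_neg]
  ring

theorem lowerOp_swap (h p₁ p₂ ε r₁ r₂ : ℂ) (f : ℕ → ℕ → ℂ) :
    lowerOp h p₁ p₂ ε r₁ r₂ (swapFun f) = swapFun (lowerOp h p₂ p₁ (-ε) r₂ r₁ f) := by
  ext a b
  rcases a with _ | a <;> rcases b with _ | b <;>
    simp only [lowerOp_apply, swapFun, neg_neg, prev_zero, prev_succ] <;> ring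

section Commute

variable (h p₁ p₂ : ℂ)

theorem lowerOp_congr (ε r₁ r₂ : ℂ) {f g : ℕ → ℕ → ℂ} {N : ℕ}
    (hfg : ∀ a b, a + b = N → f a b = g a b) (a b : ℕ) (hab : a + b = N + 1) :
    lowerOp h p₁ p₂ ε r₁ r₂ f a b = lowerOp h p₁ p₂ ε r₁ r₂ g a b := by
  rw [lowerOp_apply, lowerOp_apply]
  congr 2
  · rcases a with _ | a
    · rfl
    · exact hfg _ _ (by omega)
  · rcases b with _ | b
    · rfl
    · exact hfg _ _ (by omega)

theorem raiseOp_congr (ε r₁ r₂ : ℂ) {f g : ℕ → ℕ → ℂ} {N : ℕ}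
    (hfg : ∀ a b, a + b = N + 1 → f a b = g a b) (a b : ℕ) (hab : a + b = N) :
    raiseOp h p₁ p₂ ε r₁ r₂ f a b = raiseOp h p₁ p₂ ε r₁ r₂ g a b := by
  rw [raiseOp_apply, raiseOp_apply, hfg _ _ (by omega), hfg _ _ (by omega)]

/-- This is the relation [X_0^+, X_1^-] = 0 of the affine algebra in an evaluation module: the
powers of q from moving X⁻ past q^{±H/2} in the two factors compensate. The cases separate the first
two values of each index because two lowerings reach back two steps. -/
theorem lowerOp_comm (r₁ r₂ s₁ s₂ : ℂ) (f : ℕ → ℕ → ℂ) :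
    lowerOp h p₁ p₂ 1 r₁ r₂ (lowerOp h p₁ p₂ (-1) s₁ s₂ f)
      = lowerOp h p₁ p₂ (-1) s₁ s₂ (lowerOp h p₁ p₂ 1 r₁ r₂ f) := by
  have h1 := qpow_ne_zero h 1
  have h2 := qpow_ne_zero h p₁
  have h3 := qpow_ne_zero h p₂
  ext a b
  have h4 := qpow_ne_zero h a
  have h5 := qpow_ne_zero h b
  rcases a with _ | _ | a <;> rcases b with _ | _ | b <;>
    simp only [lowerOp_apply, prev_zero, prev_succ, mul_zero, zero_add, add_zero, neg_neg, one_mul,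
      neg_one_mul] <;> push_cast at * <;> simp only [qpow_add, qpow_sub, qpow_neg, qpow_zero] at * <;>
    field_simp <;> ring

end Commute

/-! ### The invariant bilinear form -/

/-- The form for which `X⁺` and `X⁻` are adjoint, on the component of degree `N`. -/
def form (h p₁ p₂ : ℂ) (N : ℕ) (f g : ℕ → ℕ → ℂ) : ℂ :=
  ∑ x ∈ antidiagonal N, (qfact h x.1 / qfall h (2 * p₁) x.1) * (qfact h x.2 / qfall h (2 * p₂) x.2)
    * (f x.1 x.2 * g x.1 x.2)

section Form

variable {h p₁ p₂ : ℂ}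

theorem form_comm (N : ℕ) (f g : ℕ → ℕ → ℂ) : form h p₁ p₂ N f g = form h p₁ p₂ N g f := by
  simp only [form, mul_comm (f _ _)]

theorem form_congr {N : ℕ} {f f' g g' : ℕ → ℕ → ℂ} (hf : ∀ a b, a + b = N → f a b = f' a b)
    (hg : ∀ a b, a + b = N → g a b = g' a b) : form h p₁ p₂ N f g = form h p₁ p₂ N f' g' := by
  refine sum_congr rfl fun x hx => ?_
  rw [hf _ _ (HasAntidiagonal.mem_antidiagonal.1 hx), hg _ _ (HasAntidiagonal.mem_antidiagonal.1 hx)]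

theorem form_smul_left (N : ℕ) (c : ℂ) (f g : ℕ → ℕ → ℂ) :
    form h p₁ p₂ N (c • f) g = c * form h p₁ p₂ N f g := by
  simp only [form, mul_sum, Pi.smul_apply, smul_eq_mul]
  exact sum_congr rfl fun x _ => by ring

theorem form_add_left (N : ℕ) (f f' g : ℕ → ℕ → ℂ) :
    form h p₁ p₂ N (f + f') g = form h p₁ p₂ N f g + form h p₁ p₂ N f' g := by
  simp only [form, ← sum_add_distrib, Pi.add_apply]
  exact sum_congr rfl fun x _ => by ring

theorem form_smul_right (N : ℕ) (c : ℂ) (f g : ℕ → ℕ → ℂ) :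
    form h p₁ p₂ N f (c • g) = c * form h p₁ p₂ N f g := by
  rw [form_comm, form_smul_left, form_comm]

theorem form_add_right (N : ℕ) (f g g' : ℕ → ℕ → ℂ) :
    form h p₁ p₂ N f (g + g') = form h p₁ p₂ N f g + form h p₁ p₂ N f g' := by
  rw [form_comm, form_add_left, form_comm, form_comm _ _ g']

theorem form_zero_left (N : ℕ) (g : ℕ → ℕ → ℂ) : form h p₁ p₂ N 0 g = 0 := by
  simp [form]

theorem form_swap (N : ℕ) (f g : ℕ → ℕ → ℂ) :
    form h p₁ p₂ N (swapFun f) (swapFun g) = form h p₂ p₁ N f g := by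
  rw [form, form, ← Nat.sum_antidiagonal_swap]
  exact sum_congr rfl fun x _ => by simp only [swapFun, Prod.fst_swap, Prod.snd_swap]; ring

variable (hp₁ : ∀ k : ℕ, qnum h (2 * p₁ - k) ≠ 0) (hp₂ : ∀ k : ℕ, qnum h (2 * p₂ - k) ≠ 0)

include hp₁ hp₂

/-- The weight of e_{k+1} divided by that of e_k is [k+1]/[2p-k], exactly the ratio of the
coefficients of X⁺ and X⁻. The powers of q^{±H/2} are diagonal and do not interfere. -/
theorem form_raiseOp (ε r₁ r₂ : ℂ) (N : ℕ) (f g : ℕ → ℕ → ℂ) :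
    form h p₁ p₂ N (raiseOp h p₁ p₂ ε r₁ r₂ f) g
      = form h p₁ p₂ (N + 1) f (lowerOp h p₁ p₂ ε r₁ r₂ g) := by
  simp only [form, raiseOp_apply, lowerOp_apply, mul_add, add_mul, sum_add_distrib]
  congr 1
  · rw [Nat.sum_antidiagonal_succ]
    simp only [prev_zero, mul_zero, zero_add, prev_succ]
    refine sum_congr rfl fun x _ => ?_
    have := hp₁ x.1
    rw [qfact_succ, qfall_succ]
    push_cast
    rw [show 2 * p₁ - (x.1 + 1 : ℂ) + 1 = 2 * p₁ - x.1 by ring]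
    field_simp
  · rw [Nat.sum_antidiagonal_succ']
    simp only [prev_zero, mul_zero, zero_add, prev_succ]
    refine sum_congr rfl fun x _ => ?_
    have := hp₂ x.2
    rw [qfact_succ, qfall_succ]
    push_cast
    rw [show 2 * p₂ - (x.2 + 1 : ℂ) + 1 = 2 * p₂ - x.2 by ring]
    field_simp

theorem form_lowerOp (ε r₁ r₂ : ℂ) (N : ℕ) (f g : ℕ → ℕ → ℂ) :
    form h p₁ p₂ (N + 1) (lowerOp h p₁ p₂ ε r₁ r₂ f) g
      = form h p₁ p₂ N f (raiseOp h p₁ p₂ ε r₁ r₂ g) := by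
  rw [form_comm, ← form_raiseOp hp₁ hp₂, form_comm]

end Form

end

end ColoredVertex

namespace ColoredVertex

noncomputable section

open Finset

/-! ### The three-term expansion of `(r₁ X⁻ ⊗ q^{-H/2} + r₂ q^{H/2} ⊗ X⁻) |n⟩` -/

section Polynomial

/-- `(x - x⁻¹) / (q - q⁻¹)`. -/
def br (q x : ℂ) : ℂ := (x - x⁻¹) / (q - q⁻¹)

theorem qnum_eq_br (h z : ℂ) : qnum h z = br (qpow h 1) (qpow h z) := by
  rw [qnum, br, qpow_neg, qpow_neg]

/-- Dictionary for this part: x = q^{p₁}, y = q^{p₂}, t = q^a, and j is q to the power of the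
highest weight p₁+p₂-n. With a+b = n+1, `coeffL1` is [2p₁-a+1][a] and `coeffL2` is [2p₂-b+1][b]. -/
def coeffL1 (q x t : ℂ) : ℂ := br q (x ^ 2 * t⁻¹ * q) * br q t

def coeffL2 (q x y j t : ℂ) : ℂ := br q (y * x⁻¹ * j * t) * br q (x * y * j⁻¹ * q * t⁻¹)

/-- The value of X⁻ applied once to a top vector, divided by that top vector's expression at the new
point. -/
def lowF (q x y j t : ℂ) : ℂ :=
  -(j ^ 2 * x⁻¹ * t) * coeffL1 q x t + t * x⁻¹ * coeffL2 q x y j t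

/-- The same after two lowerings. The argument j is that of the next component n+1, so the component
lowered twice has parameter jq. With this normalisation all three terms of the expansion carry the
same j. -/
def lowFF (q x y j t : ℂ) : ℂ :=
  -(j ^ 2 * x⁻¹ * t) * (q * coeffL1 q x t) * lowF q x y (j * q) (t * q⁻¹)
    + t * x⁻¹ * coeffL2 q x y j t * lowF q x y (j * q) t

variable {q x y j t : ℂ} (hq : q ≠ 0) (hx : x ≠ 0) (hy : y ≠ 0) (hj : j ≠ 0) (ht : t ≠ 0)
  (hd : q - q⁻¹ ≠ 0)

include hq hx hy hj ht

theorem lowF_eq : lowF q x y j t = t * (x⁻¹ * ((y ^ 2 * q + (y ^ 2 * q)⁻¹)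
      - j ^ 2 * (x ^ 2 * q + (x ^ 2 * q)⁻¹)) + x * q * (j ^ 2 - (j ^ 2)⁻¹) * (t ^ 2)⁻¹)
      / (q - q⁻¹) ^ 2 := by
  simp only [lowF, coeffL1, coeffL2, br]
  field_simp
  ring

include hd

/-- The coefficient of r₁ in the three-term expansion, as an identity of rational functions;
`lowQ_eq` is the coefficient of r₂. The factors t and t⁻¹ arise because the top vectors of the
neighbouring components differ by q^{±a} apart from constants. -/
theorem lowP_eq (h0 : j ^ 2 - (j ^ 2)⁻¹ ≠ 0) (h1 : j ^ 2 * q - (j ^ 2 * q)⁻¹ ≠ 0)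
    (h2 : j ^ 2 * q ^ 2 - (j ^ 2 * q ^ 2)⁻¹ ≠ 0) : 
    -(x * q ^ 2 * t⁻¹) * coeffL1 q x t =
      - x⁻¹ * (br q (x * y * j⁻¹ * q) * br q (x * y⁻¹ * j) * br q (y * x⁻¹ * j) * br q (x * y * j * q)
        / (br q (j ^ 2) * br q (j ^ 2 * q))) * t
      + ((x ^ 2 * q + (x ^ 2 * q)⁻¹) * (j ^ 2 * q + (j ^ 2 * q)⁻¹)
          - (q + q⁻¹) * (y ^ 2 * q + (y ^ 2 * q)⁻¹))
        / ((j ^ 2 - (j ^ 2)⁻¹) * (j ^ 2 * q ^ 2 - (j ^ 2 * q ^ 2)⁻¹)) * lowF q x y j t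
      + x / (br q (j ^ 2 * q) * br q (j ^ 2 * q ^ 2)) * (t⁻¹ * lowFF q x y j t) := by
  simp only [lowFF, lowF_eq hq hx hy (mul_ne_zero hj hq) ht, coeffL1, coeffL2, br,
    lowF_eq hq hx hy (mul_ne_zero hj hq) (mul_ne_zero ht (inv_ne_zero hq)),
    lowF_eq hq hx hy hj ht]
  -- The denominators are kept as atoms while fractions are cleared and are substituted back only
  -- for the final polynomial identity.
  generalize ed : q - q⁻¹ = d at *
  generalize e0 : j ^ 2 - (j ^ 2)⁻¹ = d0 at *
  generalize e1 : j ^ 2 * q - (j ^ 2 * q)⁻¹ = d1 at *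
  generalize e2 : j ^ 2 * q ^ 2 - (j ^ 2 * q ^ 2)⁻¹ = d2 at *
  have : d2 ≠ 0 := h2
  field_simp
  subst e0 e1 e2
  field_simp
  ring

theorem lowQ_eq (h0 : j ^ 2 - (j ^ 2)⁻¹ ≠ 0) (h1 : j ^ 2 * q - (j ^ 2 * q)⁻¹ ≠ 0)
    (h2 : j ^ 2 * q ^ 2 - (j ^ 2 * q ^ 2)⁻¹ ≠ 0) : 
    x * t⁻¹ * coeffL2 q x y j t =
      x⁻¹ * j ^ 2 * (br q (x * y * j⁻¹ * q) * br q (x * y⁻¹ * j) * br q (y * x⁻¹ * j)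
        * br q (x * y * j * q) / (br q (j ^ 2) * br q (j ^ 2 * q))) * t
      + ((y ^ 2 * q + (y ^ 2 * q)⁻¹) * (j ^ 2 * q + (j ^ 2 * q)⁻¹)
          - (q + q⁻¹) * (x ^ 2 * q + (x ^ 2 * q)⁻¹))
        / ((j ^ 2 - (j ^ 2)⁻¹) * (j ^ 2 * q ^ 2 - (j ^ 2 * q ^ 2)⁻¹)) * lowF q x y j t
      - x * (j ^ 2 * q ^ 2)⁻¹ / (br q (j ^ 2 * q) * br q (j ^ 2 * q ^ 2)) * (t⁻¹ * lowFF q x y j t) := by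
  simp only [lowFF, lowF_eq hq hx hy (mul_ne_zero hj hq) ht, coeffL1, coeffL2, br,
    lowF_eq hq hx hy (mul_ne_zero hj hq) (mul_ne_zero ht (inv_ne_zero hq)),
    lowF_eq hq hx hy hj ht]
  generalize ed : q - q⁻¹ = d at *
  generalize e0 : j ^ 2 - (j ^ 2)⁻¹ = d0 at *
  generalize e1 : j ^ 2 * q - (j ^ 2 * q)⁻¹ = d1 at *
  generalize e2 : j ^ 2 * q ^ 2 - (j ^ 2 * q ^ 2)⁻¹ = d2 at *
  have : d2 ≠ 0 := h2
  field_simp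
  subst e0 e1 e2
  field_simp
  ring

end Polynomial

end

end ColoredVertex

/-! ### Highest weight vectors and their first two descendants -/

namespace ColoredVertex

noncomputable section

open Finset

/-- The highest weight vector of the component `n`, up to normalization. -/
def topFun (h c : ℂ) (a b : ℕ) : ℂ := (-1) ^ a * qpow h (a * c) * ((qfact h a)⁻¹ * (qfact h b)⁻¹)

theorem topFun_add (h c c' : ℂ) (a b : ℕ) :
    topFun h (c + c') a b = topFun h c a b * qpow h (a * c') := by
  rw [topFun, topFun, mul_add, qpow_add]
  ring

def topConst (h p₁ p₂ : ℂ) (n : ℕ) : ℂ :=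
  qpow h (((n : ℂ) - (n : ℂ) ^ 2) / 2 + n * p₂) * (qfall h (2 * p₁) n * qfall h (2 * p₂) n)

theorem topConst_succ (h p₁ p₂ : ℂ) (n : ℕ) : topConst h p₁ p₂ (n + 1) =
    topConst h p₁ p₂ n * (qpow h (p₂ - n) * (qnum h (2 * p₁ - n) * qnum h (2 * p₂ - n))) := by
  have : qpow h ((((n + 1 : ℕ) : ℂ) - ((n + 1 : ℕ) : ℂ) ^ 2) / 2 + (n + 1 : ℕ) * p₂)
      = qpow h (((n : ℂ) - (n : ℂ) ^ 2) / 2 + n * p₂) * qpow h (p₂ - n) := by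
    rw [← qpow_add]; congr 1; push_cast; ring
  rw [topConst, topConst, qfall_succ, qfall_succ, this]
  ring

section

variable {h : ℂ} (hq : ∀ n : ℕ, 0 < n → Complex.exp h ^ n ≠ 1) (p₁ p₂ : ℂ)

/-- In degree a+b = n the conditions ν ≤ a and ν' ≤ b force (ν, ν') = (a, b), so the sum has a
single term. -/
theorem cgFun_top {n a b : ℕ} (hab : a + b = n) :
    cgFun h p₁ p₂ n a b = topConst h p₁ p₂ n * topFun h (n - 1 - p₁ - p₂) a b := by
  have hn : (n : ℂ) = a + b := by exact_mod_cast hab.symm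
  have e : qpow h (((n : ℂ) - (n : ℂ) ^ 2) / 2 + ((n : ℂ) - b) * p₁ + ((n : ℂ) + a) * p₂)
      * qpow h (-(a : ℂ) * (2 * p₁ + 2 * p₂ - n + 1))
      = qpow h (((n : ℂ) - (n : ℂ) ^ 2) / 2 + n * p₂) * qpow h (a * (n - 1 - p₁ - p₂)) := by
    rw [← qpow_add, ← qpow_add, hn]; congr 1; ring
  rw [cgFun, sum_eq_single_of_mem (a, b) (by simpa using hab)]
  · simp only [cgTerm, qrecip, le_refl, if_true, Nat.sub_self, qfact_zero, hab, inv_one, mul_one,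
      add_comm b a, topConst, topFun]
    linear_combination (qfact h a)⁻¹ * (qfact h b)⁻¹ * (-1) ^ a
      * (qfall h (2 * p₁) n * qfall h (2 * p₂) n) * e
  · rintro ⟨x, y⟩ hx hne
    have hxy : x + y = n := by simpa using hx
    have : a < x ∨ b < y := by
      by_contra hc
      exact hne (by ext <;> simp <;> omega)
    rcases this with h1 | h1 <;> simp [cgTerm, qrecip_of_lt h1]

include hq

/-- The shifts a-1 and b-1 are taken in ℂ. At a = 0 or b = 0 the corresponding term has the factor
[0], so the values of G there do not matter. -/
theorem lowerOp_topFun (ε r₁ r₂ c : ℂ) (G : ℂ → ℂ → ℂ) (a b : ℕ) :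
    lowerOp h p₁ p₂ ε r₁ r₂ (fun a b => topFun h c a b * G a b) a b = topFun h c a b *
      (r₁ * (-(qpow h (ε * (p₂ - b)) * qpow h (-c))
          * (qnum h (2 * p₁ - a + 1) * qnum h a)) * G (a - 1) b
        + r₂ * (qpow h (-ε * (p₁ - a)) * (qnum h (2 * p₂ - b + 1) * qnum h b)) * G a (b - 1)) := by
  rw [lowerOp_apply, mul_add]
  congr 1
  · rcases a with _ | a
    · simp [qnum_zero]
    · have h1 := qfact_ne_zero hq a
      have h2 := qnum_natCast_add_one_ne_zero hq a
      have e : qpow h ((a + 1 : ℕ) * c) * qpow h (-c) = qpow h (a * c) := by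
        rw [← qpow_add]; congr 1; push_cast; ring
      simp only [prev_succ, topFun]
      rw [← e, qfact_succ, show ((a + 1 : ℕ) : ℂ) - 1 = a by push_cast; ring, pow_succ]
      push_cast
      field_simp
  · rcases b with _ | b
    · simp [qnum_zero]
    · have h1 := qfact_ne_zero hq b
      have h2 := qnum_natCast_add_one_ne_zero hq b
      simp only [prev_succ, topFun]
      rw [qfact_succ, show ((b + 1 : ℕ) : ℂ) - 1 = b by push_cast; ring]
      push_cast
      field_simp

theorem raiseOp_cgFun (n : ℕ) : raiseOp h p₁ p₂ 1 1 1 (cgFun h p₁ p₂ n)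
    = fun a b => qnum h (2 * p₁ + 2 * p₂ - n - ((a + b : ℕ) : ℂ)) * cgFun h p₁ p₂ n a b := by
  ext a b
  rw [← cgFun_raise hq, raiseOp_apply]
  simp only [one_mul, neg_one_mul]
  ring

theorem lowerOp_cgFun (n : ℕ) : lowerOp h p₁ p₂ 1 1 1 (cgFun h p₁ p₂ n)
    = fun a b => qnum h (((a + b : ℕ) : ℂ) - n) * cgFun h p₁ p₂ n a b := by
  ext a b
  rw [← cgFun_lower hq, lowerOp_apply]
  simp only [one_mul, neg_one_mul]
  ring

/-- The values of the function `lowF` along the component of degree `n + 1`. -/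
theorem cgFun_top_succ {n a b : ℕ} (hab : a + b = n + 1) :
    cgFun h p₁ p₂ n a b = topConst h p₁ p₂ n * (topFun h (n - 1 - p₁ - p₂) a b *
      lowF (qpow h 1) (qpow h p₁) (qpow h p₂) (qpow h (p₁ + p₂ - n)) (qpow h a)) := by
  have h1 := congr_fun (congr_fun (lowerOp_cgFun hq p₁ p₂ n) a) b
  simp only [hab] at h1
  rw [show ((n + 1 : ℕ) : ℂ) - n = 1 by push_cast; ring, qnum_one hq, one_mul] at h1
  rw [← h1, lowerOp_congr h p₁ p₂ 1 1 1 (N := n) (g := topConst h p₁ p₂ n •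
    fun a b => topFun h (n - 1 - p₁ - p₂) a b * (fun _ _ => (1 : ℂ)) (a : ℂ) (b : ℂ)) _ a b hab,
    map_smul, Pi.smul_apply, Pi.smul_apply, smul_eq_mul,
    lowerOp_topFun hq p₁ p₂ 1 1 1 _ (fun _ _ => 1)]
  · have hb : (b : ℂ) = n + 1 - a := by rw [eq_sub_iff_add_eq']; exact_mod_cast hab
    congr 2
    simp only [hb, lowF, coeffL1, coeffL2, qnum_eq_br, one_mul, neg_one_mul, mul_one]
    simp only [← qpow_add, ← qpow_neg, ← qpow_two_mul, neg_mul]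
    ring_nf
  · intro x y hxy
    simp [cgFun_top p₁ p₂ hxy]

/-- Two applications of X⁻ to the top vector give [1][2] times the value of `cgFun` two degrees up,
hence the factor [2]. -/
theorem cgFun_top_succ_succ {n a b : ℕ} (hab : a + b = n + 2) :
    qnum h 2 * cgFun h p₁ p₂ n a b = topConst h p₁ p₂ n * (topFun h (n - 1 - p₁ - p₂) a b *
      lowFF (qpow h 1) (qpow h p₁) (qpow h p₂) (qpow h (p₁ + p₂ - n - 1)) (qpow h a)) := by
  have h1 := congr_fun (congr_fun (lowerOp_cgFun hq p₁ p₂ n) a) b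
  simp only [hab] at h1
  rw [show ((n + 2 : ℕ) : ℂ) - n = 2 by push_cast; ring] at h1
  rw [← h1, lowerOp_congr h p₁ p₂ 1 1 1 (N := n + 1) (g := topConst h p₁ p₂ n •
    fun a b => topFun h (n - 1 - p₁ - p₂) a b * (fun x _ => lowF (qpow h 1) (qpow h p₁) (qpow h p₂)
      (qpow h (p₁ + p₂ - n)) (qpow h x)) (a : ℂ) (b : ℂ)) _ a b hab,
    map_smul, Pi.smul_apply, Pi.smul_apply, smul_eq_mul,
    lowerOp_topFun hq p₁ p₂ 1 1 1 _ (fun x _ => lowF (qpow h 1) (qpow h p₁) (qpow h p₂)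
      (qpow h (p₁ + p₂ - n)) (qpow h x))]
  · have hb : (b : ℂ) = n + 2 - a := by rw [eq_sub_iff_add_eq']; exact_mod_cast hab
    congr 2
    rw [lowFF, ← qpow_add h (p₁ + p₂ - n - 1), sub_add_cancel, ← qpow_sub]
    congr 2
    · simp only [hb, coeffL1, qnum_eq_br, one_mul]
      simp only [← qpow_add, ← qpow_neg, ← qpow_two_mul, neg_mul, ← mul_assoc]
      ring_nf
    · simp only [hb, coeffL2, qnum_eq_br, one_mul, neg_one_mul]
      simp only [← qpow_add, ← qpow_neg]
      ring_nf
  · intro x y hxy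
    simp [cgFun_top_succ hq p₁ p₂ hxy]

end

end

end ColoredVertex

/-! ### Action of the affine generator X_0^+ on highest weight vectors -/

namespace ColoredVertex

noncomputable section

open Finset

/-- `expandUp`, `expandStay` and `expandDown` are the reduced matrix elements towards the components
n+1, n and n-1, read off from `lowP_eq` and `lowQ_eq`. The last one is indexed by its target. -/
def expandUp (h p₁ p₂ : ℂ) (n : ℕ) : ℂ :=
  qpow h (n - p₁ - p₂) * (qnum h ((n : ℂ) + 1) * qnum h (2 * p₁ + 2 * p₂ - n + 1)
    / (qnum h (2 * (p₁ + p₂ - n) + 1) * qnum h (2 * (p₁ + p₂ - n))))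

def expandStay (h p₁ p₂ : ℂ) (n : ℕ) : ℂ :=
  ((qpow h (2 * p₁ + 1) + qpow h (-(2 * p₁ + 1)))
      * (qpow h (2 * (p₁ + p₂ - n) + 1) + qpow h (-(2 * (p₁ + p₂ - n) + 1)))
    - (qpow h 1 + qpow h (-1)) * (qpow h (2 * p₂ + 1) + qpow h (-(2 * p₂ + 1))))
  / ((qpow h (2 * (p₁ + p₂ - n)) - qpow h (-(2 * (p₁ + p₂ - n))))
    * (qpow h (2 * (p₁ + p₂ - n) + 2) - qpow h (-(2 * (p₁ + p₂ - n) + 2))))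

def expandDown (h p₁ p₂ : ℂ) (n : ℕ) : ℂ :=
  qnum h 2 * (qnum h (2 * p₁ - n) * qnum h (2 * p₂ - n))
    / (qnum h (2 * (p₁ + p₂ - n)) * qnum h (2 * (p₁ + p₂ - n) - 1))

/-- No q-number in the denominators of the expansion coefficients vanishes. -/
def CGGeneric (h p₁ p₂ : ℂ) : Prop := ∀ k : ℕ, qnum h (2 * p₁ + 2 * p₂ + 2 - k) ≠ 0

theorem CGGeneric.symm {h p₁ p₂ : ℂ} (hc : CGGeneric h p₁ p₂) : CGGeneric h p₂ p₁ := by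
  intro k
  rw [add_comm (2 * p₂)]
  exact hc k

section

variable {h : ℂ} (hq : ∀ n : ℕ, 0 < n → Complex.exp h ^ n ≠ 1) {p₁ p₂ : ℂ}

theorem qpow_sub_ne_zero {z : ℂ} (hz : qnum h z ≠ 0) : qpow h z - qpow h (-z) ≠ 0 := by
  intro h0
  exact hz (by rw [qnum, h0, zero_div])

include hq

/-- The third term is left as `lowFF` instead of component n-1, so that one computation covers n =
0, where no lower component exists. -/
theorem lowerOp_cgFun_aux (hc : CGGeneric h p₁ p₂) (r₁ r₂ : ℂ) {n a b : ℕ} (hab : a + b = n + 1) :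
    lowerOp h p₁ p₂ (-1) r₁ r₂ (cgFun h p₁ p₂ n) a b =
      expandUp h p₁ p₂ n * (r₂ * qpow h (2 * (p₁ + p₂ - n)) - r₁) * cgFun h p₁ p₂ (n + 1) a b
      + (r₁ * expandStay h p₁ p₂ n + r₂ * expandStay h p₂ p₁ n) * cgFun h p₁ p₂ n a b
      + (r₁ * qpow h (p₁ + p₂ - n + 1) - r₂ * qpow h (-(p₁ + p₂ - n + 1)))
        * (topConst h p₁ p₂ n * qpow h (n - 1 - p₂) / (qnum h (2 * (p₁ + p₂ - n) + 1) *
          qnum h (2 * (p₁ + p₂ - n) + 2)) * (topFun h (n - 2 - p₁ - p₂) a b *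
      lowFF (qpow h 1) (qpow h p₁) (qpow h p₂) (qpow h (p₁ + p₂ - n)) (qpow h a))) := by
  have hb : (b : ℂ) = n + 1 - a := by rw [eq_sub_iff_add_eq']; exact_mod_cast hab
  have k0 : qnum h (2 * (p₁ + p₂ - n)) ≠ 0 := by
    convert hc (2 * n + 2) using 2; push_cast; ring
  have k1 : qnum h (2 * (p₁ + p₂ - n) + 1) ≠ 0 := by
    convert hc (2 * n + 1) using 2; push_cast; ring
  have k2 : qnum h (2 * (p₁ + p₂ - n) + 2) ≠ 0 := by
    convert hc (2 * n) using 2; push_cast; ring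
  have k0' := qpow_sub_ne_zero k0
  have k1' := qpow_sub_ne_zero k1
  have k2' := qpow_sub_ne_zero k2
  have hd := q_sub_inv_ne_zero hq
  rw [lowerOp_congr h p₁ p₂ (-1) r₁ r₂ (N := n) (g := topConst h p₁ p₂ n •
    fun a b => topFun h (n - 1 - p₁ - p₂) a b * (fun _ _ => (1 : ℂ)) (a : ℂ) (b : ℂ)) _ a b hab,
    map_smul, Pi.smul_apply, Pi.smul_apply, smul_eq_mul,
    lowerOp_topFun hq p₁ p₂ (-1) r₁ r₂ _ (fun _ _ => 1),
    cgFun_top_succ hq p₁ p₂ hab, cgFun_top p₁ p₂ hab, topConst_succ,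
    show ((n + 1 : ℕ) : ℂ) - 1 - p₁ - p₂ = (n - 1 - p₁ - p₂) + 1 by push_cast; ring, topFun_add,
    show (n : ℂ) - 2 - p₁ - p₂ = (n - 1 - p₁ - p₂) + -1 by ring, topFun_add]
  · have eJ : qpow h (2 * (p₁ + p₂ - n)) = qpow h (p₁ + p₂ - n) ^ 2 := qpow_two_mul _ _
    have hP := lowP_eq (qpow_ne_zero h 1) (qpow_ne_zero h p₁) (qpow_ne_zero h p₂)
      (qpow_ne_zero h (p₁ + p₂ - n)) (qpow_ne_zero h a)
      (by rwa [← qpow_neg]) (by rwa [← qpow_two_mul, ← qpow_neg])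
      (by rwa [← qpow_two_mul, ← qpow_add, ← qpow_neg])
      (by rwa [← qpow_two_mul, ← qpow_two_mul, ← qpow_add, ← qpow_neg, mul_one])
    have hQ := lowQ_eq (qpow_ne_zero h 1) (qpow_ne_zero h p₁) (qpow_ne_zero h p₂)
      (qpow_ne_zero h (p₁ + p₂ - n)) (qpow_ne_zero h a)
      (by rwa [← qpow_neg]) (by rwa [← qpow_two_mul, ← qpow_neg])
      (by rwa [← qpow_two_mul, ← qpow_add, ← qpow_neg])
      (by rwa [← qpow_two_mul, ← qpow_two_mul, ← qpow_add, ← qpow_neg, mul_one])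
    simp only [← qpow_two_mul, ← qpow_neg, ← qpow_add, ← qnum_eq_br, mul_one] at hP hQ
    have e1 : -(qpow h (-1 * (p₂ - b)) * qpow h (-(n - 1 - p₁ - p₂)))
          * (qnum h (2 * p₁ - a + 1) * qnum h a) =
        -qpow h (p₁ + 2 + -a) * coeffL1 (qpow h 1) (qpow h p₁) (qpow h a) := by
      simp only [coeffL1, ← qpow_two_mul, ← qpow_neg, ← qpow_add, ← qnum_eq_br, hb]
      ring_nf
    have e2 : qpow h (-(-1) * (p₁ - a)) * (qnum h (2 * p₂ - b + 1) * qnum h b) =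
        qpow h (p₁ + -a) * coeffL2 (qpow h 1) (qpow h p₁) (qpow h p₂) (qpow h (p₁ + p₂ - n))
          (qpow h a) := by
      simp only [coeffL2, ← qpow_neg, ← qpow_add, ← qnum_eq_br, hb]
      ring_nf
    have g1 : qpow h (-p₁) = qpow h (n - p₁ - p₂) * qpow h (p₂ - n) := by
      rw [← qpow_add]; congr 1; ring
    have g2 : qpow h p₁ = qpow h (p₁ + p₂ - n + 1) * qpow h (n - 1 - p₂) := by
      rw [← qpow_add]; congr 1; ring
    have g3 : qpow h (p₁ + -(2 * (p₁ + p₂ - n) + 2))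
        = qpow h (-(p₁ + p₂ - n + 1)) * qpow h (n - 1 - p₂) := by
      rw [← qpow_add]; congr 1; ring
    rw [e1, e2, hP, hQ]
    clear hP hQ e1 e2
    rw [show p₁ + p₂ + -(p₁ + p₂ - n) + 1 = (n : ℂ) + 1 by ring,
      show p₁ + -p₂ + (p₁ + p₂ - n) = 2 * p₁ - n by ring,
      show p₂ + -p₁ + (p₁ + p₂ - n) = 2 * p₂ - n by ring,
      show p₁ + p₂ + (p₁ + p₂ - n) + 1 = 2 * p₁ + 2 * p₂ - n + 1 by ring]
    simp only [expandUp, expandStay, mul_one, mul_neg_one, add_comm p₂ p₁]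
    generalize lowF _ _ _ _ _ = L
    generalize lowFF _ _ _ _ _ = L'
    rw [qpow_add h (-p₁), g3, g1, g2]
    ring
  · intro x y hxy
    simp [cgFun_top p₁ p₂ hxy]

end

end

end ColoredVertex

namespace ColoredVertex

noncomputable section

open Finset

theorem expandUp_symm (h p₁ p₂ : ℂ) (n : ℕ) : expandUp h p₂ p₁ n = expandUp h p₁ p₂ n := by
  simp only [expandUp, add_comm p₂, add_comm (2 * p₂), sub_right_comm _ p₂]

theorem expandDown_symm (h p₁ p₂ : ℂ) (n : ℕ) : expandDown h p₂ p₁ n = expandDown h p₁ p₂ n := by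
  simp only [expandDown, add_comm p₂, mul_comm (qnum h (2 * p₂ - n))]

section

variable {h : ℂ} (hq : ∀ n : ℕ, 0 < n → Complex.exp h ^ n ≠ 1) {p₁ p₂ : ℂ}

include hq

theorem lowerOp_cgFun_succ (hc : CGGeneric h p₁ p₂) (r₁ r₂ : ℂ) {n a b : ℕ} (hab : a + b = n + 2) :
    lowerOp h p₁ p₂ (-1) r₁ r₂ (cgFun h p₁ p₂ (n + 1)) a b =
      expandUp h p₁ p₂ (n + 1) * (r₂ * qpow h (2 * (p₁ + p₂ - (n + 1 : ℕ))) - r₁)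
        * cgFun h p₁ p₂ (n + 2) a b
      + (r₁ * expandStay h p₁ p₂ (n + 1) + r₂ * expandStay h p₂ p₁ (n + 1))
        * cgFun h p₁ p₂ (n + 1) a b
      + (r₁ * qpow h (p₁ + p₂ - n) - r₂ * qpow h (-(p₁ + p₂ - n))) * expandDown h p₁ p₂ n
        * cgFun h p₁ p₂ n a b := by
  rw [lowerOp_cgFun_aux hq hc r₁ r₂ hab]
  congr 1
  have h1 := cgFun_top_succ_succ hq p₁ p₂ hab
  have e : qpow h (p₂ - n) * qpow h (n - p₂) = 1 := by
    rw [← qpow_add, ← qpow_zero h]; congr 1; ring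
  rw [topConst_succ]
  push_cast
  rw [show p₁ + p₂ - ((n : ℂ) + 1) + 1 = p₁ + p₂ - n by ring,
    show 2 * (p₁ + p₂ - ((n : ℂ) + 1)) + 1 = 2 * (p₁ + p₂ - n) - 1 by ring,
    show 2 * (p₁ + p₂ - ((n : ℂ) + 1)) + 2 = 2 * (p₁ + p₂ - n) by ring,
    show (n : ℂ) + 1 - 2 - p₁ - p₂ = n - 1 - p₁ - p₂ by ring,
    show p₁ + p₂ - ((n : ℂ) + 1) = p₁ + p₂ - n - 1 by ring,
    show (n : ℂ) + 1 - 1 - p₂ = n - p₂ by ring, expandDown]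
  generalize lowFF _ _ _ _ _ = L at *
  generalize (r₁ * qpow h (p₁ + p₂ - n) - r₂ * qpow h (-(p₁ + p₂ - n))) = X
  simp only [div_eq_mul_inv, mul_inv]
  generalize (qnum h (2 * (p₁ + p₂ - n)))⁻¹ = Y
  generalize (qnum h (2 * (p₁ + p₂ - n) - 1))⁻¹ = Z
  linear_combination X * Y * Z * qnum h (2 * p₁ - n) * qnum h (2 * p₂ - n)
    * (topConst h p₁ p₂ n * topFun h (n - 1 - p₁ - p₂) a b * L * e - h1)

/-- For n = 0 the third term drops out: in degree 1 there are only the points (0,1) and (1,0), and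
at both of them every summand of `lowFF` contains a factor [0]. -/
theorem lowerOp_cgFun_zero (hc : CGGeneric h p₁ p₂) (r₁ r₂ : ℂ) {a b : ℕ} (hab : a + b = 1) :
    lowerOp h p₁ p₂ (-1) r₁ r₂ (cgFun h p₁ p₂ 0) a b =
      expandUp h p₁ p₂ 0 * (r₂ * qpow h (2 * (p₁ + p₂ - (0 : ℕ))) - r₁) * cgFun h p₁ p₂ 1 a b
      + (r₁ * expandStay h p₁ p₂ 0 + r₂ * expandStay h p₂ p₁ 0) * cgFun h p₁ p₂ 0 a b := by
  rw [lowerOp_cgFun_aux hq hc r₁ r₂ hab, add_eq_left]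
  have hL : lowFF (qpow h 1) (qpow h p₁) (qpow h p₂) (qpow h (p₁ + p₂ - (0 : ℕ))) (qpow h a) = 0 := by
    have h1 := qpow_ne_zero h 1
    have h2 := qpow_ne_zero h p₁
    have h3 := qpow_ne_zero h p₂
    have b1 : br (qpow h 1) 1 = 0 := by simp [br]
    obtain ⟨rfl, rfl⟩ | ⟨rfl, rfl⟩ : a = 0 ∧ b = 1 ∨ a = 1 ∧ b = 0 := by omega
    · have c1 : coeffL1 (qpow h 1) (qpow h p₁) 1 = 0 := by simp [coeffL1, b1]
      have c2 : coeffL2 (qpow h 1) (qpow h p₁) (qpow h p₂) (qpow h p₁ * qpow h p₂ * qpow h 1) 1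
          = 0 := by
        rw [coeffL2, show qpow h p₁ * qpow h p₂ * (qpow h p₁ * qpow h p₂ * qpow h 1)⁻¹ * qpow h 1
          * 1⁻¹ = 1 by field_simp, b1, mul_zero]
      simp [lowFF, lowF, qpow_zero, qpow_add, c1, c2]
    · have c1 : coeffL1 (qpow h 1) (qpow h p₁) 1 = 0 := by simp [coeffL1, b1]
      have c2 : coeffL2 (qpow h 1) (qpow h p₁) (qpow h p₂) (qpow h p₁ * qpow h p₂) (qpow h 1)
          = 0 := by
        rw [coeffL2, show qpow h p₁ * qpow h p₂ * (qpow h p₁ * qpow h p₂)⁻¹ * qpow h 1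
          * (qpow h 1)⁻¹ = 1 by field_simp, b1, mul_zero]
      have c3 : coeffL2 (qpow h 1) (qpow h p₁) (qpow h p₂) (qpow h p₁ * qpow h p₂ * qpow h 1) 1
          = 0 := by
        rw [coeffL2, show qpow h p₁ * qpow h p₂ * (qpow h p₁ * qpow h p₂ * qpow h 1)⁻¹ * qpow h 1
          * 1⁻¹ = 1 by field_simp, b1, mul_zero]
      simp [lowFF, lowF, qpow_add, c1, c2, c3, mul_inv_cancel₀ h1]
  rw [hL, mul_zero, mul_zero, mul_zero]

end

/-! ### Orthogonality -/

/-- The inverse of the square norm of the vector `|n, z⟩`. -/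
def cgNorm (h p₁ p₂ : ℂ) (n z : ℕ) : ℂ :=
  qnum h (2 * p₁ + 2 * p₂ - 2 * n + 1) * (qfact h n * qfact h z)
    / (qfall h (2 * p₁ + 2 * p₂ - n + 1) (n + z + 1) * (qfall h (2 * p₁) n * qfall h (2 * p₂) n))

theorem cgNorm_symm (h p₁ p₂ : ℂ) (n z : ℕ) : cgNorm h p₂ p₁ n z = cgNorm h p₁ p₂ n z := by
  simp only [cgNorm, add_comm (2 * p₂), mul_comm (qfall h (2 * p₂) n)]

theorem qfall_succ_left (h p : ℂ) (n : ℕ) : qfall h p (n + 1) = qnum h p * qfall h (p - 1) n := by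
  simp only [qfall, prod_range_succ', Nat.cast_zero, sub_zero]
  rw [mul_comm]
  congr 1
  refine prod_congr rfl fun k _ => ?_
  push_cast
  ring_nf

theorem qfall_ne_zero {h p : ℂ} {n : ℕ} (hp : ∀ k < n, qnum h (p - k) ≠ 0) : qfall h p n ≠ 0 :=
  prod_ne_zero_iff.2 fun k hk => hp k (mem_range.1 hk)

section

variable {h : ℂ} (hq : ∀ n : ℕ, 0 < n → Complex.exp h ^ n ≠ 1) {p₁ p₂ : ℂ}
  (hp₁ : ∀ k : ℕ, qnum h (2 * p₁ - k) ≠ 0) (hp₂ : ∀ k : ℕ, qnum h (2 * p₂ - k) ≠ 0)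
  (hc : CGGeneric h p₁ p₂)

include hc in
theorem CGGeneric.qfall_ne_zero (n k : ℕ) : qfall h (2 * p₁ + 2 * p₂ - n + 1) k ≠ 0 :=
  ColoredVertex.qfall_ne_zero fun i _ => by
    convert hc (n + i + 1) using 2; push_cast; ring

include hc in
theorem cgNorm_succ (n z : ℕ) : cgNorm h p₁ p₂ n (z + 1)
      * qnum h (2 * p₁ + 2 * p₂ - n - ((n + z : ℕ) : ℂ))
    = cgNorm h p₁ p₂ n z * qnum h ((z : ℂ) + 1) := by
  have h1 := hc.qfall_ne_zero n (n + z + 1)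
  have h2 : qnum h (2 * p₁ + 2 * p₂ - n - ((n + z : ℕ) : ℂ)) ≠ 0 := by
    convert hc (2 * n + z + 2) using 2; push_cast; ring
  rw [cgNorm, cgNorm, ← add_assoc, qfall_succ _ _ (n + z + 1), qfact_succ h z,
    show 2 * p₁ + 2 * p₂ - n + 1 - ((n + z + 1 : ℕ) : ℂ) = 2 * p₁ + 2 * p₂ - n - ((n + z : ℕ) : ℂ) by
      push_cast; ring]
  generalize qnum h (2 * p₁ + 2 * p₂ - n - ((n + z : ℕ) : ℂ)) = X at *
  generalize qfall h (2 * p₁ + 2 * p₂ - n + 1) (n + z + 1) = Y at *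
  field_simp

include hq hp₁ hp₂

/-- Obtained by moving X⁻ across the form: it acts on the left entry by [N+1-n], and its adjoint X⁺
acts on the right entry by [2p₁+2p₂-m-N]. -/
theorem form_cgFun_step (n m N : ℕ) :
    qnum h (((N + 1 : ℕ) : ℂ) - n) * form h p₁ p₂ (N + 1) (cgFun h p₁ p₂ n) (cgFun h p₁ p₂ m)
      = qnum h (2 * p₁ + 2 * p₂ - m - (N : ℂ))
        * form h p₁ p₂ N (cgFun h p₁ p₂ n) (cgFun h p₁ p₂ m) := by
  rw [← form_smul_left, ← form_smul_right]
  have := form_lowerOp hp₁ hp₂ 1 1 1 N (cgFun h p₁ p₂ n) (cgFun h p₁ p₂ m)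
  rw [lowerOp_cgFun hq, raiseOp_cgFun hq] at this
  refine Eq.trans (form_congr (fun a b hab => ?_) fun a b _ => rfl)
    (this.trans (form_congr (fun a b _ => rfl) fun a b hab => ?_))
  · simp [← hab]
  · simp [← hab]

/-- Below degree m the right entry vanishes. From degree m on, N+1 > n makes [N+1-n] nonzero, so the
zero propagates upward through `form_cgFun_step`. -/
theorem form_cgFun_of_lt {n m : ℕ} (hnm : n < m) (N : ℕ) :
    form h p₁ p₂ N (cgFun h p₁ p₂ n) (cgFun h p₁ p₂ m) = 0 := by
  induction N with
  | zero =>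
    rw [form_comm, form_congr (f' := 0) (g' := cgFun h p₁ p₂ n) _ fun a b _ => rfl, form_zero_left]
    exact fun a b hab => cgFun_of_lt p₁ p₂ (by omega)
  | succ N ih =>
    rcases lt_or_ge (N + 1) m with hN | hN
    · rw [form_comm, form_congr (f' := 0) (g' := cgFun h p₁ p₂ n) _ fun a b _ => rfl, form_zero_left]
      exact fun a b hab => cgFun_of_lt p₁ p₂ (by omega)
    · have := form_cgFun_step hq hp₁ hp₂ n m N
      rw [ih, mul_zero] at this
      refine (mul_eq_zero.1 this).resolve_left ?_
      rw [← Nat.cast_sub (by omega)]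
      exact qnum_natCast_ne_zero hq (by omega)

theorem form_cgFun_of_ne {n m : ℕ} (hnm : n ≠ m) (N : ℕ) :
    form h p₁ p₂ N (cgFun h p₁ p₂ n) (cgFun h p₁ p₂ m) = 0 := by
  rcases lt_or_gt_of_ne hnm with h1 | h1
  · exact form_cgFun_of_lt hq hp₁ hp₂ h1 N
  · rw [form_comm]
    exact form_cgFun_of_lt hq hp₁ hp₂ h1 N

include hc

/-- The ratio of consecutive top norms, from the adjoint pair X⁻⊗q^{-H/2} and X⁺⊗q^{-H/2}, that is
(r₁, r₂) = (1, 0). Pairing the three-term expansion with component n+1 leaves only `expandUp`, and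
on the other side the top vector n+1 is sent to a multiple of the top vector n. -/
theorem form_cgFun_top_succ (n : ℕ) :
    expandUp h p₁ p₂ n * form h p₁ p₂ (n + 1) (cgFun h p₁ p₂ (n + 1)) (cgFun h p₁ p₂ (n + 1))
      = qpow h (n - p₁ - p₂) * (qnum h (2 * p₁ - n) * qnum h (2 * p₂ - n))
        * form h p₁ p₂ n (cgFun h p₁ p₂ n) (cgFun h p₁ p₂ n) := by
  have h1 := form_lowerOp hp₁ hp₂ (-1) 1 0 n (cgFun h p₁ p₂ n) (cgFun h p₁ p₂ (n + 1))
  have h2 : form h p₁ p₂ (n + 1) (lowerOp h p₁ p₂ (-1) 1 0 (cgFun h p₁ p₂ n))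
      (cgFun h p₁ p₂ (n + 1)) = -expandUp h p₁ p₂ n
        * form h p₁ p₂ (n + 1) (cgFun h p₁ p₂ (n + 1)) (cgFun h p₁ p₂ (n + 1)) := by
    rcases n with _ | n
    · rw [form_congr (f' := (-expandUp h p₁ p₂ 0) • cgFun h p₁ p₂ 1
        + expandStay h p₁ p₂ 0 • cgFun h p₁ p₂ 0) (g' := cgFun h p₁ p₂ 1) _ fun a b _ => rfl,
        form_add_left, form_smul_left, form_smul_left,
        form_cgFun_of_ne hq hp₁ hp₂ (n := 0) (m := 1) (by omega), mul_zero, add_zero]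
      intro a b hab
      rw [lowerOp_cgFun_zero hq hc 1 0 hab]
      simp
    · rw [form_congr (f' := (-expandUp h p₁ p₂ (n + 1)) • cgFun h p₁ p₂ (n + 2)
        + expandStay h p₁ p₂ (n + 1) • cgFun h p₁ p₂ (n + 1)
        + (qpow h (p₁ + p₂ - n) * expandDown h p₁ p₂ n) • cgFun h p₁ p₂ n)
        (g' := cgFun h p₁ p₂ (n + 2)) _ fun a b _ => rfl,
        form_add_left, form_add_left, form_smul_left, form_smul_left, form_smul_left,
        form_cgFun_of_ne hq hp₁ hp₂ (n := n + 1) (m := n + 2) (by omega),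
        form_cgFun_of_ne hq hp₁ hp₂ (n := n) (m := n + 2) (by omega), mul_zero, add_zero, mul_zero,
        add_zero]
      intro a b hab
      rw [lowerOp_cgFun_succ hq hc 1 0 hab]
      simp
  have h3 : form h p₁ p₂ n (cgFun h p₁ p₂ n) (raiseOp h p₁ p₂ (-1) 1 0 (cgFun h p₁ p₂ (n + 1)))
      = -(qpow h (n - p₁ - p₂) * (qnum h (2 * p₁ - n) * qnum h (2 * p₂ - n)))
        * form h p₁ p₂ n (cgFun h p₁ p₂ n) (cgFun h p₁ p₂ n) := by
    rw [← form_smul_right]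
    refine form_congr (fun a b _ => rfl) fun a b hab => ?_
    have hb : (b : ℂ) = n - a := by rw [eq_sub_iff_add_eq']; exact_mod_cast hab
    have hf := qfact_ne_zero hq a
    have hf' := qnum_natCast_add_one_ne_zero hq a
    have e : qpow h (-1 * (p₂ - b)) * (qpow h ((a + 1 : ℕ) * ((n + 1 : ℕ) - 1 - p₁ - p₂))
        * qpow h (p₂ - n)) = qpow h (a * (n - 1 - p₁ - p₂)) * qpow h (n - p₁ - p₂) := by
      rw [← qpow_add, ← qpow_add, ← qpow_add, hb]
      congr 1
      push_cast
      ring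
    rw [raiseOp_apply, cgFun_top p₁ p₂ (show a + 1 + b = n + 1 by omega), Pi.smul_apply,
      Pi.smul_apply, cgFun_top p₁ p₂ hab, topConst_succ, topFun, topFun, qfact_succ, pow_succ]
    simp only [one_mul, zero_mul, add_zero, smul_eq_mul, mul_inv]
    generalize qpow h (-1 * (p₂ - b)) = x1 at *
    generalize qpow h ((a + 1 : ℕ) * ((n + 1 : ℕ) - 1 - p₁ - p₂)) = x2 at *
    generalize qnum h (2 * p₁ - n) = x3 at *
    generalize qnum h (2 * p₂ - n) = x4 at *
    field_simp
    linear_combination (-(qfact h b)⁻¹ * topConst h p₁ p₂ n * x3 * x4) * e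
  rw [h2, h3] at h1
  linear_combination -h1

theorem form_cgFun_top (n : ℕ) :
    form h p₁ p₂ n (cgFun h p₁ p₂ n) (cgFun h p₁ p₂ n) * cgNorm h p₁ p₂ n 0 = 1 := by
  induction n with
  | zero =>
    have : qnum h (2 * p₁ + 2 * p₂ + 1) ≠ 0 := by
      convert hc 1 using 2; push_cast; ring
    simp [form, cgFun, cgNorm, cgTerm, qrecip, qfact_zero, qfall_zero, qpow_zero, qfall_succ, this]
  | succ n ih =>
    have h1 := form_cgFun_top_succ hq hp₁ hp₂ hc n
    have a1 := hp₁ n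
    have a2 := hp₂ n
    have f1 : qfall h (2 * p₁) n ≠ 0 := qfall_ne_zero fun k _ => hp₁ k
    have f2 : qfall h (2 * p₂) n ≠ 0 := qfall_ne_zero fun k _ => hp₂ k
    have f3 : qfact h n ≠ 0 := qfact_ne_zero hq n
    have f4 := qnum_natCast_add_one_ne_zero hq n
    have f5 : qnum h (2 * p₁ + 2 * p₂ - n + 1) ≠ 0 := by
      convert hc (n + 1) using 2; push_cast; ring
    have f6 : qnum h (2 * (p₁ + p₂ - n)) ≠ 0 := by
      convert hc (2 * n + 2) using 2; push_cast; ring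
    have f7 : qnum h (2 * (p₁ + p₂ - n) - 1) ≠ 0 := by
      convert hc (2 * n + 3) using 2; push_cast; ring
    have f8 : qnum h (2 * (p₁ + p₂ - n) + 1) ≠ 0 := by
      convert hc (2 * n + 1) using 2; push_cast; ring
    have f9 : qfall h (2 * p₁ + 2 * p₂ - n) n ≠ 0 := qfall_ne_zero fun k _ => by
      convert hc (n + k + 2) using 2; push_cast; ring
    have f10 := qpow_ne_zero h (n - p₁ - p₂)
    simp only [cgNorm, add_zero, qfact_zero, mul_one] at ih ⊢
    rw [qfall_succ_left, show 2 * p₁ + 2 * p₂ - (n : ℂ) + 1 - 1 = 2 * p₁ + 2 * p₂ - n by ring,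
      show 2 * p₁ + 2 * p₂ - 2 * (n : ℂ) + 1 = 2 * (p₁ + p₂ - n) + 1 by ring] at ih
    rw [show 2 * p₁ + 2 * p₂ - ((n + 1 : ℕ) : ℂ) + 1 = 2 * p₁ + 2 * p₂ - n by push_cast; ring,
      show 2 * p₁ + 2 * p₂ - 2 * ((n + 1 : ℕ) : ℂ) + 1 = 2 * (p₁ + p₂ - n) - 1 by push_cast; ring,
      qfall_succ, qfall_succ, qfact_succ, qfall_succ h (2 * p₁), qfall_succ h (2 * p₂),
      show 2 * p₁ + 2 * p₂ - (n : ℂ) - n = 2 * (p₁ + p₂ - n) by ring,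
      show 2 * p₁ + 2 * p₂ - (n : ℂ) - ((n + 1 : ℕ) : ℂ) = 2 * (p₁ + p₂ - n) - 1 by push_cast; ring]
    rw [expandUp] at h1
    generalize qnum h (2 * p₁ - n) = x1 at *
    generalize qnum h (2 * p₂ - n) = x2 at *
    generalize qfall h (2 * p₁) n = x3 at *
    generalize qfall h (2 * p₂) n = x4 at *
    generalize qnum h (2 * p₁ + 2 * p₂ - n + 1) = x5 at *
    generalize qnum h (2 * (p₁ + p₂ - n)) = x6 at *
    generalize qnum h (2 * (p₁ + p₂ - n) - 1) = x7 at *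
    generalize qnum h (2 * (p₁ + p₂ - n) + 1) = x8 at *
    generalize qfall h (2 * p₁ + 2 * p₂ - n) n = x9 at *
    field_simp at h1 ih ⊢
    apply mul_left_cancel₀ f5
    linear_combination qfact h n * h1 + (x1 * x2 * x6) * ih

theorem form_cgFun_self (n z : ℕ) :
    form h p₁ p₂ (n + z) (cgFun h p₁ p₂ n) (cgFun h p₁ p₂ n) * cgNorm h p₁ p₂ n z = 1 := by
  induction z with
  | zero => exact form_cgFun_top hq hp₁ hp₂ hc n
  | succ z ih =>
    have h1 := form_cgFun_step hq hp₁ hp₂ n n (n + z)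
    have h2 := cgNorm_succ hc n z
    have f4 := qnum_natCast_add_one_ne_zero hq z
    have f5 : qnum h (2 * p₁ + 2 * p₂ - n - ((n + z : ℕ) : ℂ)) ≠ 0 := by
      convert hc (2 * n + z + 2) using 2; push_cast; ring
    rw [show ((n + z + 1 : ℕ) : ℂ) - n = (z : ℂ) + 1 by push_cast; ring] at h1
    rw [← add_assoc]
    apply mul_left_cancel₀ (mul_ne_zero f4 f5)
    linear_combination cgNorm h p₁ p₂ n (z + 1) * qnum h (2 * p₁ + 2 * p₂ - n - ((n + z : ℕ) : ℂ)) * h1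
      + qnum h (2 * p₁ + 2 * p₂ - n - ((n + z : ℕ) : ℂ))
        * form h p₁ p₂ (n + z) (cgFun h p₁ p₂ n) (cgFun h p₁ p₂ n) * h2
      + qnum h (2 * p₁ + 2 * p₂ - n - ((n + z : ℕ) : ℂ)) * qnum h ((z : ℂ) + 1) * ih

end

end

end ColoredVertex

namespace ColoredVertex

noncomputable section

open Finset

/-! ### The R operator -/

/-- The R operator `V^{(p₁)} ⊗ V^{(p₂)} → V^{(p₁)} ⊗ V^{(p₂)}`. -/
def rOp (h p₁ p₂ u : ℂ) : (ℕ → ℕ → ℂ) →ₗ[ℂ] (ℕ → ℕ → ℂ) where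
  toFun f a b := ∑ n ∈ range (a + b + 1), gfun h p₁ p₂ n u * cgNorm h p₁ p₂ n (a + b - n)
    * form h p₁ p₂ (a + b) (cgFun h p₁ p₂ n) f * cgFun h p₂ p₁ n b a
  map_add' f g := by
    ext a b
    simp only [form_add_right, Pi.add_apply, ← sum_add_distrib]
    exact sum_congr rfl fun _ _ => by ring
  map_smul' c f := by
    ext a b
    simp only [form_smul_right, Pi.smul_apply, smul_eq_mul, RingHom.id_apply, mul_sum]
    exact sum_congr rfl fun _ _ => by ring

theorem rOp_apply (h p₁ p₂ u : ℂ) (f : ℕ → ℕ → ℂ) (a b : ℕ) : rOp h p₁ p₂ u f a b =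
    ∑ n ∈ range (a + b + 1), gfun h p₁ p₂ n u * cgNorm h p₁ p₂ n (a + b - n)
    * form h p₁ p₂ (a + b) (cgFun h p₁ p₂ n) f * cgFun h p₂ p₁ n b a := rfl

theorem rOp_congr (h p₁ p₂ u : ℂ) {f g : ℕ → ℕ → ℂ} {N : ℕ} (hfg : ∀ a b, a + b = N → f a b = g a b)
    (a b : ℕ) (hab : a + b = N) : rOp h p₁ p₂ u f a b = rOp h p₁ p₂ u g a b := by
  rw [rOp_apply, rOp_apply]
  refine sum_congr rfl fun n _ => ?_
  rw [form_congr (fun _ _ _ => rfl) fun x y hxy => hfg x y (hxy.trans hab)]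

/-- On the component of degree `N` the image of the R operator is a combination of the
Clebsch-Gordan functions. -/
theorem rOp_eq_sum (h p₁ p₂ u : ℂ) (f : ℕ → ℕ → ℂ) {N a b : ℕ} (hab : a + b = N) :
    rOp h p₁ p₂ u f a b = (∑ n ∈ range (N + 1), (gfun h p₁ p₂ n u * cgNorm h p₁ p₂ n (N - n)
      * form h p₁ p₂ N (cgFun h p₁ p₂ n) f) • swapFun (cgFun h p₂ p₁ n)) a b := by
  subst hab
  simp [rOp_apply, swapFun]

theorem gfun_succ {h p₁ p₂ u : ℂ} (hg : GRegular h p₁ p₂ u) (n : ℕ) :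
    gfun h p₁ p₂ (n + 1) u * qnum h (u + p₁ + p₂ - n)
      = -(gfun h p₁ p₂ n u * qnum h (u - p₁ - p₂ + n)) := by
  have := hg n
  rw [gfun, gfun, prod_range_succ, pow_succ]
  field_simp

section

variable {h : ℂ} (hq : ∀ n : ℕ, 0 < n → Complex.exp h ^ n ≠ 1) {p₁ p₂ u : ℂ}

include hq in
-- The recurrence for g written in the variables x = q^{-2u} and q^{2(p₁+p₂-n)}, the form in which
-- it appears when the three-term expansion is compared on both sides.
theorem gfun_succ' (hg : GRegular h p₁ p₂ u) (n : ℕ) :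
    gfun h p₁ p₂ (n + 1) u * (qpow h (2 * (p₁ + p₂ - n)) - qpow h (-2 * u))
      = gfun h p₁ p₂ n u * (qpow h (-2 * u) * qpow h (2 * (p₁ + p₂ - n)) - 1) := by
  have h1 := gfun_succ hg n
  have hd := q_sub_inv_ne_zero hq
  have h2 : qnum h (u + p₁ + p₂ - n) * (qpow h 1 - qpow h (-1)) * qpow h (p₁ + p₂ - n - u)
      = qpow h (2 * (p₁ + p₂ - n)) - qpow h (-2 * u) := by
    rw [qnum, div_mul_cancel₀ _ hd, sub_mul, ← qpow_add, ← qpow_add]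
    ring_nf
  have h3 : qnum h (u - p₁ - p₂ + n) * (qpow h 1 - qpow h (-1)) * qpow h (p₁ + p₂ - n - u)
      = 1 - qpow h (-2 * u) * qpow h (2 * (p₁ + p₂ - n)) := by
    rw [qnum, div_mul_cancel₀ _ hd, sub_mul, ← qpow_add, ← qpow_add, ← qpow_add, ← qpow_zero h]
    ring_nf
  linear_combination -gfun h p₁ p₂ (n + 1) u * h2 - gfun h p₁ p₂ n u * h3
    + (qpow h 1 - qpow h (-1)) * qpow h (p₁ + p₂ - n - u) * h1

theorem form_zero_lowerOp (ε r₁ r₂ : ℂ) (f g : ℕ → ℕ → ℂ) :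
    form h p₁ p₂ 0 f (lowerOp h p₁ p₂ ε r₁ r₂ g) = 0 := by
  simp [form, lowerOp_apply]

variable (hp₁ : ∀ k : ℕ, qnum h (2 * p₁ - k) ≠ 0) (hp₂ : ∀ k : ℕ, qnum h (2 * p₂ - k) ≠ 0)
  (hc : CGGeneric h p₁ p₂)

include hq

theorem raiseOp_swap_cgFun (n a b : ℕ) : raiseOp h p₁ p₂ (-1) 1 1 (swapFun (cgFun h p₂ p₁ n)) a b
    = qnum h (2 * p₁ + 2 * p₂ - n - ((a + b : ℕ) : ℂ)) * cgFun h p₂ p₁ n b a := by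
  rw [raiseOp_swap, neg_neg, raiseOp_cgFun hq, swapFun, add_comm (2 * p₂), add_comm b]

theorem lowerOp_swap_cgFun (n a b : ℕ) : lowerOp h p₁ p₂ (-1) 1 1 (swapFun (cgFun h p₂ p₁ n)) a b
    = qnum h (((a + b : ℕ) : ℂ) - n) * cgFun h p₂ p₁ n b a := by
  rw [lowerOp_swap, neg_neg, lowerOp_cgFun hq, swapFun, add_comm b]

include hp₁ hp₂ hc

/-- The scalar g_n is constant on each component, so only the module structure of the components and
the norm recursion `cgNorm_succ` enter, and no property of g is used. -/
theorem rOp_raiseOp (f : ℕ → ℕ → ℂ) : rOp h p₁ p₂ u (raiseOp h p₁ p₂ 1 1 1 f)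
    = raiseOp h p₁ p₂ (-1) 1 1 (rOp h p₁ p₂ u f) := by
  ext a b
  rw [raiseOp_congr h p₁ p₂ (-1) 1 1 (fun x y hxy => rOp_eq_sum h p₁ p₂ u f hxy) a b rfl, map_sum,
    sum_range_succ, rOp_apply]
  simp only [map_smul, Pi.add_apply, Finset.sum_apply, Pi.smul_apply, smul_eq_mul,
    raiseOp_swap_cgFun hq]
  -- The expansion in degree a+b+1 has one component more than that in degree a+b: its top vector,
  -- which X⁺ kills.
  rw [cgFun_of_lt p₂ p₁ (n := a + b + 1) (by omega), mul_zero, mul_zero, add_zero]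
  refine sum_congr rfl fun n hn => ?_
  obtain ⟨z, hz⟩ := Nat.exists_eq_add_of_le (Nat.lt_succ_iff.1 (mem_range.1 hn))
  have h1 := cgNorm_succ hc n z
  rw [hz, show n + z + 1 - n = z + 1 by omega, show n + z - n = z by omega, form_comm,
    form_raiseOp hp₁ hp₂, lowerOp_cgFun hq, form_comm,
    form_congr (f' := qnum h ((z : ℂ) + 1) • cgFun h p₁ p₂ n) (g' := f) _ (fun _ _ _ => rfl),
    form_smul_left]
  · linear_combination (-gfun h p₁ p₂ n u * form h p₁ p₂ (n + z + 1) (cgFun h p₁ p₂ n) f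
      * cgFun h p₂ p₁ n b a) * h1
  · intro x y hxy
    rw [hxy, show ((n + z + 1 : ℕ) : ℂ) - n = (z : ℂ) + 1 by push_cast; ring]
    rfl

theorem rOp_lowerOp (f : ℕ → ℕ → ℂ) : rOp h p₁ p₂ u (lowerOp h p₁ p₂ 1 1 1 f)
    = lowerOp h p₁ p₂ (-1) 1 1 (rOp h p₁ p₂ u f) := by
  ext a b
  rcases hN : a + b with _ | N
  · obtain ⟨rfl, rfl⟩ : a = 0 ∧ b = 0 := by omega
    rw [rOp_apply, lowerOp_apply, sum_eq_zero fun n _ => by rw [form_zero_lowerOp]; ring]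
    simp
  rw [lowerOp_congr h p₁ p₂ (-1) 1 1 (fun x y hxy => rOp_eq_sum h p₁ p₂ u f hxy) a b hN, map_sum,
    rOp_apply, hN, sum_range_succ]
  simp only [map_smul, Finset.sum_apply, Pi.smul_apply, smul_eq_mul, lowerOp_swap_cgFun hq]
  rw [← form_comm, form_lowerOp hp₁ hp₂, raiseOp_cgFun hq, form_congr (f' := f) (g' := 0)
    (fun _ _ _ => rfl), form_comm, form_zero_left, mul_zero, zero_mul, add_zero]
  · refine sum_congr rfl fun n hn => ?_
    obtain ⟨z, rfl⟩ := Nat.exists_eq_add_of_le (Nat.lt_succ_iff.1 (mem_range.1 hn))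
    have h1 := cgNorm_succ hc n z
    rw [hN, show n + z + 1 - n = z + 1 by omega, show n + z - n = z by omega, form_comm,
      form_lowerOp hp₁ hp₂, raiseOp_cgFun hq, form_comm,
      form_congr (f' := qnum h (2 * p₁ + 2 * p₂ - n - ((n + z : ℕ) : ℂ)) • cgFun h p₁ p₂ n)
      (g' := f) _ (fun _ _ _ => rfl), form_smul_left,
      show ((n + z + 1 : ℕ) : ℂ) - n = (z : ℂ) + 1 by push_cast; ring]
    · linear_combination (gfun h p₁ p₂ n u * form h p₁ p₂ (n + z) (cgFun h p₁ p₂ n) f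
        * cgFun h p₂ p₁ n b a) * h1
    · intro x y hxy
      rw [hxy]
      rfl
  · intro x y hxy
    rw [cgFun_of_lt p₁ p₂ (by omega), mul_zero]
    rfl

theorem rOp_cgFun (m : ℕ) : rOp h p₁ p₂ u (cgFun h p₁ p₂ m)
    = gfun h p₁ p₂ m u • swapFun (cgFun h p₂ p₁ m) := by
  ext a b
  rw [rOp_apply, Pi.smul_apply, Pi.smul_apply, swapFun, smul_eq_mul]
  rcases lt_or_ge (a + b) m with hm | hm
  · rw [cgFun_of_lt p₂ p₁ (by omega), mul_zero]
    refine sum_eq_zero fun n hn => ?_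
    rw [form_cgFun_of_ne hq hp₁ hp₂ (by rw [mem_range] at hn; omega), mul_zero, zero_mul]
  · obtain ⟨z, hz⟩ := Nat.exists_eq_add_of_le hm
    rw [sum_eq_single_of_mem m (by rw [mem_range]; omega), hz, Nat.add_sub_cancel_left]
    · linear_combination (gfun h p₁ p₂ m u * cgFun h p₂ p₁ m b a) * form_cgFun_self hq hp₁ hp₂ hc m z
    · intro n _ hn
      rw [form_cgFun_of_ne hq hp₁ hp₂ hn, mul_zero, zero_mul]

/-- The Clebsch-Gordan functions span every component. -/
theorem cgFun_complete (f : ℕ → ℕ → ℂ) {N a b : ℕ} (hab : a + b = N) :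
    f a b = (∑ n ∈ range (N + 1), (cgNorm h p₁ p₂ n (N - n) * form h p₁ p₂ N (cgFun h p₁ p₂ n) f)
      • cgFun h p₁ p₂ n) a b := by
  let w : ℕ → ℂ := fun i =>
    (qfact h i / qfall h (2 * p₁) i) * (qfact h (N - i) / qfall h (2 * p₂) (N - i))
  have hform (f g : ℕ → ℕ → ℂ) : form h p₁ p₂ N f g
      = ∑ i : Fin (N + 1), w i * (f i (N - i) * g i (N - i)) := by
    rw [form, Nat.sum_antidiagonal_eq_sum_range_succ (fun i j => (qfact h i / qfall h (2 * p₁) i)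
      * (qfact h j / qfall h (2 * p₂) j) * (f i j * g i j)), sum_range]
  let U : Matrix (Fin (N + 1)) (Fin (N + 1)) ℂ := Matrix.of fun n i => cgFun h p₁ p₂ n i (N - i)
  let V : Matrix (Fin (N + 1)) (Fin (N + 1)) ℂ := Matrix.of fun i n =>
    w i * cgFun h p₁ p₂ n i (N - i) * cgNorm h p₁ p₂ n (N - n)
  have hUV : U * V = 1 := by
    ext n m
    have e : (U * V) n m = form h p₁ p₂ N (cgFun h p₁ p₂ n) (cgFun h p₁ p₂ m)
        * cgNorm h p₁ p₂ m (N - m) := by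
      rw [hform, Matrix.mul_apply, sum_mul]
      exact sum_congr rfl fun i _ => by simp only [U, V, Matrix.of_apply]; ring
    rw [e, Matrix.one_apply]
    split_ifs with hnm
    · subst hnm
      have := form_cgFun_self hq hp₁ hp₂ hc n (N - n)
      rwa [Nat.add_sub_cancel' (Nat.lt_succ_iff.1 n.2)] at this
    · rw [form_cgFun_of_ne hq hp₁ hp₂ (by simpa [Fin.ext_iff] using hnm), zero_mul]
  -- Orthonormality says U V = 1; for square matrices this gives V U = 1, which is completeness.
  have hVU := mul_eq_one_comm.1 hUV
  have ha : a < N + 1 := by omega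
  have hb : b = N - a := by omega
  have key : f a b = ∑ i : Fin (N + 1), (V * U) i ⟨a, ha⟩ * f i (N - i) := by
    rw [hVU, sum_eq_single_of_mem ⟨a, ha⟩ (mem_univ _), Matrix.one_apply_eq, one_mul, hb]
    intro i _ hi
    rw [Matrix.one_apply_ne hi, zero_mul]
  rw [key]
  simp only [Matrix.mul_apply, sum_mul, Finset.sum_apply, Pi.smul_apply, smul_eq_mul, hform]
  rw [sum_comm, sum_range]
  refine sum_congr rfl fun n _ => ?_
  rw [mul_sum, sum_mul]
  refine sum_congr rfl fun i _ => ?_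
  simp only [U, V, Matrix.of_apply, hb]
  ring

end

end

end ColoredVertex

/-! ### Intertwining of the affine generators X_0^± -/

namespace ColoredVertex

noncomputable section

open Finset

section

variable {h : ℂ} (hq : ∀ n : ℕ, 0 < n → Complex.exp h ^ n ≠ 1) {p₁ p₂ u : ℂ}
  (hp₁ : ∀ k : ℕ, qnum h (2 * p₁ - k) ≠ 0) (hp₂ : ∀ k : ℕ, qnum h (2 * p₂ - k) ≠ 0)
  (hc : CGGeneric h p₁ p₂) (hg : GRegular h p₁ p₂ u)

include hq hp₁ hp₂ hc hg

/-- Three-term expansions with (r₁, r₂) = (x, 1) on one side and (1, x) for the exchanged factors on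
the other. The middle coefficients agree because r₁ and r₂ are exchanged together with p₁ and p₂;
the outer two are the recurrence for g at adjacent indices. -/
theorem rOp_affineLowerOp_top (n a b : ℕ) (hab : a + b = n + 1) :
    rOp h p₁ p₂ u (lowerOp h p₁ p₂ (-1) (qpow h (-2 * u)) 1 (cgFun h p₁ p₂ n)) a b
      = lowerOp h p₁ p₂ 1 (qpow h (-2 * u)) 1 (rOp h p₁ p₂ u (cgFun h p₁ p₂ n)) a b := by
  have hba : b + a = n + 1 := by omega
  rw [rOp_cgFun hq hp₁ hp₂ hc, map_smul, lowerOp_swap, Pi.smul_apply, Pi.smul_apply, swapFun]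
  rcases n with _ | n
  · rw [rOp_congr h p₁ p₂ u (g := (expandUp h p₁ p₂ 0 * (1 * qpow h (2 * (p₁ + p₂ - (0 : ℕ)))
        - qpow h (-2 * u))) • cgFun h p₁ p₂ 1 + (qpow h (-2 * u) * expandStay h p₁ p₂ 0
        + 1 * expandStay h p₂ p₁ 0) • cgFun h p₁ p₂ 0)
      (fun x y hxy => by rw [lowerOp_cgFun_zero hq hc _ _ hxy]; rfl) a b hab,
      lowerOp_cgFun_zero hq hc.symm _ _ hba, map_add, map_smul, map_smul,
      rOp_cgFun hq hp₁ hp₂ hc, rOp_cgFun hq hp₁ hp₂ hc, expandUp_symm h p₁ p₂, add_comm p₂]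
    have h1 := gfun_succ' hq hg 0
    simp only [Pi.add_apply, Pi.smul_apply, smul_eq_mul, swapFun]
    linear_combination expandUp h p₁ p₂ 0 * cgFun h p₂ p₁ 1 b a * h1
  · rw [rOp_congr h p₁ p₂ u (g := (expandUp h p₁ p₂ (n + 1)
          * (1 * qpow h (2 * (p₁ + p₂ - (n + 1 : ℕ))) - qpow h (-2 * u))) • cgFun h p₁ p₂ (n + 2)
        + (qpow h (-2 * u) * expandStay h p₁ p₂ (n + 1) + 1 * expandStay h p₂ p₁ (n + 1))
          • cgFun h p₁ p₂ (n + 1)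
        + ((qpow h (-2 * u) * qpow h (p₁ + p₂ - n) - 1 * qpow h (-(p₁ + p₂ - n)))
          * expandDown h p₁ p₂ n) • cgFun h p₁ p₂ n)
      (fun x y hxy => by rw [lowerOp_cgFun_succ hq hc _ _ hxy]; rfl) a b hab,
      lowerOp_cgFun_succ hq hc.symm _ _ hba, map_add, map_add, map_smul, map_smul, map_smul,
      rOp_cgFun hq hp₁ hp₂ hc, rOp_cgFun hq hp₁ hp₂ hc, rOp_cgFun hq hp₁ hp₂ hc, expandUp_symm h p₁ p₂,
      expandDown_symm h p₁ p₂, add_comm p₂]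
    have h1 := gfun_succ' hq hg (n + 1)
    have h2 := gfun_succ' hq hg n
    have e : qpow h (2 * (p₁ + p₂ - n)) * qpow h (-(p₁ + p₂ - n)) = qpow h (p₁ + p₂ - n) := by
      rw [← qpow_add]; congr 1; ring
    simp only [Pi.add_apply, Pi.smul_apply, smul_eq_mul, swapFun]
    linear_combination expandUp h p₁ p₂ (n + 1) * cgFun h p₂ p₁ (n + 2) b a * h1
      - expandDown h p₁ p₂ n * cgFun h p₂ p₁ n b a * (qpow h (-(p₁ + p₂ - n)) * h2
        + (gfun h p₁ p₂ n u * qpow h (-2 * u) - gfun h p₁ p₂ (n + 1) u) * e)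

/-- Induction on the degree: beyond the top, the vector is a multiple of X_1^- applied to the
previous degree, with nonzero factor [N+1-n], and `lowerOp_comm` moves X_1^- outside on both sides.
-/
theorem rOp_affineLowerOp_cgFun (n N a b : ℕ) (hab : a + b = N + 1) :
    rOp h p₁ p₂ u (lowerOp h p₁ p₂ (-1) (qpow h (-2 * u)) 1 (cgFun h p₁ p₂ n)) a b
      = lowerOp h p₁ p₂ 1 (qpow h (-2 * u)) 1 (rOp h p₁ p₂ u (cgFun h p₁ p₂ n)) a b := by
  have hzero {N a b : ℕ} (hN : N < n) (hab : a + b = N + 1) :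
      rOp h p₁ p₂ u (lowerOp h p₁ p₂ (-1) (qpow h (-2 * u)) 1 (cgFun h p₁ p₂ n)) a b
      = lowerOp h p₁ p₂ 1 (qpow h (-2 * u)) 1 (rOp h p₁ p₂ u (cgFun h p₁ p₂ n)) a b := by
    have hz : ∀ x y, x + y = N → cgFun h p₁ p₂ n x y = (0 : ℕ → ℕ → ℂ) x y := fun x y hxy =>
      cgFun_of_lt p₁ p₂ (by omega)
    rw [rOp_congr h p₁ p₂ u (lowerOp_congr h p₁ p₂ _ _ _ hz) a b hab,
      lowerOp_congr h p₁ p₂ _ _ _ (rOp_congr h p₁ p₂ u hz) a b hab, map_zero, map_zero, map_zero]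
  induction N generalizing a b with
  | zero =>
    rcases Nat.eq_zero_or_pos n with rfl | hn
    · exact rOp_affineLowerOp_top hq hp₁ hp₂ hc hg 0 a b hab
    · exact hzero hn hab
  | succ N ih =>
    rcases lt_trichotomy (N + 1) n with hN | hN | hN
    · exact hzero hN hab
    · subst hN
      exact rOp_affineLowerOp_top hq hp₁ hp₂ hc hg (N + 1) a b hab
    have hne : qnum h (((N + 1 : ℕ) : ℂ) - n) ≠ 0 := by
      rw [← Nat.cast_sub hN.le]
      exact qnum_natCast_ne_zero hq (by omega)
    have hF : ∀ x y, x + y = N + 1 → (qnum h (((N + 1 : ℕ) : ℂ) - n) • cgFun h p₁ p₂ n) x y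
        = lowerOp h p₁ p₂ 1 1 1 (cgFun h p₁ p₂ n) x y := by
      intro x y hxy
      rw [lowerOp_cgFun hq]
      simp [← hxy]
    have h1 : qnum h (((N + 1 : ℕ) : ℂ) - n) • rOp h p₁ p₂ u
          (lowerOp h p₁ p₂ (-1) (qpow h (-2 * u)) 1 (cgFun h p₁ p₂ n)) a b
        = rOp h p₁ p₂ u (lowerOp h p₁ p₂ (-1) (qpow h (-2 * u)) 1
          (lowerOp h p₁ p₂ 1 1 1 (cgFun h p₁ p₂ n))) a b := by
      rw [← rOp_congr h p₁ p₂ u (lowerOp_congr h p₁ p₂ _ _ _ hF) a b hab, map_smul, map_smul]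
      rfl
    have h2 : qnum h (((N + 1 : ℕ) : ℂ) - n) • lowerOp h p₁ p₂ 1 (qpow h (-2 * u)) 1
          (rOp h p₁ p₂ u (cgFun h p₁ p₂ n)) a b
        = lowerOp h p₁ p₂ 1 (qpow h (-2 * u)) 1 (rOp h p₁ p₂ u
          (lowerOp h p₁ p₂ 1 1 1 (cgFun h p₁ p₂ n))) a b := by
      rw [← lowerOp_congr h p₁ p₂ _ _ _ (rOp_congr h p₁ p₂ u hF) a b hab, map_smul, map_smul]
      rfl
    apply smul_right_injective ℂ hne
    beta_reduce
    rw [h1, h2, ← lowerOp_comm, rOp_lowerOp hq hp₁ hp₂ hc, rOp_lowerOp hq hp₁ hp₂ hc, lowerOp_comm]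
    exact lowerOp_congr h p₁ p₂ _ _ _ (fun x y hxy => ih x y hxy) a b hab

theorem rOp_affineLowerOp (f : ℕ → ℕ → ℂ) :
    rOp h p₁ p₂ u (lowerOp h p₁ p₂ (-1) (qpow h (-2 * u)) 1 f)
      = lowerOp h p₁ p₂ 1 (qpow h (-2 * u)) 1 (rOp h p₁ p₂ u f) := by
  ext a b
  rcases hN : a + b with _ | N
  · obtain ⟨rfl, rfl⟩ : a = 0 ∧ b = 0 := by omega
    rw [rOp_apply, lowerOp_apply, sum_eq_zero fun n _ => by rw [form_zero_lowerOp]; ring]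
    simp
  have hf := fun x y (hxy : x + y = N) => cgFun_complete hq hp₁ hp₂ hc f hxy
  rw [rOp_congr h p₁ p₂ u (lowerOp_congr h p₁ p₂ _ _ _ hf) a b hN,
    lowerOp_congr h p₁ p₂ _ _ _ (rOp_congr h p₁ p₂ u hf) a b hN]
  simp only [map_sum, map_smul, Finset.sum_apply, Pi.smul_apply]
  exact sum_congr rfl fun n _ => by rw [rOp_affineLowerOp_cgFun hq hp₁ hp₂ hc hg n N a b hN]

omit hq hp₁ hp₂ hc hg in
-- The spectral sum is symmetric: g and the norms do not change under p₁ ↔ p₂, so transposing R only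
-- exchanges the tensor factors.
theorem form_rOp (N : ℕ) (f g : ℕ → ℕ → ℂ) : form h p₁ p₂ N f (rOp h p₁ p₂ u g)
    = form h p₁ p₂ N (swapFun (rOp h p₂ p₁ u (swapFun f))) g := by
  have hsymm (n : ℕ) : gfun h p₂ p₁ n u = gfun h p₁ p₂ n u := by
    simp only [gfun, sub_right_comm u p₂, add_right_comm u p₂]
  have form_sum (g : ℕ → ℕ → ℂ) (t : Finset ℕ) (c : ℕ → ℂ) (F : ℕ → ℕ → ℕ → ℂ) :
      form h p₁ p₂ N g (∑ n ∈ t, c n • F n) = ∑ n ∈ t, c n * form h p₁ p₂ N g (F n) := by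
    simp only [form, Finset.sum_apply, Pi.smul_apply, smul_eq_mul, mul_sum]
    rw [sum_comm]
    exact sum_congr rfl fun _ _ => sum_congr rfl fun _ _ => by ring
  rw [form_congr (g := rOp h p₁ p₂ u g) (fun _ _ _ => rfl)
      (fun a b hab => rOp_eq_sum h p₁ p₂ u g hab),
    form_comm _ (swapFun _), form_congr (fun _ _ _ => rfl)
      (g := swapFun (rOp h p₂ p₁ u (swapFun f))) (g' := ∑ n ∈ range (N + 1), (gfun h p₂ p₁ n u * cgNorm h p₂ p₁ n (N - n)
      * form h p₂ p₁ N (cgFun h p₂ p₁ n) (swapFun f)) • cgFun h p₁ p₂ n)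
      (fun a b hab => (rOp_eq_sum h p₂ p₁ u (swapFun f) (by omega : b + a = N)).trans
        (by simp [swapFun])), form_sum, form_sum]
  refine sum_congr rfl fun n _ => ?_
  rw [hsymm, cgNorm_symm, ← form_swap (p₁ := p₁), form_comm _ f, form_comm _ g,
    show swapFun (swapFun f) = f from rfl]
  ring

omit hq hc hg hp₁ hp₂ in
theorem eq_of_form_eq (hq : ∀ n : ℕ, 0 < n → Complex.exp h ^ n ≠ 1)
    (hp₁ : ∀ k : ℕ, qnum h (2 * p₁ - k) ≠ 0) (hp₂ : ∀ k : ℕ, qnum h (2 * p₂ - k) ≠ 0)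
    {f g : ℕ → ℕ → ℂ} {N a b : ℕ} (hab : a + b = N)
    (hfg : ∀ f', form h p₁ p₂ N f' f = form h p₁ p₂ N f' g) : f a b = g a b := by
  have h1 := hfg (fun x y => if x = a then 1 else 0)
  have h2 (g : ℕ → ℕ → ℂ) : form h p₁ p₂ N (fun x y => if x = a then 1 else 0) g
      = (qfact h a / qfall h (2 * p₁) a) * (qfact h b / qfall h (2 * p₂) b) * g a b := by
    rw [form, sum_eq_single_of_mem (a, b) (by simpa using hab)]
    · simp
    · rintro ⟨x, y⟩ hx hne
      have : x ≠ a := by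
        rintro rfl
        exact hne (by ext <;> simp at hx ⊢; omega)
      simp [this]
  rw [h2, h2] at h1
  exact mul_left_cancel₀ (mul_ne_zero (div_ne_zero (qfact_ne_zero hq a)
    (qfall_ne_zero fun k _ => hp₁ k)) (div_ne_zero (qfact_ne_zero hq b)
    (qfall_ne_zero fun k _ => hp₂ k))) h1

/-- The transpose of `rOp_affineLowerOp` for the exchanged parameters. Exchanging the factors turns
(x⁻¹, 1) into (1, x⁻¹), which is x⁻¹ times (x, 1). -/
theorem rOp_affineRaiseOp (f : ℕ → ℕ → ℂ) :
    rOp h p₁ p₂ u (raiseOp h p₁ p₂ (-1) (qpow h (-2 * u))⁻¹ 1 f)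
      = raiseOp h p₁ p₂ 1 (qpow h (-2 * u))⁻¹ 1 (rOp h p₁ p₂ u f) := by
  have hg' : GRegular h p₂ p₁ u := fun k => by rw [add_right_comm u]; exact hg k
  have hx : qpow h (-2 * u) ≠ 0 := qpow_ne_zero _ _
  have hscale (ε r₁ r₂ c : ℂ) (g : ℕ → ℕ → ℂ) :
      lowerOp h p₂ p₁ ε (c * r₁) (c * r₂) g = c • lowerOp h p₂ p₁ ε r₁ r₂ g := by
    ext a b
    simp only [lowerOp_apply, Pi.smul_apply, smul_eq_mul]
    ring
  ext a b
  refine eq_of_form_eq hq hp₁ hp₂ rfl fun f' => ?_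
  rw [form_rOp, ← form_lowerOp hp₁ hp₂, ← form_lowerOp hp₁ hp₂,
    form_rOp, lowerOp_swap]
  congr 2
  have e1 := hscale (- -1) (qpow h (-2 * u)) 1 (qpow h (-2 * u))⁻¹
    (rOp h p₂ p₁ u (swapFun f'))
  have e2 := hscale (-1) (qpow h (-2 * u)) 1 (qpow h (-2 * u))⁻¹ (swapFun f')
  rw [inv_mul_cancel₀ hx, mul_one] at e1 e2
  rw [e1, show swapFun (lowerOp h p₁ p₂ 1 (qpow h (-2 * u))⁻¹ 1 f')
    = lowerOp h p₂ p₁ (-1) 1 (qpow h (-2 * u))⁻¹ (swapFun f') by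
      rw [lowerOp_swap, neg_neg], e2, map_smul,
    rOp_affineLowerOp hq hp₂ hp₁ hc.symm hg', neg_neg]

end

end

end ColoredVertex

namespace ColoredVertex

noncomputable section

open Finset

/-! ### Monodromy matrices -/

/-- The entry `C` of the monodromy matrix of two sites with parameters `(p₁, u₁)`, `(p₂, u₂)`. -/
def monC (h p₁ u₁ p₂ u₂ y : ℂ) : (ℕ → ℕ → ℂ) →ₗ[ℂ] (ℕ → ℕ → ℂ) where
  toFun f a b := qpow h u₁ * qnum h ((a : ℂ) + 1) * qnum h (y + u₂ + p₂ - b) * f (a + 1) b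
    + qnum h (y + u₁ - p₁ + a) * (qpow h u₂ * qnum h ((b : ℂ) + 1)) * f a (b + 1)
  map_add' f g := by ext a b; simp; ring
  map_smul' c f := by ext a b; simp; ring

/-- The entry `A` of the monodromy matrix of two sites. -/
def monA (h p₁ u₁ p₂ u₂ y : ℂ) : (ℕ → ℕ → ℂ) →ₗ[ℂ] (ℕ → ℕ → ℂ) where
  toFun f a b := qnum h (y + u₁ + p₁ - a) * qnum h (y + u₂ + p₂ - b) * f a b
    + qpow h (-u₁) * qnum h (2 * p₁ - a + 1) * (qpow h u₂ * qnum h ((b : ℂ) + 1))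
      * prev (fun w => f w (b + 1)) a
  map_add' f g := by ext a b; cases a <;> simp <;> ring
  map_smul' c f := by ext a b; cases a <;> simp <;> ring

/-- The entry `D` of the monodromy matrix of two sites. -/
def monD (h p₁ u₁ p₂ u₂ y : ℂ) : (ℕ → ℕ → ℂ) →ₗ[ℂ] (ℕ → ℕ → ℂ) where
  toFun f a b := qnum h (y + u₁ - p₁ + a) * qnum h (y + u₂ - p₂ + b) * f a b
    + qpow h u₁ * qnum h ((a : ℂ) + 1) * (qpow h (-u₂) * qnum h (2 * p₂ - b + 1))
      * prev (f (a + 1)) b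
  map_add' f g := by ext a b; cases b <;> simp <;> ring
  map_smul' c f := by ext a b; cases b <;> simp <;> ring

section

variable (h p₁ u₁ p₂ u₂ y : ℂ) (f : ℕ → ℕ → ℂ) (a b : ℕ)

theorem monC_apply : monC h p₁ u₁ p₂ u₂ y f a b =
    qpow h u₁ * qnum h ((a : ℂ) + 1) * qnum h (y + u₂ + p₂ - b) * f (a + 1) b
    + qnum h (y + u₁ - p₁ + a) * (qpow h u₂ * qnum h ((b : ℂ) + 1)) * f a (b + 1) := rfl

theorem monA_apply : monA h p₁ u₁ p₂ u₂ y f a b =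
    qnum h (y + u₁ + p₁ - a) * qnum h (y + u₂ + p₂ - b) * f a b
    + qpow h (-u₁) * qnum h (2 * p₁ - a + 1) * (qpow h u₂ * qnum h ((b : ℂ) + 1))
      * prev (fun w => f w (b + 1)) a := rfl

theorem monD_apply : monD h p₁ u₁ p₂ u₂ y f a b =
    qnum h (y + u₁ - p₁ + a) * qnum h (y + u₂ - p₂ + b) * f a b
    + qpow h u₁ * qnum h ((a : ℂ) + 1) * (qpow h (-u₂) * qnum h (2 * p₂ - b + 1))
      * prev (f (a + 1)) b := rfl

variable {h} (hq : ∀ n : ℕ, 0 < n → Complex.exp h ^ n ≠ 1)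

include hq

omit hq in
-- The one-site matrix has diagonal entries [y+u_i±H/2] and off-diagonal entries q^{u_i}X⁺,
-- q^{-u_i}X⁻. Splitting the q-number in C into its two exponentials separates the coproducts of
-- X_1^+ and X_0^-.
theorem monC_eq : monC h p₁ u₁ p₂ u₂ y f
    = (qpow h (y + u₁ + u₂) / (qpow h 1 - qpow h (-1))) • raiseOp h p₁ p₂ 1 1 1 f
      - (qpow h (-y + u₂ - u₁) / (qpow h 1 - qpow h (-1)))
        • raiseOp h p₁ p₂ (-1) (qpow h (-2 * (u₁ - u₂)))⁻¹ 1 f := by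
  ext a b
  have e1 : qnum h (y + u₂ + p₂ - b) = (qpow h (y + u₂ + p₂ - b) - qpow h (-(y + u₂ + p₂ - b)))
    / (qpow h 1 - qpow h (-1)) := rfl
  have e2 : qnum h (y + u₁ - p₁ + a) = (qpow h (y + u₁ - p₁ + a) - qpow h (-(y + u₁ - p₁ + a)))
    / (qpow h 1 - qpow h (-1)) := rfl
  rw [monC_apply, Pi.sub_apply, Pi.sub_apply, Pi.smul_apply, Pi.smul_apply, Pi.smul_apply,
    Pi.smul_apply, raiseOp_apply, raiseOp_apply, smul_eq_mul, smul_eq_mul, e1, e2, ← qpow_neg]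
  have f1 : qpow h (y + u₁ + u₂) * qpow h (1 * (p₂ - b)) = qpow h u₁ * qpow h (y + u₂ + p₂ - b) := by
    rw [← qpow_add, ← qpow_add]; ring_nf
  have f2 : qpow h (y + u₁ + u₂) * qpow h (-1 * (p₁ - a)) = qpow h u₂ * qpow h (y + u₁ - p₁ + a) := by
    rw [← qpow_add, ← qpow_add]; ring_nf
  have f3 : qpow h (-y + u₂ - u₁) * (qpow h (-(-2 * (u₁ - u₂))) * qpow h (-1 * (p₂ - b)))
      = qpow h u₁ * qpow h (-(y + u₂ + p₂ - b)) := by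
    rw [← qpow_add, ← qpow_add, ← qpow_add]; ring_nf
  have f4 : qpow h (-y + u₂ - u₁) * qpow h (- -1 * (p₁ - a))
      = qpow h u₂ * qpow h (-(y + u₁ - p₁ + a)) := by
    rw [← qpow_add, ← qpow_add]; ring_nf
  linear_combination (-qnum h ((a : ℂ) + 1) * f (a + 1) b / (qpow h 1 - qpow h (-1))) * (f1 - f3)
    - (qnum h ((b : ℂ) + 1) * f a (b + 1) / (qpow h 1 - qpow h (-1))) * (f2 - f4)

/-- A is a q-commutator of X_1^+ and a rescaled X_0^+, plus a scalar depending only on the degree.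
The same holds for D in `monD_eq` with q² in place of q⁻². Therefore whatever commutes with the
generators and the degree commutes with A and D. -/
theorem monA_eq : (qpow h 1 - qpow h (-3)) * monA h p₁ u₁ p₂ u₂ y f a b
    = ((qpow h 1 - qpow h (-3)) / (qpow h 1 - qpow h (-1)) ^ 2
          * (qpow h (2 * y + u₁ + u₂ + p₁ + p₂ - ((a + b : ℕ) : ℂ))
            + qpow h (-(2 * y + u₁ + u₂ + p₁ + p₂ - ((a + b : ℕ) : ℂ))))
        - qpow h (p₁ + p₂ - ((a + b : ℕ) : ℂ)) * ((1 - qpow h (-2)) / (qpow h 1 - qpow h (-1)) ^ 2)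
          * (qpow h (u₂ - u₁) * (qpow h (2 * p₁ + 1) + qpow h (-(2 * p₁ + 1)))
            + qpow h (u₁ - u₂) * (qpow h (2 * p₂ + 1) + qpow h (-(2 * p₂ + 1))))) * f a b
      + qpow h (p₁ + p₂ - ((a + b : ℕ) : ℂ)) *
        (raiseOp h p₁ p₂ 1 1 1 (lowerOp h p₁ p₂ (-1) (qpow h (u₂ - u₁)) (qpow h (u₁ - u₂)) f) a b
          - qpow h (-2) * lowerOp h p₁ p₂ (-1) (qpow h (u₂ - u₁)) (qpow h (u₁ - u₂))
            (raiseOp h p₁ p₂ 1 1 1 f) a b) := by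
  have hd : qpow h 1 - (qpow h 1)⁻¹ ≠ 0 := qpow_neg h 1 ▸ q_sub_inv_ne_zero hq
  rcases a with _ | a <;> rcases b with _ | b <;>
    simp only [raiseOp_apply, lowerOp_apply, monA_apply, prev_zero, prev_succ, mul_zero, zero_add,
      add_zero, neg_neg, one_mul, neg_one_mul, qnum] <;> push_cast <;>
    simp only [qpow_add, qpow_sub, qpow_neg, qpow_zero, qpow_two_mul, qpow_two, qpow_three] <;>
    generalize qpow h 1 - (qpow h 1)⁻¹ = d at hd ⊢ <;>
    field_simp (disch := first | assumption | exact qpow_ne_zero _ _) <;> ring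

theorem monD_eq : (qpow h 3 - qpow h (-1)) * monD h p₁ u₁ p₂ u₂ y f a b
    = ((qpow h 3 - qpow h (-1)) / (qpow h 1 - qpow h (-1)) ^ 2
          * (qpow h (2 * y + u₁ + u₂ - p₁ - p₂ + ((a + b : ℕ) : ℂ))
            + qpow h (-(2 * y + u₁ + u₂ - p₁ - p₂ + ((a + b : ℕ) : ℂ))))
        + qpow h (-(p₁ + p₂ - ((a + b : ℕ) : ℂ)))
          * ((1 - qpow h 2) / (qpow h 1 - qpow h (-1)) ^ 2)
          * (qpow h (u₂ - u₁) * (qpow h (2 * p₁ + 1) + qpow h (-(2 * p₁ + 1)))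
            + qpow h (u₁ - u₂) * (qpow h (2 * p₂ + 1) + qpow h (-(2 * p₂ + 1))))) * f a b
      - qpow h (-(p₁ + p₂ - ((a + b : ℕ) : ℂ))) *
        (raiseOp h p₁ p₂ 1 1 1 (lowerOp h p₁ p₂ (-1) (qpow h (u₂ - u₁)) (qpow h (u₁ - u₂)) f) a b
          - qpow h 2 * lowerOp h p₁ p₂ (-1) (qpow h (u₂ - u₁)) (qpow h (u₁ - u₂))
            (raiseOp h p₁ p₂ 1 1 1 f) a b) := by
  have hd : qpow h 1 - (qpow h 1)⁻¹ ≠ 0 := qpow_neg h 1 ▸ q_sub_inv_ne_zero hq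
  rcases a with _ | a <;> rcases b with _ | b <;>
    simp only [raiseOp_apply, lowerOp_apply, monD_apply, prev_zero, prev_succ, mul_zero, zero_add,
      add_zero, neg_neg, one_mul, neg_one_mul, qnum] <;> push_cast <;>
    simp only [qpow_add, qpow_sub, qpow_neg, qpow_zero, qpow_two_mul, qpow_two, qpow_three] <;>
    generalize qpow h 1 - (qpow h 1)⁻¹ = d at hd ⊢ <;>
    field_simp (disch := first | assumption | exact qpow_ne_zero _ _) <;> ring

end

end

end ColoredVertex

/-! ### Intertwining of the two-site monodromy matrix -/

namespace ColoredVertex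

noncomputable section

open Finset

theorem rOp_degree_mul (h p₁ p₂ u : ℂ) (φ : ℕ → ℂ) (f : ℕ → ℕ → ℂ) :
    rOp h p₁ p₂ u (fun a b => φ (a + b) * f a b) = fun a b => φ (a + b) * rOp h p₁ p₂ u f a b := by
  ext a b
  rw [rOp_congr h p₁ p₂ u (g := φ (a + b) • f) (N := a + b) (fun x y hxy => by
    rw [hxy, Pi.smul_apply, Pi.smul_apply, smul_eq_mul]) a b rfl, map_smul]
  rfl

/-- The R operator followed by the exchange of the tensor factors. -/
def braidOp (h p₁ p₂ u : ℂ) : (ℕ → ℕ → ℂ) →ₗ[ℂ] (ℕ → ℕ → ℂ) where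
  toFun f := swapFun (rOp h p₁ p₂ u f)
  map_add' f g := by rw [map_add]; rfl
  map_smul' c f := by rw [map_smul]; rfl

theorem braidOp_apply (h p₁ p₂ u : ℂ) (f : ℕ → ℕ → ℂ) (a b : ℕ) :
    braidOp h p₁ p₂ u f a b = rOp h p₁ p₂ u f b a := rfl

theorem braidOp_congr (h p₁ p₂ u : ℂ) {f g : ℕ → ℕ → ℂ} {N : ℕ}
    (hfg : ∀ a b, a + b = N → f a b = g a b) (a b : ℕ) (hab : a + b = N) :
    braidOp h p₁ p₂ u f a b = braidOp h p₁ p₂ u g a b :=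
  rOp_congr h p₁ p₂ u hfg b a (by omega)

theorem lowerOp_smul (h p₁ p₂ ε r₁ r₂ c : ℂ) (f : ℕ → ℕ → ℂ) :
    lowerOp h p₁ p₂ ε (c * r₁) (c * r₂) f = c • lowerOp h p₁ p₂ ε r₁ r₂ f := by
  ext a b
  simp only [lowerOp_apply, Pi.smul_apply, smul_eq_mul]
  ring

theorem raiseOp_smul (h p₁ p₂ ε r₁ r₂ c : ℂ) (f : ℕ → ℕ → ℂ) :
    raiseOp h p₁ p₂ ε (c * r₁) (c * r₂) f = c • raiseOp h p₁ p₂ ε r₁ r₂ f := by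
  ext a b
  simp only [raiseOp_apply, Pi.smul_apply, smul_eq_mul]
  ring

section

variable {h : ℂ} (hq : ∀ n : ℕ, 0 < n → Complex.exp h ^ n ≠ 1) {p₁ p₂ u₁ u₂ : ℂ}
  (hp₁ : ∀ k : ℕ, qnum h (2 * p₁ - k) ≠ 0) (hp₂ : ∀ k : ℕ, qnum h (2 * p₂ - k) ≠ 0)
  (hc : CGGeneric h p₁ p₂) (hg : GRegular h p₁ p₂ (u₁ - u₂)) (y : ℂ) (f : ℕ → ℕ → ℂ)

include hq in
-- Expresses q⁴ ≠ 1; it allows the prefactors q-q⁻³ and q³-q⁻¹ of `monA_eq` and `monD_eq` to be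
-- cancelled.
theorem qpow_sub_qpow_ne_zero (z : ℂ) : qpow h (z + 4) - qpow h z ≠ 0 := by
  have h1 := qnum_natCast_ne_zero hq (n := 2) (by norm_num)
  rw [Ne, qnum_eq_zero_iff hq] at h1
  rw [qpow_add]
  intro h2
  refine h1 (mul_left_cancel₀ (qpow_ne_zero h z) ?_)
  rw [show (2 : ℂ) * (2 : ℕ) = 4 by norm_num]
  linear_combination h2

include hq hp₁ hp₂ hc hg

theorem braidOp_monC : braidOp h p₁ p₂ (u₁ - u₂) (monC h p₁ u₁ p₂ u₂ y f)
    = monC h p₂ u₂ p₁ u₁ y (braidOp h p₁ p₂ (u₁ - u₂) f) := by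
  have hs : swapFun (rOp h p₁ p₂ (u₁ - u₂) f) = braidOp h p₁ p₂ (u₁ - u₂) f := rfl
  have e := raiseOp_smul h p₁ p₂ 1 (qpow h (-2 * (u₁ - u₂)))⁻¹ 1 (qpow h (-2 * (u₁ - u₂)))
    (rOp h p₁ p₂ (u₁ - u₂) f)
  rw [mul_inv_cancel₀ (qpow_ne_zero _ _), mul_one] at e
  rw [monC_eq p₁ u₁ p₂ u₂ y f, monC_eq p₂ u₂ p₁ u₁ y, ← hs, raiseOp_swap, raiseOp_swap,
    neg_neg, show (qpow h (-2 * (u₂ - u₁)))⁻¹ = qpow h (-2 * (u₁ - u₂)) by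
      rw [← qpow_neg]; ring_nf, e]
  ext a b
  rw [braidOp_apply, map_sub, map_smul, map_smul, rOp_raiseOp hq hp₁ hp₂ hc,
    rOp_affineRaiseOp hq hp₁ hp₂ hc hg]
  simp only [Pi.sub_apply, Pi.smul_apply, smul_eq_mul, swapFun]
  have e2 : qpow h (-y + u₁ - u₂) * qpow h (-2 * (u₁ - u₂)) = qpow h (-y + u₂ - u₁) := by
    rw [← qpow_add]; ring_nf
  rw [← e2, add_right_comm y u₂]
  ring

/-- `rOp_affineLowerOp` multiplied by q^{u₁-u₂}. The coefficients q^{u₂-u₁}, q^{u₁-u₂} are then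
exchanged under exchange of the two sites. -/
theorem rOp_lowerOp_symm : rOp h p₁ p₂ (u₁ - u₂)
      (lowerOp h p₁ p₂ (-1) (qpow h (u₂ - u₁)) (qpow h (u₁ - u₂)) f)
    = lowerOp h p₁ p₂ 1 (qpow h (u₂ - u₁)) (qpow h (u₁ - u₂)) (rOp h p₁ p₂ (u₁ - u₂) f) := by
  have e : qpow h (u₂ - u₁) = qpow h (u₁ - u₂) * qpow h (-2 * (u₁ - u₂)) := by
    rw [← qpow_add]; ring_nf
  have e1 : qpow h (u₁ - u₂) = qpow h (u₁ - u₂) * 1 := (mul_one _).symm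
  rw [e]
  nth_rw 2 4 [e1]
  rw [lowerOp_smul, lowerOp_smul, map_smul, rOp_affineLowerOp hq hp₁ hp₂ hc hg]

theorem braidOp_monA : braidOp h p₁ p₂ (u₁ - u₂) (monA h p₁ u₁ p₂ u₂ y f)
    = monA h p₂ u₂ p₁ u₁ y (braidOp h p₁ p₂ (u₁ - u₂) f) := by
  have hs : swapFun (rOp h p₁ p₂ (u₁ - u₂) f) = braidOp h p₁ p₂ (u₁ - u₂) f := rfl
  have hne : qpow h 1 - qpow h (-3) ≠ 0 := by
    have := qpow_sub_qpow_ne_zero hq (-3)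
    norm_num at this ⊢
    exact this
  ext a b
  apply mul_left_cancel₀ hne
  rw [monA_eq p₂ u₂ p₁ u₁ y _ a b hq, ← hs, raiseOp_swap, lowerOp_swap, lowerOp_swap, raiseOp_swap,
    neg_neg, ← rOp_lowerOp_symm hq hp₁ hp₂ hc hg, ← rOp_raiseOp hq hp₁ hp₂ hc,
    ← rOp_raiseOp hq hp₁ hp₂ hc, ← rOp_lowerOp_symm hq hp₁ hp₂ hc hg, ← smul_eq_mul,
    ← Pi.smul_apply, ← Pi.smul_apply, ← map_smul, braidOp_apply]
  have key : (qpow h 1 - qpow h (-3)) • monA h p₁ u₁ p₂ u₂ y f = _ :=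
    funext₂ fun a b => monA_eq p₁ u₁ p₂ u₂ y f a b hq
  rw [key]
  -- Both degree-dependent scalars are symmetric under exchange of (p₁, u₁) and (p₂, u₂), so they
  -- are the same before and after the braiding.
  let φ (n : ℕ) : ℂ := (qpow h 1 - qpow h (-3)) / (qpow h 1 - qpow h (-1)) ^ 2
          * (qpow h (2 * y + u₁ + u₂ + p₁ + p₂ - (n : ℂ))
            + qpow h (-(2 * y + u₁ + u₂ + p₁ + p₂ - (n : ℂ))))
        - qpow h (p₁ + p₂ - (n : ℂ)) * ((1 - qpow h (-2)) / (qpow h 1 - qpow h (-1)) ^ 2)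
          * (qpow h (u₂ - u₁) * (qpow h (2 * p₁ + 1) + qpow h (-(2 * p₁ + 1)))
            + qpow h (u₁ - u₂) * (qpow h (2 * p₂ + 1) + qpow h (-(2 * p₂ + 1))))
  let ψ (n : ℕ) : ℂ := qpow h (p₁ + p₂ - (n : ℂ))
  set X := raiseOp h p₁ p₂ 1 1 1 (lowerOp h p₁ p₂ (-1) (qpow h (u₂ - u₁)) (qpow h (u₁ - u₂)) f)
  set Y := lowerOp h p₁ p₂ (-1) (qpow h (u₂ - u₁)) (qpow h (u₁ - u₂)) (raiseOp h p₁ p₂ 1 1 1 f)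
  have key2 : (fun a b => φ (a + b) * f a b + ψ (a + b) * (X a b - qpow h (-2) * Y a b))
      = (fun a b => φ (a + b) * f a b) + (fun a b => ψ (a + b) * (X - qpow h (-2) • Y) a b) := rfl
  change rOp h p₁ p₂ (u₁ - u₂) (fun a b => φ (a + b) * f a b
    + ψ (a + b) * (X a b - qpow h (-2) * Y a b)) b a = _
  rw [key2, map_add, rOp_degree_mul, rOp_degree_mul, map_sub, map_smul]
  simp only [φ, ψ, Pi.add_apply, swapFun, Pi.sub_apply, Pi.smul_apply, smul_eq_mul, add_comm b a,
    add_right_comm _ u₂ u₁, add_right_comm _ p₂ p₁, add_comm p₂ p₁]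
  ring

theorem braidOp_monD : braidOp h p₁ p₂ (u₁ - u₂) (monD h p₁ u₁ p₂ u₂ y f)
    = monD h p₂ u₂ p₁ u₁ y (braidOp h p₁ p₂ (u₁ - u₂) f) := by
  have hs : swapFun (rOp h p₁ p₂ (u₁ - u₂) f) = braidOp h p₁ p₂ (u₁ - u₂) f := rfl
  have hne : qpow h 3 - qpow h (-1) ≠ 0 := by
    have := qpow_sub_qpow_ne_zero hq (-1)
    norm_num at this ⊢
    exact this
  ext a b
  apply mul_left_cancel₀ hne
  rw [monD_eq p₂ u₂ p₁ u₁ y _ a b hq, ← hs, raiseOp_swap, lowerOp_swap, lowerOp_swap, raiseOp_swap,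
    neg_neg, ← rOp_lowerOp_symm hq hp₁ hp₂ hc hg, ← rOp_raiseOp hq hp₁ hp₂ hc,
    ← rOp_raiseOp hq hp₁ hp₂ hc, ← rOp_lowerOp_symm hq hp₁ hp₂ hc hg, ← smul_eq_mul,
    ← Pi.smul_apply, ← Pi.smul_apply, ← map_smul, braidOp_apply]
  have key : (qpow h 3 - qpow h (-1)) • monD h p₁ u₁ p₂ u₂ y f = _ :=
    funext₂ fun a b => monD_eq p₁ u₁ p₂ u₂ y f a b hq
  rw [key]
  let φ (n : ℕ) : ℂ := (qpow h 3 - qpow h (-1)) / (qpow h 1 - qpow h (-1)) ^ 2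
          * (qpow h (2 * y + u₁ + u₂ - p₁ - p₂ + (n : ℂ))
            + qpow h (-(2 * y + u₁ + u₂ - p₁ - p₂ + (n : ℂ))))
        + qpow h (-(p₁ + p₂ - (n : ℂ))) * ((1 - qpow h 2) / (qpow h 1 - qpow h (-1)) ^ 2)
          * (qpow h (u₂ - u₁) * (qpow h (2 * p₁ + 1) + qpow h (-(2 * p₁ + 1)))
            + qpow h (u₁ - u₂) * (qpow h (2 * p₂ + 1) + qpow h (-(2 * p₂ + 1))))
  let ψ (n : ℕ) : ℂ := qpow h (-(p₁ + p₂ - (n : ℂ)))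
  set X := raiseOp h p₁ p₂ 1 1 1 (lowerOp h p₁ p₂ (-1) (qpow h (u₂ - u₁)) (qpow h (u₁ - u₂)) f)
  set Y := lowerOp h p₁ p₂ (-1) (qpow h (u₂ - u₁)) (qpow h (u₁ - u₂)) (raiseOp h p₁ p₂ 1 1 1 f)
  have key2 : (fun a b => φ (a + b) * f a b - ψ (a + b) * (X a b - qpow h 2 * Y a b))
      = (fun a b => φ (a + b) * f a b) - (fun a b => ψ (a + b) * (X - qpow h 2 • Y) a b) := rfl
  change rOp h p₁ p₂ (u₁ - u₂) (fun a b => φ (a + b) * f a b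
    - ψ (a + b) * (X a b - qpow h 2 * Y a b)) b a = _
  rw [key2, map_sub, rOp_degree_mul, rOp_degree_mul, map_sub, map_smul]
  simp only [φ, ψ, Pi.sub_apply, swapFun, Pi.smul_apply, smul_eq_mul, add_comm b a,
    add_right_comm _ u₂ u₁, sub_right_comm _ p₂ p₁, add_comm p₂ p₁]
  ring

end

end

end ColoredVertex

namespace ColoredVertex

noncomputable section

open Finset

/-! ### Three sites -/

/-- An operator on two sites, acting on the first two of three sites. -/
def act12 (T : (ℕ → ℕ → ℂ) →ₗ[ℂ] (ℕ → ℕ → ℂ)) (F : ℕ → ℕ → ℕ → ℂ) : ℕ → ℕ → ℕ → ℂ :=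
  fun a b c => T (fun x y => F x y c) a b

/-- An operator on two sites, acting on the last two of three sites. -/
def act23 (T : (ℕ → ℕ → ℂ) →ₗ[ℂ] (ℕ → ℕ → ℂ)) (F : ℕ → ℕ → ℕ → ℂ) : ℕ → ℕ → ℕ → ℂ :=
  fun a b c => T (F a) b c

/-- The entry `C` of the monodromy matrix of three sites. -/
def monC3 (h p₁ u₁ p₂ u₂ p₃ u₃ y : ℂ) (F : ℕ → ℕ → ℕ → ℂ) : ℕ → ℕ → ℕ → ℂ :=
  fun a b c => qpow h u₁ * qnum h ((a : ℂ) + 1) * monA h p₂ u₂ p₃ u₃ y (F (a + 1)) b c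
    + qnum h (y + u₁ - p₁ + a) * monC h p₂ u₂ p₃ u₃ y (F a) b c

theorem monC3_apply (h p₁ u₁ p₂ u₂ p₃ u₃ y : ℂ) (F : ℕ → ℕ → ℕ → ℂ) (a b c : ℕ) :
    monC3 h p₁ u₁ p₂ u₂ p₃ u₃ y F a b c
      = qpow h u₁ * qnum h ((a : ℂ) + 1) * monA h p₂ u₂ p₃ u₃ y (F (a + 1)) b c
        + qnum h (y + u₁ - p₁ + a) * monC h p₂ u₂ p₃ u₃ y (F a) b c := rfl

theorem monC3_sub (h p₁ u₁ p₂ u₂ p₃ u₃ y : ℂ) (F G : ℕ → ℕ → ℕ → ℂ) :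
    monC3 h p₁ u₁ p₂ u₂ p₃ u₃ y (F - G)
      = monC3 h p₁ u₁ p₂ u₂ p₃ u₃ y F - monC3 h p₁ u₁ p₂ u₂ p₃ u₃ y G := by
  ext a b c
  simp only [monC3_apply, Pi.sub_apply, map_sub]
  ring

/-- Associativity of the product of three one-site matrices: the bracketing C₁A₂₃ + D₁C₂₃ suits an
operator on the last two sites, C₁₂A₃ + D₁₂C₃ one on the first two. -/
theorem monC3_eq (h p₁ u₁ p₂ u₂ p₃ u₃ y : ℂ) (F : ℕ → ℕ → ℕ → ℂ) (a b c : ℕ) :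
    monC3 h p₁ u₁ p₂ u₂ p₃ u₃ y F a b c
      = qnum h (y + u₃ + p₃ - c) * monC h p₁ u₁ p₂ u₂ y (fun x y => F x y c) a b
        + qpow h u₃ * qnum h ((c : ℂ) + 1)
          * monD h p₁ u₁ p₂ u₂ y (fun x y => F x y (c + 1)) a b := by
  rcases b with _ | b <;>
    simp only [monC3_apply, monA_apply, monC_apply, monD_apply, prev_zero, prev_succ] <;> ring

section

variable {h : ℂ} (hq : ∀ n : ℕ, 0 < n → Complex.exp h ^ n ≠ 1)

section

variable {p₁ p₂ u₁ u₂ : ℂ}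
  (hp₁ : ∀ k : ℕ, qnum h (2 * p₁ - k) ≠ 0) (hp₂ : ∀ k : ℕ, qnum h (2 * p₂ - k) ≠ 0)
  (hc : CGGeneric h p₁ p₂) (hg : GRegular h p₁ p₂ (u₁ - u₂)) (p₃ u₃ y : ℂ) (F : ℕ → ℕ → ℕ → ℂ)

include hq hp₁ hp₂ hc hg

theorem act12_monC3 : act12 (braidOp h p₁ p₂ (u₁ - u₂)) (monC3 h p₁ u₁ p₂ u₂ p₃ u₃ y F)
    = monC3 h p₂ u₂ p₁ u₁ p₃ u₃ y (act12 (braidOp h p₁ p₂ (u₁ - u₂)) F) := by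
  ext a b c
  have e : (fun x z => monC3 h p₁ u₁ p₂ u₂ p₃ u₃ y F x z c)
      = qnum h (y + u₃ + p₃ - c) • monC h p₁ u₁ p₂ u₂ y (fun x y => F x y c)
        + (qpow h u₃ * qnum h ((c : ℂ) + 1)) • monD h p₁ u₁ p₂ u₂ y (fun x y => F x y (c + 1)) :=
    funext₂ fun x z => monC3_eq h p₁ u₁ p₂ u₂ p₃ u₃ y F x z c
  rw [act12, e, map_add, map_smul, map_smul, braidOp_monC hq hp₁ hp₂ hc hg,
    braidOp_monD hq hp₁ hp₂ hc hg, monC3_eq]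
  rfl

theorem act23_monC3 : act23 (braidOp h p₁ p₂ (u₁ - u₂)) (monC3 h p₃ u₃ p₁ u₁ p₂ u₂ y F)
    = monC3 h p₃ u₃ p₂ u₂ p₁ u₁ y (act23 (braidOp h p₁ p₂ (u₁ - u₂)) F) := by
  ext a b c
  have e : monC3 h p₃ u₃ p₁ u₁ p₂ u₂ y F a
      = (qpow h u₃ * qnum h ((a : ℂ) + 1)) • monA h p₁ u₁ p₂ u₂ y (F (a + 1))
        + qnum h (y + u₃ - p₃ + a) • monC h p₁ u₁ p₂ u₂ y (F a) := rfl
  rw [act23, e, map_add, map_smul, map_smul, braidOp_monC hq hp₁ hp₂ hc hg,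
    braidOp_monA hq hp₁ hp₂ hc hg, monC3_apply]
  rfl

end

include hq

/-- Each q-number vanishes for at most one y among 0, 1, 2, since two zeros would force [1] = 0 or
[2] = 0; two conditions thus leave an admissible value. -/
theorem exists_qnum_ne_zero (r t : ℂ) : ∃ y, qnum h (y + r) ≠ 0 ∧ qnum h (y + t) ≠ 0 := by
  have key (z y : ℂ) (n : ℕ) (hn : 0 < n) (h1 : qnum h (y + z) = 0)
      (h2 : qnum h (y + n + z) = 0) : False := by
    apply qnum_natCast_ne_zero hq hn
    rw [qnum_eq_zero_iff hq] at *
    rw [show 2 * (y + n + z) = 2 * (y + z) + 2 * n by ring, qpow_add, h1, one_mul] at h2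
    exact h2
  by_contra! H
  have k01 (z : ℂ) := key z 0 1 one_pos
  have k02 (z : ℂ) := key z 0 2 two_pos
  have k12 (z : ℂ) := key z 1 1 one_pos
  have h0 := H 0
  have h1 := H (0 + (1 : ℕ))
  have h2 := H (0 + (2 : ℕ))
  rw [show ((1 : ℂ) + (1 : ℕ)) = 0 + (2 : ℕ) by norm_num,
    show (1 : ℂ) = 0 + (1 : ℕ) by norm_num] at k12
  by_cases a0 : qnum h (0 + r) = 0 <;> by_cases a1 : qnum h (0 + (1 : ℕ) + r) = 0
  · exact k01 _ a0 a1
  · by_cases a2 : qnum h (0 + (2 : ℕ) + r) = 0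
    · exact k02 _ a0 a2
    · exact k12 _ (h1 a1) (h2 a2)
  · by_cases a2 : qnum h (0 + (2 : ℕ) + r) = 0
    · exact k12 _ a1 a2
    · exact k02 _ (h0 a0) (h2 a2)
  · exact k01 _ (h0 a0) (h1 a1)

/-- The only vectors annihilated by C(y) for all y lie in degree 0. Special values of y switch off
one term of C(y), and the remaining operator A₂₃ or D₁₂ is triangular in the middle index, with
diagonal entries that are precisely the denominators of g. -/
theorem monC3_injective {p₁ u₁ p₂ u₂ p₃ u₃ : ℂ} (h₁₂ : GRegular h p₁ p₂ (u₂ - u₁))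
    (h₁₃ : GRegular h p₁ p₃ (u₃ - u₁)) (h₂₃ : GRegular h p₂ p₃ (u₃ - u₂)) {F : ℕ → ℕ → ℕ → ℂ}
    {N : ℕ} (hF : ∀ y a b c, a + b + c = N → monC3 h p₁ u₁ p₂ u₂ p₃ u₃ y F a b c = 0)
    (a b c : ℕ) (habc : a + b + c = N + 1) : F a b c = 0 := by
  have h1 (a : ℕ) : ∀ b c, a + b + c = N → F (a + 1) b c = 0 := by
    intro b
    induction b with
    | zero =>
      intro c hc
      -- This y is the zero of D₁ on e_a, leaving C₁A₂₃; the induction on b removes the off-diagonal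
      -- term of A₂₃.
      have := hF (p₁ - u₁ - a) a 0 c hc
      rw [monC3_apply, show p₁ - u₁ - a + u₁ - p₁ + a = 0 by ring, qnum_zero, monA_apply,
        prev_zero] at this
      have g1 := h₁₂ a
      have g2 := h₁₃ (a + c)
      rw [show p₁ - u₁ - a + u₂ + p₂ - (0 : ℕ) = u₂ - u₁ + p₁ + p₂ - a by push_cast; ring,
        show p₁ - u₁ - a + u₃ + p₃ - c = u₃ - u₁ + p₁ + p₃ - (a + c : ℕ) by push_cast; ring] at this
      simpa [-Nat.cast_add, qpow_ne_zero, qnum_natCast_add_one_ne_zero hq, g1, g2] using this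
    | succ b ih =>
      intro c hc
      have := hF (p₁ - u₁ - a) a (b + 1) c hc
      rw [monC3_apply, show p₁ - u₁ - a + u₁ - p₁ + a = 0 by ring, qnum_zero, monA_apply,
        prev_succ, ih (c + 1) (by omega)] at this
      have g1 := h₁₂ (a + (b + 1))
      have g2 := h₁₃ (a + c)
      rw [show p₁ - u₁ - a + u₂ + p₂ - (b + 1 : ℕ) = u₂ - u₁ + p₁ + p₂ - (a + (b + 1) : ℕ) by
          push_cast; ring,
        show p₁ - u₁ - a + u₃ + p₃ - c = u₃ - u₁ + p₁ + p₃ - (a + c : ℕ) by push_cast; ring] at this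
      simpa [-Nat.cast_add, qpow_ne_zero, qnum_natCast_add_one_ne_zero hq, g1, g2] using this
  have h2 (c : ℕ) : ∀ b a, a + b + c = N → F a b (c + 1) = 0 := by
    intro b
    induction b with
    | zero =>
      intro a hc
      -- This y is the zero of A₃ on e_c, leaving D₁₂C₃.
      have := hF (c - u₃ - p₃) a 0 c hc
      rw [monC3_eq, show c - u₃ - p₃ + u₃ + p₃ - c = 0 by ring, qnum_zero, monD_apply,
        prev_zero] at this
      have g1 := h₁₃ (a + c)
      have g2 := h₂₃ c
      rw [show c - u₃ - p₃ + u₁ - p₁ + a = -(u₃ - u₁ + p₁ + p₃ - (a + c : ℕ)) by push_cast; ring,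
        show c - u₃ - p₃ + u₂ - p₂ + (0 : ℕ) = -(u₃ - u₂ + p₂ + p₃ - c) by push_cast; ring,
        qnum_neg, qnum_neg] at this
      simpa [-Nat.cast_add, qpow_ne_zero, qnum_natCast_add_one_ne_zero hq, g1, g2] using this
    | succ b ih =>
      intro a hc
      have := hF (c - u₃ - p₃) a (b + 1) c hc
      rw [monC3_eq, show c - u₃ - p₃ + u₃ + p₃ - c = 0 by ring, qnum_zero, monD_apply,
        prev_succ, ih (a + 1) (by omega)] at this
      have g1 := h₁₃ (a + c)
      have g2 := h₂₃ (b + 1 + c)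
      rw [show c - u₃ - p₃ + u₁ - p₁ + a = -(u₃ - u₁ + p₁ + p₃ - (a + c : ℕ)) by push_cast; ring,
        show c - u₃ - p₃ + u₂ - p₂ + (b + 1 : ℕ) = -(u₃ - u₂ + p₂ + p₃ - (b + 1 + c : ℕ)) by
          push_cast; ring, qnum_neg, qnum_neg] at this
      simpa [-Nat.cast_add, qpow_ne_zero, qnum_natCast_add_one_ne_zero hq, g1, g2] using this
  rcases a with _ | a
  · rcases c with _ | c
    · rcases b with _ | b
      · omega
      -- Only the vector with both outer indices 0 is left. It enters C(y) solely through D₁C₂A₃,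
      -- and y is taken with both diagonal factors nonzero.
      · obtain ⟨y, hy₁, hy₂⟩ := exists_qnum_ne_zero hq (u₁ - p₁) (u₃ + p₃)
        have := hF y 0 b 0 (by omega)
        rw [monC3_apply, monA_apply, monC_apply, h1 0 b 0 (by omega), h2 0 b 0 (by omega)] at this
        have e : prev (fun w => F (0 + 1) w (0 + 1)) b = 0 := by
          rcases b with _ | b
          · rfl
          · exact h1 0 b 1 (by omega)
        rw [e] at this
        rw [← add_sub_assoc] at hy₁
        rw [← add_assoc] at hy₂
        simpa [qpow_ne_zero, qnum_natCast_add_one_ne_zero hq, hy₁, hy₂] using this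
    · exact h2 c b 0 (by omega)
  · exact h1 a b c (by omega)

/-- The Yang-Baxter equation in braid form. -/
theorem braidOp_yangBaxter {p₁ p₂ p₃ u₁ u₂ u₃ : ℂ} (hp₁ : ∀ k : ℕ, qnum h (2 * p₁ - k) ≠ 0)
    (hp₂ : ∀ k : ℕ, qnum h (2 * p₂ - k) ≠ 0) (hp₃ : ∀ k : ℕ, qnum h (2 * p₃ - k) ≠ 0)
    (hc₁₂ : CGGeneric h p₁ p₂) (hc₁₃ : CGGeneric h p₁ p₃) (hc₂₃ : CGGeneric h p₂ p₃)
    (hg₁₂ : GRegular h p₁ p₂ (u₁ - u₂)) (hg₁₃ : GRegular h p₁ p₃ (u₁ - u₃))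
    (hg₂₃ : GRegular h p₂ p₃ (u₂ - u₃)) (F : ℕ → ℕ → ℕ → ℂ) :
    act12 (braidOp h p₂ p₃ (u₂ - u₃)) (act23 (braidOp h p₁ p₃ (u₁ - u₃))
        (act12 (braidOp h p₁ p₂ (u₁ - u₂)) F))
      = act23 (braidOp h p₁ p₂ (u₁ - u₂)) (act12 (braidOp h p₁ p₃ (u₁ - u₃))
        (act23 (braidOp h p₂ p₃ (u₂ - u₃)) F)) := by
  suffices H : ∀ N F a b c, a + b + c = N →
      act12 (braidOp h p₂ p₃ (u₂ - u₃)) (act23 (braidOp h p₁ p₃ (u₁ - u₃))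
        (act12 (braidOp h p₁ p₂ (u₁ - u₂)) F)) a b c
      = act23 (braidOp h p₁ p₂ (u₁ - u₂)) (act12 (braidOp h p₁ p₃ (u₁ - u₃))
        (act23 (braidOp h p₂ p₃ (u₂ - u₃)) F)) a b c from
    funext₃ fun a b c => H _ F a b c rfl
  intro N
  induction N with
  | zero =>
    intro F a b c habc
    obtain ⟨rfl, rfl, rfl⟩ : a = 0 ∧ b = 0 ∧ c = 0 := by omega
    -- Degree 0 is one-dimensional, so the braid operators are scalars there and the two words have
    -- the same three factors.
    have e (p p' u : ℂ) (f : ℕ → ℕ → ℂ) : braidOp h p p' u f 0 0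
        = braidOp h p p' u (fun _ _ => 1) 0 0 * f 0 0 := by
      rw [mul_comm, ← smul_eq_mul, ← Pi.smul_apply, ← Pi.smul_apply, ← map_smul]
      refine braidOp_congr h p p' u (N := 0) (fun a b hab => ?_) 0 0 rfl
      obtain ⟨rfl, rfl⟩ : a = 0 ∧ b = 0 := by omega
      simp
    have e12 (p p' u : ℂ) (F : ℕ → ℕ → ℕ → ℂ) : act12 (braidOp h p p' u) F 0 0 0
        = braidOp h p p' u (fun _ _ => 1) 0 0 * F 0 0 0 := e p p' u _
    have e23 (p p' u : ℂ) (F : ℕ → ℕ → ℕ → ℂ) : act23 (braidOp h p p' u) F 0 0 0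
        = braidOp h p p' u (fun _ _ => 1) 0 0 * F 0 0 0 := e p p' u _
    simp only [e12, e23]
    ring
  | succ N ih =>
    intro F a b c habc
    rw [← sub_eq_zero]
    have hr {p p' u : ℂ} (H : GRegular h p p' u) : GRegular h p' p u := fun k => by
      rw [add_right_comm u]; exact H k
    -- Both words reverse the order of the sites, so injectivity is needed for the parameters in the
    -- order 3, 2, 1.
    have := monC3_injective hq (p₁ := p₃) (u₁ := u₃) (p₂ := p₂) (u₂ := u₂) (p₃ := p₁) (u₃ := u₁)
      (hr hg₂₃) (hr hg₁₃) (hr hg₁₂) (F := act12 (braidOp h p₂ p₃ (u₂ - u₃))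
        (act23 (braidOp h p₁ p₃ (u₁ - u₃)) (act12 (braidOp h p₁ p₂ (u₁ - u₂)) F))
      - act23 (braidOp h p₁ p₂ (u₁ - u₂)) (act12 (braidOp h p₁ p₃ (u₁ - u₃))
        (act23 (braidOp h p₂ p₃ (u₂ - u₃)) F))) (N := N) ?_ a b c habc
    · exact this
    · intro y a b c habc
      rw [monC3_sub, ← act12_monC3 hq hp₂ hp₃ hc₂₃ hg₂₃, ← act23_monC3 hq hp₁ hp₃ hc₁₃ hg₁₃,
        ← act12_monC3 hq hp₁ hp₂ hc₁₂ hg₁₂, ← act23_monC3 hq hp₁ hp₂ hc₁₂ hg₁₂,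
        ← act12_monC3 hq hp₁ hp₃ hc₁₃ hg₁₃, ← act23_monC3 hq hp₂ hp₃ hc₂₃ hg₂₃]
      exact sub_eq_zero.2 (ih _ a b c habc)

end

end

end ColoredVertex

namespace ColoredVertex

noncomputable section

open Finset

/-! ### R matrices with a free choice of the square roots

`σᵢ k` is a square root of `[2pᵢ - k]_q`. -/

/-- `∏_{k<m} σ k`. -/
def rootProd (σ : ℕ → ℂ) (m : ℕ) : ℂ := ∏ i ∈ range m, σ i

/-- `∏_{i<m} σ (k + i)`. -/
def rootFall (σ : ℕ → ℂ) (k m : ℕ) : ℂ := ∏ i ∈ range m, σ (k + i)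

theorem rootProd_mul_rootFall (σ : ℕ → ℂ) (k m : ℕ) :
    rootProd σ k * rootFall σ k m = rootProd σ (k + m) := (prod_range_add σ k m).symm

theorem rootProd_ne_zero {σ : ℕ → ℂ} (hσ : ∀ k, σ k ≠ 0) (m : ℕ) : rootProd σ m ≠ 0 :=
  prod_ne_zero_iff.2 fun k _ => hσ k

theorem rootProd_sq {h p : ℂ} {σ : ℕ → ℂ} (hσ : ∀ k, σ k ^ 2 = qnum h (2 * p - k)) (m : ℕ) :
    rootProd σ m ^ 2 = qfall h (2 * p) m := by
  rw [rootProd, ← prod_pow]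
  exact prod_congr rfl fun k _ => hσ k

/-- The Clebsch-Gordan coefficient without the factors common to all terms. -/
def cgRoot (h p₁ p₂ : ℂ) (σ₁ σ₂ : ℕ → ℂ) (n z₁ z₂ : ℕ) : ℂ :=
  qpow h (((n : ℂ) - (n : ℂ) ^ 2) / 2 + ((n : ℂ) - z₂) * p₁ + ((n : ℂ) + z₁) * p₂)
    * ∑ ν ∈ Icc (n - z₂) (min n z₁),
        (-1) ^ ν * qpow h (-(ν : ℂ) * (2 * p₁ + 2 * p₂ - n + 1))
          / (qfact h ν * qfact h (n - ν) * qfact h (z₁ - ν) * qfact h (z₂ + ν - n))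
          * (rootFall σ₁ n (z₁ - ν) * rootFall σ₁ z₁ (n - ν)
              * rootFall σ₂ n (z₂ + ν - n) * rootFall σ₂ z₂ ν)

/-- The contribution of `p₁ + p₂ - n` to a matrix element of the R matrix. -/
def rootTerm (h : ℂ) (s : ℂ → ℂ) (p₁ p₂ u : ℂ) (σ₁ σ₂ : ℕ → ℂ) (a b : ℕ × ℕ) (n : ℕ) : ℂ :=
  gfun h p₁ p₂ n u * (qnum h (2 * p₁ + 2 * p₂ - 2 * n + 1) * (qfact h n * qfact h (b.1 + b.2 - n))
      / qfall h (2 * p₁ + 2 * p₂ - n + 1) (b.1 + b.2 + 1))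
    * ((sqrtFact h s b.1 * sqrtFact h s b.2 * cgRoot h p₁ p₂ σ₁ σ₂ n b.1 b.2)
      * (sqrtFact h s a.1 * sqrtFact h s a.2 * cgRoot h p₂ p₁ σ₂ σ₁ n a.2 a.1))

/-- The R matrix for a given choice of the square roots of `[2pᵢ - k]_q`. -/
def rootR (h : ℂ) (s : ℂ → ℂ) (p₁ p₂ u : ℂ) (σ₁ σ₂ : ℕ → ℂ) (a b : ℕ × ℕ) : ℂ :=
  if a.1 + a.2 = b.1 + b.2 then
    ∑ n ∈ range (b.1 + b.2 + 1), rootTerm h s p₁ p₂ u σ₁ σ₂ a b n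
  else 0

theorem rootR_of_ne {h : ℂ} {s : ℂ → ℂ} {p₁ p₂ u : ℂ} {σ₁ σ₂ : ℕ → ℂ} {a b : ℕ × ℕ}
    (hab : a.1 + a.2 ≠ b.1 + b.2) : rootR h s p₁ p₂ u σ₁ σ₂ a b = 0 := if_neg hab

/-- The square roots `s ([2p - k]_q)`. -/
def stdRoot (h : ℂ) (s : ℂ → ℂ) (p : ℂ) (k : ℕ) : ℂ := s (qnum h (2 * p - k))

section

variable {h : ℂ} {s : ℂ → ℂ}

theorem sqrtFall_eq_rootFall (p : ℂ) (k m : ℕ) :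
    sqrtFall h s (2 * p - k) m = rootFall (stdRoot h s p) k m :=
  prod_congr rfl fun i _ => by rw [stdRoot, Nat.cast_add, sub_add_eq_sub_sub]

theorem cgPP_eq (p₁ p₂ : ℂ) (n z₁ z₂ z₃ : ℕ) (hz : z₃ + n = z₁ + z₂) :
    cgPP h s p₁ p₂ n z₁ z₂ z₃ = s (qnum h (2 * p₁ + 2 * p₂ - 2 * n + 1))
      * (sqrtFact h s n * sqrtFact h s z₁ * sqrtFact h s z₂ * sqrtFact h s z₃)
      / sqrtFall h s (2 * p₁ + 2 * p₂ - n + 1) (z₁ + z₂ + 1)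
      * cgRoot h p₁ p₂ (stdRoot h s p₁) (stdRoot h s p₂) n z₁ z₂ := by
  simp only [cgPP, cgOn, if_pos hz, cgRoot, sqrtFall_eq_rootFall, mul_sum]
  exact sum_congr rfl fun ν _ => by ring

variable (hs : ∀ z, s z ^ 2 = z)

include hs in
theorem sqrtFall_sq (p : ℂ) (n : ℕ) : sqrtFall h s p n ^ 2 = qfall h p n := by
  rw [sqrtFall, ← prod_pow]
  exact prod_congr rfl fun k _ => hs _

include hs in
theorem sqrtFact_sq (n : ℕ) : sqrtFact h s n ^ 2 = qfact h n := by
  rw [sqrtFact, ← prod_pow]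
  exact prod_congr rfl fun k _ => hs _

include hs in
-- The roots of [2p₁+2p₂-2n+1], [n]!, [z]! and of the denominator occur once in each Clebsch-Gordan
-- coefficient, hence only squared in R. Apart from the factorials of the indices, the choice of
-- roots matters only through [2p_i-k].
theorem termPP_eq (p₁ p₂ u : ℂ) (a b : ℕ × ℕ) (n z : ℕ) (hb : z + n = b.1 + b.2)
    (ha : z + n = a.1 + a.2) : termPP h s p₁ p₂ u a b (n, z)
      = rootTerm h s p₁ p₂ u (stdRoot h s p₁) (stdRoot h s p₂) a b n := by
  have e : a.2 + a.1 + 1 = b.1 + b.2 + 1 := by omega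
  rw [termPP, cgPP_eq _ _ _ _ _ _ hb, cgPP_eq _ _ _ _ _ _ (ha.trans (add_comm _ _)), rootTerm, ← hb,
    Nat.add_sub_cancel, ← sqrtFact_sq hs n, ← sqrtFact_sq hs z, ← sqrtFall_sq hs,
    add_comm (2 * p₂), e, ← hb]
  nth_rw 3 [← hs (qnum h (2 * p₁ + 2 * p₂ - 2 * n + 1))]
  ring

theorem termPP_of_ne {p₁ p₂ u : ℂ} {a b : ℕ × ℕ} {x : ℕ × ℕ} (hx : x.2 + x.1 ≠ b.1 + b.2) :
    termPP h s p₁ p₂ u a b x = 0 := by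
  simp [termPP, cgPP, cgOn, if_neg hx]

theorem termPP_of_ne_left {p₁ p₂ u : ℂ} {a b : ℕ × ℕ} {x : ℕ × ℕ} (hx : x.2 + x.1 ≠ a.1 + a.2) :
    termPP h s p₁ p₂ u a b x = 0 := by
  have : ¬ x.2 + x.1 = a.2 + a.1 := by omega
  rw [termPP, cgPP, cgPP, cgOn, cgOn, if_neg this, mul_zero]

theorem support_termPP_subset (p₁ p₂ u : ℂ) (a b : ℕ × ℕ) :
    Function.support (termPP h s p₁ p₂ u a b) ⊆ antidiagonal (b.1 + b.2) := by
  intro x hx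
  by_contra hne
  refine hx (termPP_of_ne fun he => hne ?_)
  rw [mem_coe, HasAntidiagonal.mem_antidiagonal, ← he, add_comm]

include hs in
theorem RPP_eq_rootR (p₁ p₂ u : ℂ) (a b : ℕ × ℕ) : RPP h s p₁ p₂ u a b
    = rootR h s p₁ p₂ u (stdRoot h s p₁) (stdRoot h s p₂) a b := by
  rw [RPP, Matrix.of_apply, finsum_eq_sum_of_support_subset _ (support_termPP_subset p₁ p₂ u a b)]
  by_cases hab : a.1 + a.2 = b.1 + b.2
  · rw [rootR, if_pos hab, Nat.sum_antidiagonal_eq_sum_range_succ_mk]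
    refine sum_congr rfl fun n hn => ?_
    have := mem_range.1 hn
    exact termPP_eq hs p₁ p₂ u a b n _ (by omega) (by omega)
  · rw [rootR_of_ne hab]
    refine sum_eq_zero fun x hx => termPP_of_ne_left fun he => hab ?_
    rw [← he, ← HasAntidiagonal.mem_antidiagonal.1 hx, add_comm]

end

section

variable {h : ℂ} {s : ℂ → ℂ} {p₁ p₂ : ℂ} {σ₁ σ₂ : ℕ → ℂ}
  (hs : ∀ z, s z ^ 2 = z) (hσ₁ : ∀ k, σ₁ k ≠ 0) (hσ₂ : ∀ k, σ₂ k ≠ 0)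
  (h₁ : ∀ k, σ₁ k ^ 2 = qnum h (2 * p₁ - k)) (h₂ : ∀ k, σ₂ k ^ 2 = qnum h (2 * p₂ - k))

include hσ₁ hσ₂ h₁ h₂

/-- Multiplying a summand by the root products of lengths n and z_i completes its two radicals for
p_i to the same root product, whose square is a falling factorial. The values of ν outside the
interval contribute zero through `qrecip`. -/
theorem cgRoot_eq (n z₁ z₂ : ℕ) : cgRoot h p₁ p₂ σ₁ σ₂ n z₁ z₂ = cgFun h p₁ p₂ n z₁ z₂
    / ((rootProd σ₁ n * rootProd σ₂ n) * (rootProd σ₁ z₁ * rootProd σ₂ z₂)) := by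
  rw [cgRoot, cgFun, mul_div_assoc, sum_div, Nat.sum_antidiagonal_eq_sum_range_succ_mk]
  congr 1
  refine sum_subset_zero_on_sdiff (fun ν hν => ?_) (fun ν hν => ?_) fun ν hν => ?_
  · rw [mem_Icc] at hν
    rw [mem_range]
    omega
  · rw [mem_sdiff, mem_range, mem_Icc] at hν
    by_cases hz : ν ≤ z₁
    · rw [cgTerm, qrecip_of_lt (z := z₂) (ν := n - ν) (by omega)]
      simp
    · rw [cgTerm, qrecip_of_lt (z := z₁) (ν := ν) (by omega)]
      simp
  · rw [mem_Icc] at hν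
    have a1 := rootProd_mul_rootFall σ₁ n (z₁ - ν)
    have a2 := rootProd_mul_rootFall σ₁ z₁ (n - ν)
    have a3 := rootProd_mul_rootFall σ₂ n (z₂ + ν - n)
    have a4 := rootProd_mul_rootFall σ₂ z₂ ν
    rw [show n + (z₁ - ν) = z₁ + (n - ν) by omega] at a1
    rw [show n + (z₂ + ν - n) = z₂ + ν by omega] at a3
    have b1 := rootProd_ne_zero hσ₁ n
    have b2 := rootProd_ne_zero hσ₂ n
    have b3 := rootProd_ne_zero hσ₁ z₁
    have b4 := rootProd_ne_zero hσ₂ z₂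
    rw [cgTerm, ← rootProd_sq h₁, ← rootProd_sq h₂, qrecip, qrecip, if_pos (by omega),
      if_pos (by omega), show z₂ - (n - ν) = z₂ + ν - n by omega, eq_div_iff (by positivity)]
    simp only [sq]
    nth_rw 1 [← a1]
    nth_rw 1 [← a2]
    nth_rw 1 [← a3]
    nth_rw 1 [← a4]
    rw [div_eq_mul_inv, mul_inv, mul_inv, mul_inv]
    ring

/-- The vector `e_{b₁} ⊗ e_{b₂}`. -/
def basisFun (b : ℕ × ℕ) : ℕ → ℕ → ℂ := fun x y => if (x, y) = b then 1 else 0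

omit hσ₁ hσ₂ h₁ h₂ in
theorem form_basisFun (N : ℕ) (f : ℕ → ℕ → ℂ) (b : ℕ × ℕ) : form h p₁ p₂ N f (basisFun b)
    = if b.1 + b.2 = N then (qfact h b.1 / qfall h (2 * p₁) b.1)
      * (qfact h b.2 / qfall h (2 * p₂) b.2) * f b.1 b.2 else 0 := by
  simp only [form, basisFun, mul_ite, mul_one, mul_zero]
  rw [sum_ite_eq']
  simp only [HasAntidiagonal.mem_antidiagonal]

/-- The factors relating the basis used for `rOp` to the basis with given square roots. -/
def gauge (h : ℂ) (s : ℂ → ℂ) (σ₁ σ₂ : ℕ → ℂ) (a : ℕ × ℕ) : ℂ :=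
  (sqrtFact h s a.1 / rootProd σ₁ a.1) * (sqrtFact h s a.2 / rootProd σ₂ a.2)

include hs in
-- R with roots is the matrix of `rOp` conjugated by a diagonal matrix. All identities for `rOp` can
-- be transferred in this way as long as the roots are nonzero.
theorem rootR_eq (hq : ∀ n : ℕ, 0 < n → Complex.exp h ^ n ≠ 1) (u : ℂ) (a b : ℕ × ℕ) :
    rootR h s p₁ p₂ u σ₁ σ₂ a b
    = gauge h s σ₁ σ₂ a / gauge h s σ₁ σ₂ b * rOp h p₁ p₂ u (basisFun b) a.1 a.2 := by
  have hS (m : ℕ) : sqrtFact h s m ≠ 0 := fun h0 => qfact_ne_zero hq m (by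
    rw [← sqrtFact_sq hs, h0]; ring)
  simp only [rOp_apply, form_basisFun]
  by_cases hab : a.1 + a.2 = b.1 + b.2
  · rw [rootR, if_pos hab, mul_sum, hab]
    refine sum_congr rfl fun n hn => ?_
    have hN := mem_range.1 hn
    rw [rootTerm, if_pos rfl, cgRoot_eq hσ₁ hσ₂ h₁ h₂, cgRoot_eq hσ₂ hσ₁ h₂ h₁, cgNorm, gauge, gauge,
      show n + (b.1 + b.2 - n) + 1 = b.1 + b.2 + 1 by omega, ← rootProd_sq h₁, ← rootProd_sq h₂,
      ← rootProd_sq h₁, ← rootProd_sq h₂, ← sqrtFact_sq hs b.1, ← sqrtFact_sq hs b.2]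
    have b1 := rootProd_ne_zero hσ₁ n
    have b2 := rootProd_ne_zero hσ₂ n
    have b3 := rootProd_ne_zero hσ₁ b.1
    have b4 := rootProd_ne_zero hσ₂ b.2
    have b5 := rootProd_ne_zero hσ₁ a.1
    have b6 := rootProd_ne_zero hσ₂ a.2
    have c1 := hS b.1
    have c2 := hS b.2
    generalize qfall h (2 * p₁ + 2 * p₂ - n + 1) (b.1 + b.2 + 1) = d
    rw [div_eq_mul_inv _ d, div_eq_mul_inv _ (d * _), mul_inv d]
    generalize d⁻¹ = d'
    field_simp
  · rw [rootR_of_ne hab, sum_eq_zero fun n _ => by rw [if_neg fun h => hab h.symm]; ring, mul_zero]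

end

end

end ColoredVertex

namespace ColoredVertex

noncomputable section

open Finset

/-! ### Matrix elements -/

/-- Vectors are arbitrary functions, without finite support. The matrix expansion is still valid
because each value of the operator depends on only finitely many entries. -/
theorem eq_sum_basisFun (T : (ℕ → ℕ → ℂ) →ₗ[ℂ] (ℕ → ℕ → ℂ)) {a b M : ℕ}
    (hT : ∀ f g : ℕ → ℕ → ℂ, (∀ x y, x < M → y < M → f x y = g x y) → T f a b = T g a b)
    (f : ℕ → ℕ → ℂ) :
    T f a b = ∑ c ∈ range M ×ˢ range M, T (basisFun c) a b * f c.1 c.2 := by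
  rw [hT f (∑ c ∈ range M ×ˢ range M, f c.1 c.2 • basisFun c) fun x y hx hy => ?_]
  · rw [map_sum]
    simp only [map_smul, Finset.sum_apply, Pi.smul_apply, smul_eq_mul, mul_comm]
  · simp only [Finset.sum_apply, Pi.smul_apply, basisFun, smul_eq_mul, mul_ite, mul_one, mul_zero]
    rw [sum_ite_eq, if_pos (by simp [hx, hy])]

theorem rOp_eq_sum_basisFun (h p₁ p₂ u : ℂ) (f : ℕ → ℕ → ℂ) {a b M : ℕ} (hM : a + b < M) :
    rOp h p₁ p₂ u f a b
      = ∑ c ∈ range M ×ˢ range M, rOp h p₁ p₂ u (basisFun c) a b * f c.1 c.2 :=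
  eq_sum_basisFun _ (fun _ _ hfg => rOp_congr h p₁ p₂ u
    (fun x y hxy => hfg x y (by omega) (by omega)) a b rfl) f

theorem rOp_basisFun_of_ne (h p₁ p₂ u : ℂ) {a b : ℕ × ℕ} (hab : a.1 + a.2 ≠ b.1 + b.2) :
    rOp h p₁ p₂ u (basisFun b) a.1 a.2 = 0 := by
  rw [rOp_apply, sum_eq_zero fun n _ => ?_]
  rw [form_basisFun, if_neg hab.symm]
  ring

theorem raiseOp_eq_sum_basisFun (h p₁ p₂ ε r₁ r₂ : ℂ) (f : ℕ → ℕ → ℂ) {a b M : ℕ}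
    (hM : a + b + 1 < M) : raiseOp h p₁ p₂ ε r₁ r₂ f a b
      = ∑ c ∈ range M ×ˢ range M, raiseOp h p₁ p₂ ε r₁ r₂ (basisFun c) a b * f c.1 c.2 :=
  eq_sum_basisFun _ (fun _ _ hfg => raiseOp_congr h p₁ p₂ ε r₁ r₂
    (fun x y hxy => hfg x y (by omega) (by omega)) a b rfl) f

theorem lowerOp_eq_sum_basisFun (h p₁ p₂ ε r₁ r₂ : ℂ) (f : ℕ → ℕ → ℂ) {a b M : ℕ}
    (hM : a + b + 1 < M) : lowerOp h p₁ p₂ ε r₁ r₂ f a b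
      = ∑ c ∈ range M ×ˢ range M, lowerOp h p₁ p₂ ε r₁ r₂ (basisFun c) a b * f c.1 c.2 := by
  refine eq_sum_basisFun _ (fun f g hfg => ?_) f
  rw [lowerOp_apply, lowerOp_apply]
  congr 2
  · rcases a with _ | a
    · rfl
    · exact hfg _ _ (by omega) (by omega)
  · rcases b with _ | b
    · rfl
    · exact hfg _ _ (by omega) (by omega)

/-- The Yang-Baxter equation for the matrix elements of the R operators. -/
theorem rOp_yangBaxter {h : ℂ} (hq : ∀ n : ℕ, 0 < n → Complex.exp h ^ n ≠ 1)
    {p₁ p₂ p₃ u₁ u₂ u₃ : ℂ} (hp₁ : ∀ k : ℕ, qnum h (2 * p₁ - k) ≠ 0)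
    (hp₂ : ∀ k : ℕ, qnum h (2 * p₂ - k) ≠ 0) (hp₃ : ∀ k : ℕ, qnum h (2 * p₃ - k) ≠ 0)
    (hc₁₂ : CGGeneric h p₁ p₂) (hc₁₃ : CGGeneric h p₁ p₃) (hc₂₃ : CGGeneric h p₂ p₃)
    (hg₁₂ : GRegular h p₁ p₂ (u₁ - u₂)) (hg₁₃ : GRegular h p₁ p₃ (u₁ - u₃))
    (hg₂₃ : GRegular h p₂ p₃ (u₂ - u₃)) {a₁ a₂ a₃ b₁ b₂ b₃ M : ℕ}
    (hM : a₁ + a₂ + a₃ + b₁ + b₂ + b₃ < M) :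
    ∑ c ∈ range M ×ˢ range M ×ˢ range M,
        rOp h p₁ p₂ (u₁ - u₂) (basisFun (b₁, b₂)) c.1 c.2.1
          * rOp h p₁ p₃ (u₁ - u₃) (basisFun (c.1, b₃)) a₁ c.2.2
          * rOp h p₂ p₃ (u₂ - u₃) (basisFun (c.2.1, c.2.2)) a₂ a₃
      = ∑ c ∈ range M ×ˢ range M ×ˢ range M,
        rOp h p₁ p₂ (u₁ - u₂) (basisFun (c.1, c.2.1)) a₁ a₂
          * rOp h p₁ p₃ (u₁ - u₃) (basisFun (b₁, c.2.2)) c.1 a₃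
          * rOp h p₂ p₃ (u₂ - u₃) (basisFun (b₂, b₃)) c.2.1 c.2.2 := by
  -- The braid relation is applied to e_{b₁}⊗e_{b₂}⊗e_{b₃} and read at reversed indices, because the
  -- flips reverse the sites.
  have key := congrFun₃ (braidOp_yangBaxter hq hp₁ hp₂ hp₃ hc₁₂ hc₁₃ hc₂₃ hg₁₂ hg₁₃ hg₂₃
    (fun x y z => if x = b₁ ∧ y = b₂ ∧ z = b₃ then 1 else 0)) a₃ a₂ a₁
  have hz (p p' u : ℂ) {a a' b b' : ℕ} (hab : a + a' ≠ b + b') :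
      rOp h p p' u (basisFun (b, b')) a a' = 0 :=
    rOp_basisFun_of_ne h p p' u (a := (a, a')) (b := (b, b')) hab
  have hH (x z w : ℕ) : act12 (braidOp h p₁ p₂ (u₁ - u₂))
      (fun x y z => if x = b₁ ∧ y = b₂ ∧ z = b₃ then 1 else 0) x z w
      = if w = b₃ then rOp h p₁ p₂ (u₁ - u₂) (basisFun (b₁, b₂)) z x else 0 := by
    rw [act12, braidOp_apply]
    split_ifs with hw
    · have : (fun s t => if s = b₁ ∧ t = b₂ ∧ w = b₃ then (1 : ℂ) else 0) = basisFun (b₁, b₂) := by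
        ext s t
        simp [basisFun, hw]
      rw [this]
    · have : (fun s t => if s = b₁ ∧ t = b₂ ∧ w = b₃ then (1 : ℂ) else 0) = 0 := by
        ext s t
        simp [hw]
      rw [this, map_zero]
      rfl
  have hH' (z w y : ℕ) : act23 (braidOp h p₂ p₃ (u₂ - u₃))
      (fun x y z => if x = b₁ ∧ y = b₂ ∧ z = b₃ then 1 else 0) z w y
      = if z = b₁ then rOp h p₂ p₃ (u₂ - u₃) (basisFun (b₂, b₃)) y w else 0 := by
    rw [act23, braidOp_apply]
    split_ifs with hw
    · have : (fun s t => if z = b₁ ∧ s = b₂ ∧ t = b₃ then (1 : ℂ) else 0) = basisFun (b₂, b₃) := by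
        ext s t
        simp [basisFun, hw]
      rw [this]
    · have : (fun s t => if z = b₁ ∧ s = b₂ ∧ t = b₃ then (1 : ℂ) else 0) = 0 := by
        ext s t
        simp [hw]
      rw [this, map_zero]
      rfl
  have hL : act12 (braidOp h p₂ p₃ (u₂ - u₃)) (act23 (braidOp h p₁ p₃ (u₁ - u₃))
        (act12 (braidOp h p₁ p₂ (u₁ - u₂))
          (fun x y z => if x = b₁ ∧ y = b₂ ∧ z = b₃ then 1 else 0))) a₃ a₂ a₁
      = ∑ x ∈ range M, ∑ y ∈ range M, ∑ z ∈ range M,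
        rOp h p₁ p₂ (u₁ - u₂) (basisFun (b₁, b₂)) z x
          * rOp h p₁ p₃ (u₁ - u₃) (basisFun (z, b₃)) a₁ y
          * rOp h p₂ p₃ (u₂ - u₃) (basisFun (x, y)) a₂ a₃ := by
    rw [act12, braidOp_apply, rOp_eq_sum_basisFun h _ _ _ _ (show a₂ + a₃ < M by omega),
      sum_product]
    refine sum_congr rfl fun x _ => sum_congr rfl fun y _ => ?_
    by_cases hxy : a₂ + a₃ = x + y
    · rw [act23, braidOp_apply, rOp_eq_sum_basisFun h _ _ _ _ (show a₁ + y < M by omega),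
        sum_product, mul_sum]
      refine sum_congr rfl fun z _ => ?_
      simp only [hH, mul_ite, mul_zero]
      rw [sum_ite_eq', if_pos (mem_range.2 (by omega))]
      ring
    · rw [hz _ _ _ hxy]
      simp
  have hR : act23 (braidOp h p₁ p₂ (u₁ - u₂)) (act12 (braidOp h p₁ p₃ (u₁ - u₃))
        (act23 (braidOp h p₂ p₃ (u₂ - u₃))
          (fun x y z => if x = b₁ ∧ y = b₂ ∧ z = b₃ then 1 else 0))) a₃ a₂ a₁
      = ∑ x ∈ range M, ∑ y ∈ range M, ∑ w ∈ range M,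
        rOp h p₁ p₂ (u₁ - u₂) (basisFun (x, y)) a₁ a₂
          * rOp h p₁ p₃ (u₁ - u₃) (basisFun (b₁, w)) x a₃
          * rOp h p₂ p₃ (u₂ - u₃) (basisFun (b₂, b₃)) y w := by
    rw [act23, braidOp_apply, rOp_eq_sum_basisFun h _ _ _ _ (show a₁ + a₂ < M by omega),
      sum_product]
    refine sum_congr rfl fun x _ => sum_congr rfl fun y _ => ?_
    by_cases hxy : a₁ + a₂ = x + y
    · rw [act12, braidOp_apply, rOp_eq_sum_basisFun h _ _ _ _ (show x + a₃ < M by omega),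
        sum_product_right, mul_sum]
      refine sum_congr rfl fun w _ => ?_
      simp only [hH', mul_ite, mul_zero]
      rw [sum_ite_eq', if_pos (mem_range.2 (by omega))]
      ring
    · rw [hz _ _ _ hxy]
      simp
  rw [hL, hR] at key
  simp only [sum_product]
  rw [← key, sum_comm]
  refine sum_congr rfl fun x _ => sum_comm

/-- The color representation for given square roots `σ k` of `[2p - k]_q`. -/
def rootRep (h : ℂ) (s : ℂ → ℂ) (p : ℂ) (σ : ℕ → ℂ) : RepMatrices ℕ where
  Xp := Matrix.of fun a b => if a + 1 = b then σ a * s (qnum h ((a : ℂ) + 1)) else 0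
  Xm := Matrix.of fun a b => if a = b + 1 then σ b * s (qnum h ((b : ℂ) + 1)) else 0
  K t := Matrix.diagonal fun a => qpow h (t * (2 * p - 2 * a))

theorem colorRep_eq (h : ℂ) (s : ℂ → ℂ) (p : ℂ) :
    colorRep h s p = rootRep h s p (stdRoot h s p) := by
  rw [colorRep, rootRep]
  congr 1
  ext a b
  simp only [Matrix.of_apply]
  split_ifs with hab
  · rw [hab, stdRoot, Nat.cast_add, Nat.cast_one, sub_add_eq_sub_sub, sub_add_cancel]
  · rfl

section

variable {h : ℂ} {s : ℂ → ℂ} {p₁ p₂ : ℂ} {σ₁ σ₂ : ℕ → ℂ}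
  (hq : ∀ n : ℕ, 0 < n → Complex.exp h ^ n ≠ 1)
  (hs : ∀ z, s z ^ 2 = z) (hσ₁ : ∀ k, σ₁ k ≠ 0) (hσ₂ : ∀ k, σ₂ k ≠ 0)
  (h₁ : ∀ k, σ₁ k ^ 2 = qnum h (2 * p₁ - k)) (h₂ : ∀ k, σ₂ k ^ 2 = qnum h (2 * p₂ - k))

include hq hs in
theorem root_qnum_ne_zero (n : ℕ) : s (qnum h ((n : ℂ) + 1)) ≠ 0 := fun h0 =>
  qnum_natCast_add_one_ne_zero hq n (by rw [← hs (qnum h ((n : ℂ) + 1)), h0]; ring)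

include hq hs in
theorem sqrtFact_ne_zero (n : ℕ) : sqrtFact h s n ≠ 0 :=
  prod_ne_zero_iff.2 fun k _ => root_qnum_ne_zero hq hs k

theorem sqrtFact_succ (n : ℕ) :
    sqrtFact h s (n + 1) = sqrtFact h s n * s (qnum h ((n : ℂ) + 1)) := prod_range_succ _ _

theorem rootProd_succ (σ : ℕ → ℂ) (n : ℕ) : rootProd σ (n + 1) = rootProd σ n * σ n :=
  prod_range_succ _ _

include hq hs hσ₁ hσ₂

theorem gauge_ne_zero (a : ℕ × ℕ) : gauge h s σ₁ σ₂ a ≠ 0 :=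
  mul_ne_zero (div_ne_zero (sqrtFact_ne_zero hq hs _) (rootProd_ne_zero hσ₁ _))
    (div_ne_zero (sqrtFact_ne_zero hq hs _) (rootProd_ne_zero hσ₂ _))

/-- Between e_{k+1} and e_k the gauge factors have ratio σ_k/√[k+1], which turns the coefficient
[k+1] of X⁺ into σ_k√[k+1]. -/
theorem raise_matrix_eq (r t t' : ℂ) (ht : t' = -t) (c b : ℕ × ℕ) :
    (r • ((rootRep h s p₁ σ₁).Xp ⊗ₖ (rootRep h s p₂ σ₂).K t)
      + (rootRep h s p₁ σ₁).K t' ⊗ₖ (rootRep h s p₂ σ₂).Xp) c b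
      = gauge h s σ₁ σ₂ c / gauge h s σ₁ σ₂ b
        * raiseOp h p₁ p₂ (2 * t) r 1 (basisFun b) c.1 c.2 := by
  obtain ⟨c₁, c₂⟩ := c
  obtain ⟨b₁, b₂⟩ := b
  have d1 := sqrtFact_ne_zero hq hs
  have d2 := rootProd_ne_zero hσ₁
  have d3 := rootProd_ne_zero hσ₂
  have d4 := root_qnum_ne_zero hq hs
  simp only [Matrix.add_apply, Matrix.smul_apply, Matrix.kroneckerMap_apply,
    rootRep, Matrix.of_apply, Matrix.diagonal_apply, raiseOp_apply, basisFun, Prod.mk.injEq,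
    smul_eq_mul, mul_add]
  congr 1
  · by_cases e1 : c₁ + 1 = b₁
    · by_cases e2 : c₂ = b₂
      · subst e1 e2
        have := d1 c₁
        have := d1 c₂
        have := d2 c₁
        have := d3 c₂
        have := d4 c₁
        have := hσ₁ c₁
        rw [if_pos rfl, if_pos rfl, if_pos ⟨rfl, rfl⟩, gauge, gauge, sqrtFact_succ, rootProd_succ,
          show t * (2 * p₂ - 2 * c₂) = 2 * t * (p₂ - c₂) by ring]
        field_simp
        rw [hs]
        ring
      · simp [e2]
    · simp [e1]
  · by_cases e1 : c₁ = b₁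
    · by_cases e2 : c₂ + 1 = b₂
      · subst e1 e2
        have := d1 c₁
        have := d1 c₂
        have := d2 c₁
        have := d3 c₂
        have := d4 c₂
        have := hσ₂ c₂
        rw [if_pos rfl, if_pos rfl, if_pos ⟨rfl, rfl⟩, gauge, gauge, sqrtFact_succ, rootProd_succ,
          ht, show -t * (2 * p₁ - 2 * c₁) = -(2 * t) * (p₁ - c₁) by ring]
        field_simp
        rw [hs]
      · simp [e2]
    · simp [e1]

include h₁ h₂

theorem lower_matrix_eq (r t t' : ℂ) (ht : t' = -t) (c b : ℕ × ℕ) :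
    (r • ((rootRep h s p₁ σ₁).Xm ⊗ₖ (rootRep h s p₂ σ₂).K t)
      + (rootRep h s p₁ σ₁).K t' ⊗ₖ (rootRep h s p₂ σ₂).Xm) c b
      = gauge h s σ₁ σ₂ c / gauge h s σ₁ σ₂ b
        * lowerOp h p₁ p₂ (2 * t) r 1 (basisFun b) c.1 c.2 := by
  obtain ⟨c₁, c₂⟩ := c
  obtain ⟨b₁, b₂⟩ := b
  have d1 := sqrtFact_ne_zero hq hs
  have d2 := rootProd_ne_zero hσ₁
  have d3 := rootProd_ne_zero hσ₂
  have d4 := root_qnum_ne_zero hq hs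
  simp only [Matrix.add_apply, Matrix.smul_apply, Matrix.kroneckerMap_apply,
    rootRep, Matrix.of_apply, Matrix.diagonal_apply, lowerOp_apply,
    smul_eq_mul, mul_add]
  congr 1
  · rcases c₁ with _ | c₁
    · simp
    by_cases e1 : c₁ = b₁
    · by_cases e2 : c₂ = b₂
      · subst e1 e2
        have := d1 c₁
        have := d1 c₂
        have := d2 c₁
        have := d3 c₂
        have := d4 c₁
        have := hσ₁ c₁
        rw [if_pos rfl, if_pos rfl, prev_succ, basisFun, if_pos rfl, gauge, gauge, sqrtFact_succ,
          rootProd_succ, Nat.cast_add, Nat.cast_one, sub_add_eq_sub_sub, sub_add_cancel, ← h₁,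
          show t * (2 * p₂ - 2 * c₂) = 2 * t * (p₂ - c₂) by ring]
        field_simp
      · simp [e2, basisFun]
    · simp [e1, basisFun]
  · rcases c₂ with _ | c₂
    · simp
    by_cases e1 : c₁ = b₁
    · by_cases e2 : c₂ = b₂
      · subst e1 e2
        have := d1 c₁
        have := d1 c₂
        have := d2 c₁
        have := d3 c₂
        have := d4 c₂
        have := hσ₂ c₂
        rw [if_pos rfl, if_pos rfl, prev_succ, basisFun, if_pos rfl, gauge, gauge, sqrtFact_succ,
          rootProd_succ, Nat.cast_add, Nat.cast_one, sub_add_eq_sub_sub, sub_add_cancel, ← h₂, ht,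
          show -t * (2 * p₁ - 2 * c₁) = -(2 * t) * (p₁ - c₁) by ring]
        field_simp
      · simp [e2, basisFun]
    · simp [e1, basisFun]

/-- The gauge factors at the summation index cancel in a product of two conjugated matrices, leaving
a common factor on both sides. -/
theorem rootR_intertwines {u : ℂ} {T T' : (ℕ → ℕ → ℂ) →ₗ[ℂ] (ℕ → ℕ → ℂ)}
    (hTT' : ∀ f, rOp h p₁ p₂ u (T f) = T' (rOp h p₁ p₂ u f)) {a b : ℕ × ℕ} {M : ℕ}
    (hM : a.1 + a.2 < M) (hT' : ∀ f, T' f a.1 a.2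
      = ∑ c ∈ range M ×ˢ range M, T' (basisFun c) a.1 a.2 * f c.1 c.2)
    {A B : Matrix (ℕ × ℕ) (ℕ × ℕ) ℂ}
    (hA : ∀ c b, A c b = gauge h s σ₁ σ₂ c / gauge h s σ₁ σ₂ b * T (basisFun b) c.1 c.2)
    (hB : ∀ c b, B c b = gauge h s σ₁ σ₂ c / gauge h s σ₁ σ₂ b * T' (basisFun b) c.1 c.2) :
    ∑ c ∈ range M ×ˢ range M, rootR h s p₁ p₂ u σ₁ σ₂ a c * A c b
      = ∑ c ∈ range M ×ˢ range M, B a c * rootR h s p₁ p₂ u σ₁ σ₂ c b := by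
  have hG := gauge_ne_zero (h := h) (s := s) hq hs hσ₁ hσ₂
  have e := congrFun₂ (hTT' (basisFun b)) a.1 a.2
  rw [rOp_eq_sum_basisFun h p₁ p₂ u _ hM, hT'] at e
  replace e := congrArg (gauge h s σ₁ σ₂ a / gauge h s σ₁ σ₂ b * ·) e
  simp only [mul_sum] at e
  convert e using 2 with c hc c hc
  · rw [rootR_eq hs hσ₁ hσ₂ h₁ h₂ hq, hA]
    have := hG c
    field_simp
  · rw [rootR_eq hs hσ₁ hσ₂ h₁ h₂ hq, hB]
    have := hG c
    field_simp

end

end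

end ColoredVertex

namespace ColoredVertex

noncomputable section

open Finset Filter Topology

/-! ### Generic parameters -/

theorem continuous_qpow (h : ℂ) : Continuous (qpow h) := by
  unfold qpow
  fun_prop

theorem continuous_qnum (h : ℂ) : Continuous (qnum h) :=
  ((continuous_qpow h).sub ((continuous_qpow h).comp continuous_neg)).div_const _

/-- Of the two roots the one closer to w is taken; then |r-w|² ≤ |r-w||r+w| = |g-w²|. This also
works at w = 0, where no continuous branch is available in general. -/
theorem exists_sqrt_tendsto {g : ℂ → ℂ} {w : ℂ} (hg : Tendsto g (𝓝 0) (𝓝 (w ^ 2))) :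
    ∃ f : ℂ → ℂ, (∀ ε, f ε ^ 2 = g ε) ∧ Tendsto f (𝓝 0) (𝓝 w) := by
  have hroot (ε : ℂ) : ∃ r : ℂ, r ^ 2 = g ε ∧ ‖r - w‖ ≤ ‖r + w‖ := by
    obtain ⟨r, hr⟩ := IsAlgClosed.exists_pow_nat_eq (g ε) two_pos
    rcases le_total ‖r - w‖ ‖r + w‖ with hle | hle
    · exact ⟨r, hr, hle⟩
    · refine ⟨-r, by rw [neg_sq, hr], ?_⟩
      rwa [← neg_add', norm_neg, neg_add_eq_sub, norm_sub_rev w r]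
  choose f hf hle using hroot
  refine ⟨f, hf, tendsto_iff_norm_sub_tendsto_zero.2 ?_⟩
  have h1 : Tendsto (fun ε => ‖g ε - w ^ 2‖) (𝓝 0) (𝓝 0) := tendsto_iff_norm_sub_tendsto_zero.1 hg
  have h2 : Tendsto (fun ε => √‖g ε - w ^ 2‖) (𝓝 0) (𝓝 0) := by
    simpa [Function.comp_def] using (Real.continuous_sqrt.tendsto 0).comp h1
  refine squeeze_zero (fun _ => norm_nonneg _) (fun ε => Real.le_sqrt_of_sq_le ?_) h2
  rw [← hf, sq_sub_sq, norm_mul, sq, mul_comm]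
  exact mul_le_mul_of_nonneg_right (hle ε) (norm_nonneg _)

theorem exists_stdRoot_tendsto (h : ℂ) {s : ℂ → ℂ} (hs : ∀ z, s z ^ 2 = z) (p : ℂ) :
    ∃ σ : ℂ → ℕ → ℂ, (∀ ε k, σ ε k ^ 2 = qnum h (2 * (p + ε) - k)) ∧
      ∀ k, Tendsto (fun ε => σ ε k) (𝓝 0) (𝓝 (stdRoot h s p k)) := by
  have hex (k : ℕ) := exists_sqrt_tendsto (g := fun ε => qnum h (2 * (p + ε) - k))
    (w := stdRoot h s p k) (by
      rw [stdRoot, hs]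
      have : Continuous fun ε => qnum h (2 * (p + ε) - k) :=
        (continuous_qnum h).comp (by fun_prop)
      simpa using this.tendsto 0)
  choose f hf hf' using hex
  exact ⟨fun ε k => f k ε, fun ε k => hf k ε, hf'⟩

/-- Complements of countable sets are dense in ℂ, so ε can tend to 0 while avoiding countably many
exceptional values. -/
instance : (𝓝 (0 : ℂ) ⊓ cocountable).NeBot := by
  rw [inf_neBot_iff]
  intro U hU V hV
  have h1 : Vᶜ.Countable := mem_cocountable.1 hV
  have h2 := h1.dense_compl ℝ
  rw [compl_compl] at h2
  exact (mem_closure_iff_nhds.1 (h2 0)) U hU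

section

variable {h : ℂ} (hq : ∀ n : ℕ, 0 < n → Complex.exp h ^ n ≠ 1)

include hq

theorem countable_qnum_eq_zero : {z | qnum h z = 0}.Countable := by
  have hh : h ≠ 0 := by
    rintro rfl
    simpa using hq 1 one_pos
  refine (Set.countable_range fun n : ℤ => (n * Real.pi * Complex.I) / h).mono ?_
  intro z hz
  rw [Set.mem_ofPred_eq, qnum_eq_zero_iff hq, qpow, Complex.exp_eq_one_iff] at hz
  obtain ⟨n, hn⟩ := hz
  refine ⟨n, ?_⟩
  simp only
  field_simp
  linear_combination (-1 / 2 : ℂ) * hn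

theorem eventually_qnum_ne_zero {c : ℂ} (hc : c ≠ 0) (t : ℂ) :
    ∀ᶠ ε in 𝓝 (0 : ℂ) ⊓ cocountable, ∀ k : ℕ, qnum h (c * ε + t - k) ≠ 0 := by
  refine Eventually.filter_mono inf_le_right ?_
  rw [Filter.Eventually, mem_cocountable]
  have : {ε : ℂ | ∀ k : ℕ, qnum h (c * ε + t - k) ≠ 0}ᶜ
      = ⋃ k : ℕ, (fun ε => c * ε + t - k) ⁻¹' {z | qnum h z = 0} := by
    ext ε
    simp
  rw [this]
  refine Set.countable_iUnion fun k => (countable_qnum_eq_zero hq).preimage ?_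
  intro x y hxy
  simp only at hxy
  exact mul_left_cancel₀ hc (by linear_combination hxy)

theorem eventually_ne_zero (p : ℂ) :
    ∀ᶠ ε in 𝓝 (0 : ℂ) ⊓ cocountable, ∀ k : ℕ, qnum h (2 * (p + ε) - k) ≠ 0 := by
  filter_upwards [eventually_qnum_ne_zero hq two_ne_zero (2 * p)] with ε hε k
  rw [show 2 * (p + ε) - k = 2 * ε + 2 * p - k by ring]
  exact hε k

theorem eventually_CGGeneric (p₁ p₂ : ℂ) :
    ∀ᶠ ε in 𝓝 (0 : ℂ) ⊓ cocountable, CGGeneric h (p₁ + ε) (p₂ + ε) := by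
  filter_upwards [eventually_qnum_ne_zero hq (c := 4) (by norm_num) (2 * p₁ + 2 * p₂ + 2)] with ε hε k
  rw [show 2 * (p₁ + ε) + 2 * (p₂ + ε) + 2 - k = 4 * ε + (2 * p₁ + 2 * p₂ + 2) - k by ring]
  exact hε k

theorem eventually_GRegular (p₁ p₂ u : ℂ) :
    ∀ᶠ ε in 𝓝 (0 : ℂ) ⊓ cocountable, GRegular h (p₁ + ε) (p₂ + ε) u := by
  filter_upwards [eventually_qnum_ne_zero hq two_ne_zero (u + p₁ + p₂)] with ε hε k
  rw [show u + (p₁ + ε) + (p₂ + ε) - k = 2 * ε + (u + p₁ + p₂) - k by ring]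
  exact hε k

end

/-! ### Continuity -/

section

variable {h : ℂ} {s : ℂ → ℂ} {p₁ p₂ u : ℂ} {σ₁ σ₂ : ℕ → ℂ} {ι : Type*} {l : Filter ι}
  {P₁ P₂ U : ι → ℂ} {S₁ S₂ : ι → ℕ → ℂ}
  (hP₁ : Tendsto P₁ l (𝓝 p₁)) (hP₂ : Tendsto P₂ l (𝓝 p₂)) (hU : Tendsto U l (𝓝 u))
  (hS₁ : ∀ k, Tendsto (fun i => S₁ i k) l (𝓝 (σ₁ k)))
  (hS₂ : ∀ k, Tendsto (fun i => S₂ i k) l (𝓝 (σ₂ k)))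

theorem tendsto_qpow {f : ι → ℂ} {z : ℂ} (hf : Tendsto f l (𝓝 z)) :
    Tendsto (fun i => qpow h (f i)) l (𝓝 (qpow h z)) := ((continuous_qpow h).tendsto z).comp hf

theorem tendsto_qnum {f : ι → ℂ} {z : ℂ} (hf : Tendsto f l (𝓝 z)) :
    Tendsto (fun i => qnum h (f i)) l (𝓝 (qnum h z)) := ((continuous_qnum h).tendsto z).comp hf

theorem tendsto_rootFall {σ : ℕ → ℂ} {S : ι → ℕ → ℂ}
    (hS : ∀ k, Tendsto (fun i => S i k) l (𝓝 (σ k))) (k m : ℕ) :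
    Tendsto (fun i => rootFall (S i) k m) l (𝓝 (rootFall σ k m)) :=
  tendsto_finsetProd _ fun _ _ => hS _

include hP₁ hP₂

theorem tendsto_gfun (hU : Tendsto U l (𝓝 u)) {n : ℕ}
    (hg : ∀ k < n, qnum h (u + p₁ + p₂ - k) ≠ 0) :
    Tendsto (fun i => gfun h (P₁ i) (P₂ i) n (U i)) l (𝓝 (gfun h p₁ p₂ n u)) :=
  (tendsto_finsetProd _ fun k hk => (tendsto_qnum (((hU.sub hP₁).sub hP₂).add_const _)).div
    (tendsto_qnum (((hU.add hP₁).add hP₂).sub_const _)) (hg k (mem_range.1 hk))).const_mul _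

include hS₁ hS₂ in
theorem tendsto_cgRoot (n z₁ z₂ : ℕ) :
    Tendsto (fun i => cgRoot h (P₁ i) (P₂ i) (S₁ i) (S₂ i) n z₁ z₂) l
      (𝓝 (cgRoot h p₁ p₂ σ₁ σ₂ n z₁ z₂)) := by
  refine Tendsto.mul (tendsto_qpow (((hP₁.const_mul _).const_add _).add (hP₂.const_mul _)))
    (tendsto_finsetSum _ fun ν _ => Tendsto.mul ((Tendsto.const_mul _ ?_).div_const _) ?_)
  · exact tendsto_qpow
      ((((hP₁.const_mul 2).add (hP₂.const_mul 2)).sub_const _).add_const 1 |>.const_mul _)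
  · exact (((tendsto_rootFall hS₁ _ _).mul (tendsto_rootFall hS₁ _ _)).mul
      (tendsto_rootFall hS₂ _ _)).mul (tendsto_rootFall hS₂ _ _)

include hS₁ hS₂ in
-- The stated regularity at the limit point suffices for continuity. The stronger genericity and the
-- non-vanishing of [2p_i-k] are needed only along the approach.
theorem tendsto_rootR (hU : Tendsto U l (𝓝 u)) (hc : CGRegular h p₁ p₂) (hg : GRegular h p₁ p₂ u)
    (a b : ℕ × ℕ) :
    Tendsto (fun i => rootR h s (P₁ i) (P₂ i) (U i) (S₁ i) (S₂ i) a b) l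
      (𝓝 (rootR h s p₁ p₂ u σ₁ σ₂ a b)) := by
  have hP := (hP₁.const_mul 2).add (hP₂.const_mul 2)
  by_cases hab : a.1 + a.2 = b.1 + b.2
  · simp only [rootR, if_pos hab]
    refine tendsto_finsetSum _ fun n hn => Tendsto.mul (Tendsto.mul
      (tendsto_gfun hP₁ hP₂ hU fun k _ => hg k) (Tendsto.div (Tendsto.mul_const _ ?_)
        (tendsto_finsetProd _ fun k _ => ?_) ?_))
      (Tendsto.mul ((tendsto_cgRoot hP₁ hP₂ hS₁ hS₂ _ _ _).const_mul _)
      ((tendsto_cgRoot hP₂ hP₁ hS₂ hS₁ _ _ _).const_mul _))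
    · exact tendsto_qnum ((hP.sub_const _).add_const 1)
    · exact tendsto_qnum (((hP.sub_const _).add_const 1).sub_const _)
    · refine qfall_ne_zero fun k _ => ?_
      have := hc (n + k)
      rwa [show 2 * p₁ + 2 * p₂ - n + 1 - k = 2 * p₁ + 2 * p₂ + 1 - (n + k : ℕ) by push_cast; ring]
  · simp only [rootR_of_ne hab]
    exact tendsto_const_nhds

omit hP₁ hP₂

theorem tendsto_rootRep_Xp {p σ} {P : ι → ℂ} {S : ι → ℕ → ℂ}
    (hS : ∀ k, Tendsto (fun i => S i k) l (𝓝 (σ k))) (a b : ℕ) :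
    Tendsto (fun i => (rootRep h s (P i) (S i)).Xp a b) l (𝓝 ((rootRep h s p σ).Xp a b)) := by
  simp only [rootRep, Matrix.of_apply]
  split_ifs
  · exact (hS a).mul_const _
  · exact tendsto_const_nhds

theorem tendsto_rootRep_Xm {p σ} {P : ι → ℂ} {S : ι → ℕ → ℂ}
    (hS : ∀ k, Tendsto (fun i => S i k) l (𝓝 (σ k))) (a b : ℕ) :
    Tendsto (fun i => (rootRep h s (P i) (S i)).Xm a b) l (𝓝 ((rootRep h s p σ).Xm a b)) := by
  simp only [rootRep, Matrix.of_apply]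
  split_ifs
  · exact (hS b).mul_const _
  · exact tendsto_const_nhds

theorem tendsto_rootRep_K {p σ} {P : ι → ℂ} {S : ι → ℕ → ℂ} (hP : Tendsto P l (𝓝 p)) (t : ℂ)
    (a b : ℕ) :
    Tendsto (fun i => (rootRep h s (P i) (S i)).K t a b) l (𝓝 ((rootRep h s p σ).K t a b)) := by
  simp only [rootRep, Matrix.diagonal_apply]
  split_ifs
  · exact tendsto_qpow (((hP.const_mul 2).sub_const _).const_mul _)
  · exact tendsto_const_nhds

end

/-! ### The equations for the R matrices of two color representations -/

section

variable {h : ℂ} (hq : ∀ n : ℕ, 0 < n → Complex.exp h ^ n ≠ 1) {s : ℂ → ℂ}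
  (hs : ∀ z : ℂ, s z ^ 2 = z)

theorem ne_zero_of_sq_eq {p : ℂ} {σ : ℕ → ℂ} (hσ : ∀ k, σ k ^ 2 = qnum h (2 * p - k))
    (hp : ∀ k : ℕ, qnum h (2 * p - k) ≠ 0) (k : ℕ) : σ k ≠ 0 := fun h0 => hp k (by
  rw [← hσ, h0]; ring)

theorem gauge_yangBaxter_left {c₁ c₂ c₃ : ℂ} (h₁ : c₁ ≠ 0) (h₂ : c₂ ≠ 0) (h₃ : c₃ ≠ 0)
    (a₁ a₂ a₃ b₁ b₂ b₃ x y z : ℂ) :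
    c₁ * c₂ / (b₁ * b₂) * x * (a₁ * c₃ / (c₁ * b₃) * y) * (a₂ * a₃ / (c₂ * c₃) * z)
      = a₁ * a₂ * a₃ / (b₁ * b₂ * b₃) * (x * y * z) := by
  simp only [div_eq_mul_inv, mul_inv]
  field_simp

theorem gauge_yangBaxter_right {c₁ c₂ c₃ : ℂ} (h₁ : c₁ ≠ 0) (h₂ : c₂ ≠ 0) (h₃ : c₃ ≠ 0)
    (a₁ a₂ a₃ b₁ b₂ b₃ x y z : ℂ) :
    a₁ * a₂ / (c₁ * c₂) * x * (c₁ * a₃ / (b₁ * c₃) * y) * (c₂ * c₃ / (b₂ * b₃) * z)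
      = a₁ * a₂ * a₃ / (b₁ * b₂ * b₃) * (x * y * z) := by
  simp only [div_eq_mul_inv, mul_inv]
  field_simp

theorem tendsto_add_zero (p : ℂ) : Tendsto (fun ε => p + ε) (𝓝 0 ⊓ cocountable) (𝓝 p) := by
  have : Continuous fun ε => p + ε := by fun_prop
  simpa using (this.tendsto 0).mono_left (inf_le_left (b := cocountable))

include hq hs

theorem rootR_yangBaxter_sum {p₁ p₂ p₃ u v : ℂ} {σ₁ σ₂ σ₃ : ℕ → ℂ}
    (z₁ : ∀ k, σ₁ k ≠ 0) (z₂ : ∀ k, σ₂ k ≠ 0) (z₃ : ∀ k, σ₃ k ≠ 0)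
    (h₁ : ∀ k, σ₁ k ^ 2 = qnum h (2 * p₁ - k)) (h₂ : ∀ k, σ₂ k ^ 2 = qnum h (2 * p₂ - k))
    (h₃ : ∀ k, σ₃ k ^ 2 = qnum h (2 * p₃ - k))
    (hc₁₂ : CGGeneric h p₁ p₂) (hc₁₃ : CGGeneric h p₁ p₃) (hc₂₃ : CGGeneric h p₂ p₃)
    (hg₁₂ : GRegular h p₁ p₂ u) (hg₁₃ : GRegular h p₁ p₃ (u + v))
    (hg₂₃ : GRegular h p₂ p₃ v) {a₁ a₂ a₃ b₁ b₂ b₃ M : ℕ}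
    (hM : a₁ + a₂ + a₃ + b₁ + b₂ + b₃ < M) :
    ∑ c ∈ range M ×ˢ range M ×ˢ range M, rootR h s p₁ p₂ u σ₁ σ₂ (c.1, c.2.1) (b₁, b₂)
        * rootR h s p₁ p₃ (u + v) σ₁ σ₃ (a₁, c.2.2) (c.1, b₃)
        * rootR h s p₂ p₃ v σ₂ σ₃ (a₂, a₃) (c.2.1, c.2.2)
      = ∑ c ∈ range M ×ˢ range M ×ˢ range M, rootR h s p₁ p₂ u σ₁ σ₂ (a₁, a₂) (c.1, c.2.1)
        * rootR h s p₁ p₃ (u + v) σ₁ σ₃ (c.1, a₃) (b₁, c.2.2)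
        * rootR h s p₂ p₃ v σ₂ σ₃ (c.2.1, c.2.2) (b₂, b₃) := by
  have key := rOp_yangBaxter hq (fun k => h₁ k ▸ pow_ne_zero 2 (z₁ k))
    (fun k => h₂ k ▸ pow_ne_zero 2 (z₂ k)) (fun k => h₃ k ▸ pow_ne_zero 2 (z₃ k))
    -- Only differences of the site parameters enter, and this choice realises u, u+v and v.
    hc₁₂ hc₁₃ hc₂₃ (u₁ := u + v) (u₂ := v) (u₃ := 0)
    (by rwa [add_sub_cancel_right]) (by rwa [sub_zero]) (by rwa [sub_zero]) hM
  rw [add_sub_cancel_right, sub_zero, sub_zero] at key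
  simp only [rootR_eq hs z₁ z₂ h₁ h₂ hq, rootR_eq hs z₁ z₃ h₁ h₃ hq, rootR_eq hs z₂ z₃ h₂ h₃ hq,
    gauge]
  have d := sqrtFact_ne_zero hq hs
  have e₁ (k : ℕ) := div_ne_zero (d k) (rootProd_ne_zero z₁ k)
  have e₂ (k : ℕ) := div_ne_zero (d k) (rootProd_ne_zero z₂ k)
  have e₃ (k : ℕ) := div_ne_zero (d k) (rootProd_ne_zero z₃ k)
  refine (sum_congr rfl fun c _ => gauge_yangBaxter_left (e₁ c.1) (e₂ c.2.1) (e₃ c.2.2) ..).trans ?_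
  refine Eq.trans ?_
    (sum_congr rfl fun c _ => gauge_yangBaxter_right (e₁ c.1) (e₂ c.2.1) (e₃ c.2.2) ..).symm
  rw [← mul_sum, ← mul_sum, key]

/-- All three parameters are shifted by the same ε; the sums 2(p_i+p_j) still move, by 4ε, so every
genericity condition fails for only countably many ε. The two sides agree for the remaining ε and
have unique limits. -/
theorem RPP_yangBaxter_sum {p₁ p₂ p₃ u v : ℂ} (hc₁₂ : CGRegular h p₁ p₂) (hc₁₃ : CGRegular h p₁ p₃)
    (hc₂₃ : CGRegular h p₂ p₃) (hg₁₂ : GRegular h p₁ p₂ u) (hg₁₃ : GRegular h p₁ p₃ (u + v))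
    (hg₂₃ : GRegular h p₂ p₃ v) {a₁ a₂ a₃ b₁ b₂ b₃ M : ℕ}
    (hM : a₁ + a₂ + a₃ + b₁ + b₂ + b₃ < M) :
    ∑ c ∈ range M ×ˢ range M ×ˢ range M, RPP h s p₁ p₂ u (c.1, c.2.1) (b₁, b₂)
        * RPP h s p₁ p₃ (u + v) (a₁, c.2.2) (c.1, b₃) * RPP h s p₂ p₃ v (a₂, a₃) (c.2.1, c.2.2)
      = ∑ c ∈ range M ×ˢ range M ×ˢ range M, RPP h s p₁ p₂ u (a₁, a₂) (c.1, c.2.1)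
        * RPP h s p₁ p₃ (u + v) (c.1, a₃) (b₁, c.2.2)
        * RPP h s p₂ p₃ v (c.2.1, c.2.2) (b₂, b₃) := by
  obtain ⟨σ₁, hσ₁, hl₁⟩ := exists_stdRoot_tendsto h hs p₁
  obtain ⟨σ₂, hσ₂, hl₂⟩ := exists_stdRoot_tendsto h hs p₂
  obtain ⟨σ₃, hσ₃, hl₃⟩ := exists_stdRoot_tendsto h hs p₃
  replace hl₁ := fun k => (hl₁ k).mono_left (inf_le_left (b := cocountable))
  replace hl₂ := fun k => (hl₂ k).mono_left (inf_le_left (b := cocountable))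
  replace hl₃ := fun k => (hl₃ k).mono_left (inf_le_left (b := cocountable))
  have ht₁ := tendsto_add_zero p₁
  have ht₂ := tendsto_add_zero p₂
  have ht₃ := tendsto_add_zero p₃
  simp only [RPP_eq_rootR hs]
  have T₁₂ := tendsto_rootR (s := s) ht₁ ht₂ hl₁ hl₂ tendsto_const_nhds hc₁₂ hg₁₂
  have T₁₃ := tendsto_rootR (s := s) ht₁ ht₃ hl₁ hl₃ tendsto_const_nhds hc₁₃ hg₁₃
  have T₂₃ := tendsto_rootR (s := s) ht₂ ht₃ hl₂ hl₃ tendsto_const_nhds hc₂₃ hg₂₃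
  refine tendsto_nhds_unique_of_eventuallyEq
    (tendsto_finsetSum _ fun c _ => ((T₁₂ _ _).mul (T₁₃ _ _)).mul (T₂₃ _ _))
    (tendsto_finsetSum _ fun c _ => ((T₁₂ _ _).mul (T₁₃ _ _)).mul (T₂₃ _ _)) ?_
  filter_upwards [eventually_ne_zero hq p₁, eventually_ne_zero hq p₂, eventually_ne_zero hq p₃,
    eventually_CGGeneric hq p₁ p₂, eventually_CGGeneric hq p₁ p₃, eventually_CGGeneric hq p₂ p₃,
    eventually_GRegular hq p₁ p₂ u, eventually_GRegular hq p₁ p₃ (u + v),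
    eventually_GRegular hq p₂ p₃ v] with ε n₁ n₂ n₃ c₁₂ c₁₃ c₂₃ g₁₂ g₁₃ g₂₃
  have z₁ := ne_zero_of_sq_eq (hσ₁ ε) n₁
  have z₂ := ne_zero_of_sq_eq (hσ₂ ε) n₂
  have z₃ := ne_zero_of_sq_eq (hσ₃ ε) n₃
  exact rootR_yangBaxter_sum hq hs z₁ z₂ z₃ (hσ₁ ε) (hσ₂ ε) (hσ₃ ε) c₁₂ c₁₃ c₂₃ g₁₂ g₁₃ g₂₃ hM

end

end

end ColoredVertex

/-! ### The linear equations for two color representations -/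

namespace ColoredVertex

noncomputable section

open Finset Filter Topology

section

variable {h : ℂ} {s : ℂ → ℂ} {p₁ p₂ u : ℂ}

/-- The two alternatives for (r, t) are X_1^+ and X_0^-, which share one matrix shape.
`rootR_lower_sum` treats X_1^- and X_0^+ in the same way. -/
theorem rootR_raise_sum (hq : ∀ n : ℕ, 0 < n → Complex.exp h ^ n ≠ 1)
    (hs : ∀ z : ℂ, s z ^ 2 = z) {σ₁ σ₂ : ℕ → ℂ}
    (z₁ : ∀ k, σ₁ k ≠ 0) (z₂ : ∀ k, σ₂ k ≠ 0)
    (h₁ : ∀ k, σ₁ k ^ 2 = qnum h (2 * p₁ - k)) (h₂ : ∀ k, σ₂ k ^ 2 = qnum h (2 * p₂ - k))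
    (hc : CGGeneric h p₁ p₂) (hg : GRegular h p₁ p₂ u) {r t t' : ℂ} (ht : t' = -t)
    (hrt : (r = 1 ∧ t = 1 / 2) ∨ (r = (qpow h (-2 * u))⁻¹ ∧ t = -(1 / 2))) {a b : ℕ × ℕ} {M : ℕ}
    (hM : a.1 + a.2 + 1 < M) :
    ∑ c ∈ range M ×ˢ range M, rootR h s p₁ p₂ u σ₁ σ₂ a c
        * (r • ((rootRep h s p₁ σ₁).Xp ⊗ₖ (rootRep h s p₂ σ₂).K t)
          + (rootRep h s p₁ σ₁).K t' ⊗ₖ (rootRep h s p₂ σ₂).Xp) c b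
      = ∑ c ∈ range M ×ˢ range M,
        (r • ((rootRep h s p₁ σ₁).Xp ⊗ₖ (rootRep h s p₂ σ₂).K t')
          + (rootRep h s p₁ σ₁).K t ⊗ₖ (rootRep h s p₂ σ₂).Xp) a c
        * rootR h s p₁ p₂ u σ₁ σ₂ c b := by
  have n₁ (k : ℕ) : qnum h (2 * p₁ - k) ≠ 0 := h₁ k ▸ pow_ne_zero 2 (z₁ k)
  have n₂ (k : ℕ) : qnum h (2 * p₂ - k) ≠ 0 := h₂ k ▸ pow_ne_zero 2 (z₂ k)
  refine rootR_intertwines hq hs z₁ z₂ h₁ h₂ (T := raiseOp h p₁ p₂ (2 * t) r 1)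
    (T' := raiseOp h p₁ p₂ (2 * t') r 1) (fun f => ?_) (by omega)
    (fun f => raiseOp_eq_sum_basisFun _ _ _ _ _ _ _ hM)
    (fun c b => raise_matrix_eq hq hs z₁ z₂ r t t' ht c b)
    (fun c b => raise_matrix_eq hq hs z₁ z₂ r t' t (by rw [ht, neg_neg]) c b)
  rcases hrt with ⟨rfl, rfl⟩ | ⟨rfl, rfl⟩ <;> subst ht
  · have := rOp_raiseOp hq n₁ n₂ hc (u := u) f
    norm_num at this ⊢
    exact this
  · have := rOp_affineRaiseOp hq n₁ n₂ hc hg f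
    norm_num at this ⊢
    exact this

theorem rootR_lower_sum (hq : ∀ n : ℕ, 0 < n → Complex.exp h ^ n ≠ 1)
    (hs : ∀ z : ℂ, s z ^ 2 = z) {σ₁ σ₂ : ℕ → ℂ}
    (z₁ : ∀ k, σ₁ k ≠ 0) (z₂ : ∀ k, σ₂ k ≠ 0)
    (h₁ : ∀ k, σ₁ k ^ 2 = qnum h (2 * p₁ - k)) (h₂ : ∀ k, σ₂ k ^ 2 = qnum h (2 * p₂ - k))
    (hc : CGGeneric h p₁ p₂) (hg : GRegular h p₁ p₂ u) {r t t' : ℂ} (ht : t' = -t)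
    (hrt : (r = 1 ∧ t = 1 / 2) ∨ (r = qpow h (-2 * u) ∧ t = -(1 / 2))) {a b : ℕ × ℕ} {M : ℕ}
    (hM : a.1 + a.2 + 1 < M) :
    ∑ c ∈ range M ×ˢ range M, rootR h s p₁ p₂ u σ₁ σ₂ a c
        * (r • ((rootRep h s p₁ σ₁).Xm ⊗ₖ (rootRep h s p₂ σ₂).K t)
          + (rootRep h s p₁ σ₁).K t' ⊗ₖ (rootRep h s p₂ σ₂).Xm) c b
      = ∑ c ∈ range M ×ˢ range M,
        (r • ((rootRep h s p₁ σ₁).Xm ⊗ₖ (rootRep h s p₂ σ₂).K t')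
          + (rootRep h s p₁ σ₁).K t ⊗ₖ (rootRep h s p₂ σ₂).Xm) a c
        * rootR h s p₁ p₂ u σ₁ σ₂ c b := by
  have n₁ (k : ℕ) : qnum h (2 * p₁ - k) ≠ 0 := h₁ k ▸ pow_ne_zero 2 (z₁ k)
  have n₂ (k : ℕ) : qnum h (2 * p₂ - k) ≠ 0 := h₂ k ▸ pow_ne_zero 2 (z₂ k)
  refine rootR_intertwines hq hs z₁ z₂ h₁ h₂ (T := lowerOp h p₁ p₂ (2 * t) r 1)
    (T' := lowerOp h p₁ p₂ (2 * t') r 1) (fun f => ?_) (by omega)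
    (fun f => lowerOp_eq_sum_basisFun _ _ _ _ _ _ _ hM)
    (fun c b => lower_matrix_eq hq hs z₁ z₂ h₁ h₂ r t t' ht c b)
    (fun c b => lower_matrix_eq hq hs z₁ z₂ h₁ h₂ r t' t (by rw [ht, neg_neg]) c b)
  rcases hrt with ⟨rfl, rfl⟩ | ⟨rfl, rfl⟩ <;> subst ht
  · have := rOp_lowerOp hq n₁ n₂ hc (u := u) f
    norm_num at this ⊢
    exact this
  · have := rOp_affineLowerOp hq n₁ n₂ hc hg f
    norm_num at this ⊢
    exact this

variable (hq : ∀ n : ℕ, 0 < n → Complex.exp h ^ n ≠ 1)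
  (hs : ∀ z : ℂ, s z ^ 2 = z) (hc : CGRegular h p₁ p₂) (hg : GRegular h p₁ p₂ u)

include hq hs hc hg

theorem RPP_raise_sum {r t t' : ℂ} (ht : t' = -t)
    (hrt : (r = 1 ∧ t = 1 / 2) ∨ (r = (qpow h (-2 * u))⁻¹ ∧ t = -(1 / 2))) {a b : ℕ × ℕ} {M : ℕ}
    (hM : a.1 + a.2 + 1 < M) :
    ∑ c ∈ range M ×ˢ range M, RPP h s p₁ p₂ u a c
        * (r • ((colorRep h s p₁).Xp ⊗ₖ (colorRep h s p₂).K t)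
          + (colorRep h s p₁).K t' ⊗ₖ (colorRep h s p₂).Xp) c b
      = ∑ c ∈ range M ×ˢ range M,
        (r • ((colorRep h s p₁).Xp ⊗ₖ (colorRep h s p₂).K t')
          + (colorRep h s p₁).K t ⊗ₖ (colorRep h s p₂).Xp) a c * RPP h s p₁ p₂ u c b := by
  obtain ⟨σ₁, hσ₁, hl₁⟩ := exists_stdRoot_tendsto h hs p₁
  obtain ⟨σ₂, hσ₂, hl₂⟩ := exists_stdRoot_tendsto h hs p₂
  replace hl₁ := fun k => (hl₁ k).mono_left (inf_le_left (b := cocountable))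
  replace hl₂ := fun k => (hl₂ k).mono_left (inf_le_left (b := cocountable))
  have ht₁ := tendsto_add_zero p₁
  have ht₂ := tendsto_add_zero p₂
  have T := tendsto_rootR (s := s) ht₁ ht₂ hl₁ hl₂ tendsto_const_nhds hc hg
  have X₁ := tendsto_rootRep_Xp (h := h) (s := s) (p := p₁) (P := fun ε => p₁ + ε) hl₁
  have X₂ := tendsto_rootRep_Xp (h := h) (s := s) (p := p₂) (P := fun ε => p₂ + ε) hl₂
  have K₁ := tendsto_rootRep_K (h := h) (s := s) (σ := stdRoot h s p₁) (S := σ₁) ht₁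
  have K₂ := tendsto_rootRep_K (h := h) (s := s) (σ := stdRoot h s p₂) (S := σ₂) ht₂
  simp only [RPP_eq_rootR hs, colorRep_eq]
  refine tendsto_nhds_unique_of_eventuallyEq
    (tendsto_finsetSum _ fun c _ => (T _ _).mul
      ((((X₁ _ _).mul (K₂ t _ _)).const_mul r).add ((K₁ t' _ _).mul (X₂ _ _))))
    (tendsto_finsetSum _ fun c _ => ((((X₁ _ _).mul (K₂ t' _ _)).const_mul r).add
      ((K₁ t _ _).mul (X₂ _ _))).mul (T _ _)) ?_
  filter_upwards [eventually_ne_zero hq p₁, eventually_ne_zero hq p₂, eventually_CGGeneric hq p₁ p₂,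
    eventually_GRegular hq p₁ p₂ u] with ε n₁ n₂ c g
  exact rootR_raise_sum hq hs (ne_zero_of_sq_eq (hσ₁ ε) n₁) (ne_zero_of_sq_eq (hσ₂ ε) n₂)
    (hσ₁ ε) (hσ₂ ε) c g ht hrt hM

theorem RPP_lower_sum {r t t' : ℂ} (ht : t' = -t)
    (hrt : (r = 1 ∧ t = 1 / 2) ∨ (r = qpow h (-2 * u) ∧ t = -(1 / 2))) {a b : ℕ × ℕ} {M : ℕ}
    (hM : a.1 + a.2 + 1 < M) :
    ∑ c ∈ range M ×ˢ range M, RPP h s p₁ p₂ u a c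
        * (r • ((colorRep h s p₁).Xm ⊗ₖ (colorRep h s p₂).K t)
          + (colorRep h s p₁).K t' ⊗ₖ (colorRep h s p₂).Xm) c b
      = ∑ c ∈ range M ×ˢ range M,
        (r • ((colorRep h s p₁).Xm ⊗ₖ (colorRep h s p₂).K t')
          + (colorRep h s p₁).K t ⊗ₖ (colorRep h s p₂).Xm) a c * RPP h s p₁ p₂ u c b := by
  obtain ⟨σ₁, hσ₁, hl₁⟩ := exists_stdRoot_tendsto h hs p₁
  obtain ⟨σ₂, hσ₂, hl₂⟩ := exists_stdRoot_tendsto h hs p₂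
  replace hl₁ := fun k => (hl₁ k).mono_left (inf_le_left (b := cocountable))
  replace hl₂ := fun k => (hl₂ k).mono_left (inf_le_left (b := cocountable))
  have ht₁ := tendsto_add_zero p₁
  have ht₂ := tendsto_add_zero p₂
  have T := tendsto_rootR (s := s) ht₁ ht₂ hl₁ hl₂ tendsto_const_nhds hc hg
  have X₁ := tendsto_rootRep_Xm (h := h) (s := s) (p := p₁) (P := fun ε => p₁ + ε) hl₁
  have X₂ := tendsto_rootRep_Xm (h := h) (s := s) (p := p₂) (P := fun ε => p₂ + ε) hl₂
  have K₁ := tendsto_rootRep_K (h := h) (s := s) (σ := stdRoot h s p₁) (S := σ₁) ht₁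
  have K₂ := tendsto_rootRep_K (h := h) (s := s) (σ := stdRoot h s p₂) (S := σ₂) ht₂
  simp only [RPP_eq_rootR hs, colorRep_eq]
  refine tendsto_nhds_unique_of_eventuallyEq
    (tendsto_finsetSum _ fun c _ => (T _ _).mul
      ((((X₁ _ _).mul (K₂ t _ _)).const_mul r).add ((K₁ t' _ _).mul (X₂ _ _))))
    (tendsto_finsetSum _ fun c _ => ((((X₁ _ _).mul (K₂ t' _ _)).const_mul r).add
      ((K₁ t _ _).mul (X₂ _ _))).mul (T _ _)) ?_
  filter_upwards [eventually_ne_zero hq p₁, eventually_ne_zero hq p₂, eventually_CGGeneric hq p₁ p₂,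
    eventually_GRegular hq p₁ p₂ u] with ε n₁ n₂ c g
  exact rootR_lower_sum hq hs (ne_zero_of_sq_eq (hσ₁ ε) n₁) (ne_zero_of_sq_eq (hσ₂ ε) n₂)
    (hσ₁ ε) (hσ₂ ε) c g ht hrt hM

end

end

end ColoredVertex

namespace ColoredVertex

noncomputable section

open Finset Filter Topology

/-! ### Finite sums -/

theorem prodEq_of_finset {ι : Type} {A B C D : Matrix ι ι ℂ} (H : ∀ a b, ∃ S : Finset ι,
    (∀ c ∉ S, A a c * B c b = 0) ∧ (∀ c ∉ S, C a c * D c b = 0) ∧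
    ∑ c ∈ S, A a c * B c b = ∑ c ∈ S, C a c * D c b) : ProdEq A B C D := by
  intro a b
  obtain ⟨S, h₁, h₂, h₃⟩ := H a b
  have e₁ : (Function.support fun c => A a c * B c b) ⊆ S := fun c hc => by
    by_contra hcS
    exact hc (h₁ c hcS)
  have e₂ : (Function.support fun c => C a c * D c b) ⊆ S := fun c hc => by
    by_contra hcS
    exact hc (h₂ c hcS)
  refine ⟨S.finite_toSet.subset e₁, S.finite_toSet.subset e₂, ?_⟩
  rw [finsum_eq_sum_of_support_subset _ e₁, finsum_eq_sum_of_support_subset _ e₂, h₃]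

theorem prodEq_diagonal {ι : Type} [DecidableEq ι] {R : Matrix ι ι ℂ} {κ : ι → ℂ}
    (hR : ∀ a b, R a b ≠ 0 → κ a = κ b) :
    ProdEq R (Matrix.diagonal κ) (Matrix.diagonal κ) R := by
  refine prodEq_of_finset fun a b => ⟨{a, b}, fun c hc => ?_, fun c hc => ?_, ?_⟩
  · rw [Matrix.diagonal_apply_ne _ fun h => hc (by simp [h]), mul_zero]
  · rw [Matrix.diagonal_apply_ne' _ fun h => hc (by simp [h]), zero_mul]
  · rw [sum_eq_single_of_mem b (by simp) fun c _ hc => by rw [Matrix.diagonal_apply_ne _ hc, mul_zero],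
      sum_eq_single_of_mem a (by simp) fun c _ hc => by rw [Matrix.diagonal_apply_ne' _ hc, zero_mul],
      Matrix.diagonal_apply_eq, Matrix.diagonal_apply_eq]
    by_cases h0 : R a b = 0
    · simp [h0]
    · rw [hR a b h0, mul_comm]

theorem solvesIntertwining_of {ι κ : Type} {x : ℂ} {ρ₁ : RepMatrices ι} {ρ₂ : RepMatrices κ}
    {R : Matrix (ι × κ) (ι × κ) ℂ}
    (hK : ∀ t, ProdEq R (ρ₁.K t ⊗ₖ ρ₂.K t) (ρ₁.K t ⊗ₖ ρ₂.K t) R)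
    (hp : ∀ r t t' : ℂ, t' = -t → (r = 1 ∧ t = 1 / 2) ∨ (r = x⁻¹ ∧ t = -(1 / 2)) →
      ProdEq R (r • (ρ₁.Xp ⊗ₖ ρ₂.K t) + ρ₁.K t' ⊗ₖ ρ₂.Xp)
        (r • (ρ₁.Xp ⊗ₖ ρ₂.K t') + ρ₁.K t ⊗ₖ ρ₂.Xp) R)
    (hm : ∀ r t t' : ℂ, t' = -t → (r = 1 ∧ t = 1 / 2) ∨ (r = x ∧ t = -(1 / 2)) →
      ProdEq R (r • (ρ₁.Xm ⊗ₖ ρ₂.K t) + ρ₁.K t' ⊗ₖ ρ₂.Xm)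
        (r • (ρ₁.Xm ⊗ₖ ρ₂.K t') + ρ₁.K t ⊗ₖ ρ₂.Xm) R) :
    SolvesIntertwining x ρ₁ ρ₂ R := by
  intro i
  by_cases hi : i = 0
  · simp only [RepMatrices.hatXp, RepMatrices.hatXm, RepMatrices.hatK, if_pos hi]
    exact ⟨hK _, hm _ _ _ rfl (Or.inr ⟨rfl, rfl⟩), hp _ _ _ rfl (Or.inr ⟨rfl, rfl⟩)⟩
  · simp only [RepMatrices.hatXp, RepMatrices.hatXm, RepMatrices.hatK, if_neg hi]
    exact ⟨hK _, hp _ _ _ rfl (Or.inl ⟨rfl, rfl⟩), hm _ _ _ rfl (Or.inl ⟨rfl, rfl⟩)⟩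

/-! ### Two color representations -/

section

variable {h : ℂ} {s : ℂ → ℂ}

theorem RPP_of_ne {p₁ p₂ u : ℂ} {a b : ℕ × ℕ} (hab : a.1 + a.2 ≠ b.1 + b.2) :
    RPP h s p₁ p₂ u a b = 0 := by
  rw [RPP, Matrix.of_apply]
  refine (finsum_congr fun x => ?_).trans finsum_zero
  by_cases hx : x.2 + x.1 = b.1 + b.2
  · exact termPP_of_ne_left fun h => hab (h.symm.trans hx)
  · exact termPP_of_ne hx

variable (hq : ∀ n : ℕ, 0 < n → Complex.exp h ^ n ≠ 1) (hs : ∀ z : ℂ, s z ^ 2 = z)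

include hq hs

theorem RPP_solvesIntertwining {p₁ p₂ u : ℂ} (hc : CGRegular h p₁ p₂) (hg : GRegular h p₁ p₂ u) :
    SolvesIntertwining (qpow h (-2 * u)) (colorRep h s p₁) (colorRep h s p₂)
      (RPP h s p₁ p₂ u) := by
  refine solvesIntertwining_of (fun t => ?_) (fun r t t' ht hrt => ?_) fun r t t' ht hrt => ?_
  · rw [colorRep, colorRep, Matrix.diagonal_kronecker_diagonal]
    refine prodEq_diagonal fun a b hab => ?_
    have : a.1 + a.2 = b.1 + b.2 := by
      by_contra hne
      exact hab (RPP_of_ne hne)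
    rw [← qpow_add, ← qpow_add]
    congr 1
    have e : (a.1 : ℂ) + a.2 = b.1 + b.2 := by exact_mod_cast this
    linear_combination (-2 * t) * e
  all_goals
    refine prodEq_of_finset fun a b => ⟨range (a.1 + a.2 + b.1 + b.2 + 2) ×ˢ
      range (a.1 + a.2 + b.1 + b.2 + 2), fun c hc => ?_, fun c hc => ?_, ?_⟩
    · rw [RPP_of_ne, zero_mul]
      rw [mem_product, mem_range, mem_range] at hc
      omega
    · rw [RPP_of_ne, mul_zero]
      rw [mem_product, mem_range, mem_range] at hc
      omega
  · exact RPP_raise_sum hq hs hc hg ht hrt (by omega)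
  · exact RPP_lower_sum hq hs hc hg ht hrt (by omega)

theorem RPP_yangBaxter {p₁ p₂ p₃ u v : ℂ} (hc₁₂ : CGRegular h p₁ p₂) (hc₁₃ : CGRegular h p₁ p₃)
    (hc₂₃ : CGRegular h p₂ p₃) (hg₁₂ : GRegular h p₁ p₂ u) (hg₁₃ : GRegular h p₁ p₃ (u + v))
    (hg₂₃ : GRegular h p₂ p₃ v) :
    YangBaxter (RPP h s p₁ p₂ u) (RPP h s p₁ p₃ (u + v)) (RPP h s p₂ p₃ v) := by
  intro a₁ b₁ a₂ b₂ a₃ b₃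
  obtain ⟨M, hM⟩ : ∃ M, M = a₁ + a₂ + a₃ + b₁ + b₂ + b₃ + 1 := ⟨_, rfl⟩
  have e₁ : (Function.support fun c : ℕ × ℕ × ℕ => RPP h s p₁ p₂ u (c.1, c.2.1) (b₁, b₂)
      * RPP h s p₁ p₃ (u + v) (a₁, c.2.2) (c.1, b₃) * RPP h s p₂ p₃ v (a₂, a₃) (c.2.1, c.2.2))
      ⊆ (range M ×ˢ range M ×ˢ range M : Finset (ℕ × ℕ × ℕ)) := by
    intro c hc
    have h₁ := left_ne_zero_of_mul (left_ne_zero_of_mul hc)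
    have h₂ := right_ne_zero_of_mul hc
    have h₁ : c.1 + c.2.1 = b₁ + b₂ := by
      by_contra hne
      exact h₁ (RPP_of_ne hne)
    have h₂ : a₂ + a₃ = c.2.1 + c.2.2 := by
      by_contra hne
      exact h₂ (RPP_of_ne hne)
    simp only [coe_product, Set.mem_prod, mem_coe, mem_range]
    omega
  have e₂ : (Function.support fun c : ℕ × ℕ × ℕ => RPP h s p₁ p₂ u (a₁, a₂) (c.1, c.2.1)
        * RPP h s p₁ p₃ (u + v) (c.1, a₃) (b₁, c.2.2)
        * RPP h s p₂ p₃ v (c.2.1, c.2.2) (b₂, b₃))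
      ⊆ (range M ×ˢ range M ×ˢ range M : Finset (ℕ × ℕ × ℕ)) := by
    intro c hc
    have h₁ := left_ne_zero_of_mul (left_ne_zero_of_mul hc)
    have h₂ := right_ne_zero_of_mul hc
    have h₁ : a₁ + a₂ = c.1 + c.2.1 := by
      by_contra hne
      exact h₁ (RPP_of_ne hne)
    have h₂ : c.2.1 + c.2.2 = b₂ + b₃ := by
      by_contra hne
      exact h₂ (RPP_of_ne hne)
    simp only [coe_product, Set.mem_prod, mem_coe, mem_range]
    omega
  refine ⟨(finite_toSet _).subset e₁, (finite_toSet _).subset e₂, ?_⟩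
  rw [finsum_eq_sum_of_support_subset _ e₁, finsum_eq_sum_of_support_subset _ e₂]
  exact RPP_yangBaxter_sum hq hs hc₁₂ hc₁₃ hc₂₃ hg₁₂ hg₁₃ hg₂₃ (by omega)

end

/-! ### The colored vertex model -/

theorem CGRegular.symm {h p₁ p₂ : ℂ} (hc : CGRegular h p₁ p₂) : CGRegular h p₂ p₁ := fun k => by
  rw [add_comm (2 * p₂)]
  exact hc k

theorem GRegular.symm {h p₁ p₂ u : ℂ} (hg : GRegular h p₁ p₂ u) : GRegular h p₂ p₁ u := fun k => by
  rw [add_right_comm u]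
  exact hg k

/-- The permutation of summation indices `(c₁, c₂, c₃) ↦ (c₃, c₂, c₁)`. -/
def reverseIndices : ℕ × ℕ × ℕ ≃ ℕ × ℕ × ℕ where
  toFun c := (c.2.2, c.2.1, c.1)
  invFun c := (c.2.2, c.2.1, c.1)
  left_inv _ := rfl
  right_inv _ := rfl

/-- The weight X with colors (α, β) is R with the representations in the order (β, α). The vertex
relation for 1, 2, 3 is therefore the Yang-Baxter equation for 3, 2, 1 with the summation indices
read backwards. -/
theorem vertexYangBaxter_of_yangBaxter {h : ℂ} {s : ℂ → ℂ} {p₁ p₂ p₃ u₁ u₂ u₃ : ℂ}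
    (H : YangBaxter (RPP h s p₃ p₂ (u₂ - u₃)) (RPP h s p₃ p₁ (u₁ - u₃))
      (RPP h s p₂ p₁ (u₁ - u₂))) : VertexYangBaxter (vertexWeight h s) p₁ p₂ p₃ u₁ u₂ u₃ := by
  intro a₁ a₂ a₃ b₁ b₂ b₃
  obtain ⟨f₁, f₂, e⟩ := H a₃ b₃ a₂ b₂ a₁ b₁
  simp only [vertexWeight]
  have g₁ : (fun c : ℕ × ℕ × ℕ => RPP h s p₂ p₁ (u₁ - u₂) (a₂, a₁) (c.2.1, c.1)
      * RPP h s p₃ p₁ (u₁ - u₃) (a₃, c.1) (c.2.2, b₁)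
      * RPP h s p₃ p₂ (u₂ - u₃) (c.2.2, c.2.1) (b₃, b₂))
      = (fun c : ℕ × ℕ × ℕ => RPP h s p₃ p₂ (u₂ - u₃) (c.1, c.2.1) (b₃, b₂)
      * RPP h s p₃ p₁ (u₁ - u₃) (a₃, c.2.2) (c.1, b₁)
      * RPP h s p₂ p₁ (u₁ - u₂) (a₂, a₁) (c.2.1, c.2.2)) ∘ reverseIndices := by
    ext c
    simp only [Function.comp, reverseIndices, Equiv.coe_fn_mk]
    ring
  have g₂ : (fun c : ℕ × ℕ × ℕ => RPP h s p₃ p₂ (u₂ - u₃) (a₃, a₂) (c.2.2, c.2.1)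
      * RPP h s p₃ p₁ (u₁ - u₃) (c.2.2, a₁) (b₃, c.1)
      * RPP h s p₂ p₁ (u₁ - u₂) (c.2.1, c.1) (b₂, b₁))
      = (fun c : ℕ × ℕ × ℕ => RPP h s p₃ p₂ (u₂ - u₃) (a₃, a₂) (c.1, c.2.1)
      * RPP h s p₃ p₁ (u₁ - u₃) (c.1, a₁) (b₃, c.2.2)
      * RPP h s p₂ p₁ (u₁ - u₂) (c.2.1, c.2.2) (b₂, b₁)) ∘ reverseIndices := rfl
  rw [g₁, g₂, Function.support_comp_eq_preimage, Function.support_comp_eq_preimage]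
  refine ⟨f₁.preimage reverseIndices.injective.injOn, f₂.preimage reverseIndices.injective.injOn, ?_⟩
  simp only [Function.comp_def]
  rw [finsum_comp_equiv reverseIndices
      (f := fun c : ℕ × ℕ × ℕ => RPP h s p₃ p₂ (u₂ - u₃) (c.1, c.2.1) (b₃, b₂)
      * RPP h s p₃ p₁ (u₁ - u₃) (a₃, c.2.2) (c.1, b₁)
      * RPP h s p₂ p₁ (u₁ - u₂) (a₂, a₁) (c.2.1, c.2.2)),
    finsum_comp_equiv reverseIndices
      (f := fun c : ℕ × ℕ × ℕ => RPP h s p₃ p₂ (u₂ - u₃) (a₃, a₂) (c.1, c.2.1)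
      * RPP h s p₃ p₁ (u₁ - u₃) (c.1, a₁) (b₃, c.2.2)
      * RPP h s p₂ p₁ (u₁ - u₂) (c.2.1, c.2.2) (b₂, b₁)), e]

/-! ### Periodicity in the exponents: dependence on the colors only -/

section

variable {h : ℂ} {w : ℂ} (hw : qpow h w = 1)

include hw

theorem qpow_intCast_mul_period (n : ℤ) : qpow h (n * w) = 1 := by
  rw [qpow, mul_left_comm, Complex.exp_int_mul, ← qpow, hw, one_zpow]

theorem qpow_add_period (z : ℂ) : qpow h (z + w) = qpow h z := by rw [qpow_add, hw, mul_one]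

theorem qnum_add_period (z : ℂ) : qnum h (z + w) = qnum h z := by
  rw [qnum, qnum, qpow_neg, qpow_neg h z, qpow_add_period hw]

theorem sqrtFall_add_period (s : ℂ → ℂ) (z : ℂ) (n : ℕ) :
    sqrtFall h s (z + w) n = sqrtFall h s z n :=
  prod_congr rfl fun k _ => by rw [add_sub_right_comm, qnum_add_period hw]

end

section

variable {h : ℂ} (s : ℂ → ℂ) {w₁ w₂ : ℂ} (hw₁ : qpow h w₁ = 1) (hw₂ : qpow h w₂ = 1) (p₁ p₂ : ℂ)

include hw₁ hw₂

theorem qpow_period_combination (k l : ℤ) : qpow h (k * w₁ + l * w₂) = 1 := by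
  rw [qpow_add, qpow_intCast_mul_period hw₁, qpow_intCast_mul_period hw₂, one_mul]

/-- In every exponent and every q-number p₁ and p₂ occur with integer coefficients, so shifts by w₁,
w₂ with q^{w₁} = q^{w₂} = 1 leave each factor unchanged, including the argument at which s is
evaluated. -/
theorem cgPP_add_period (n z₁ z₂ z₃ : ℕ) :
    cgPP h s (p₁ + w₁) (p₂ + w₂) n z₁ z₂ z₃ = cgPP h s p₁ p₂ n z₁ z₂ z₃ := by
  have hp := qpow_period_combination hw₁ hw₂
  have a₁ (k : ℕ) (m : ℕ) : sqrtFall h s (2 * (p₁ + w₁) - k) m = sqrtFall h s (2 * p₁ - k) m := by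
    rw [← sqrtFall_add_period (hp 2 0) s (2 * p₁ - k)]
    congr 1
    push_cast
    ring
  have a₂ (k : ℕ) (m : ℕ) : sqrtFall h s (2 * (p₂ + w₂) - k) m = sqrtFall h s (2 * p₂ - k) m := by
    rw [← sqrtFall_add_period (hp 0 2) s (2 * p₂ - k)]
    congr 1
    push_cast
    ring
  have a₃ (m : ℕ) : sqrtFall h s (2 * (p₁ + w₁) + 2 * (p₂ + w₂) - n + 1) m
      = sqrtFall h s (2 * p₁ + 2 * p₂ - n + 1) m := by
    rw [← sqrtFall_add_period (hp 2 2) s (2 * p₁ + 2 * p₂ - n + 1)]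
    congr 1
    push_cast
    ring
  have a₄ : qnum h (2 * (p₁ + w₁) + 2 * (p₂ + w₂) - 2 * n + 1)
      = qnum h (2 * p₁ + 2 * p₂ - 2 * n + 1) := by
    rw [← qnum_add_period (hp 2 2) (2 * p₁ + 2 * p₂ - 2 * n + 1)]
    congr 1
    push_cast
    ring
  have a₅ : qpow h (((n : ℂ) - (n : ℂ) ^ 2) / 2 + ((n : ℂ) - z₂) * (p₁ + w₁)
        + ((n : ℂ) + z₁) * (p₂ + w₂))
      = qpow h (((n : ℂ) - (n : ℂ) ^ 2) / 2 + ((n : ℂ) - z₂) * p₁ + ((n : ℂ) + z₁) * p₂) := by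
    rw [← qpow_add_period (hp (n - z₂) (n + z₁)) (((n : ℂ) - (n : ℂ) ^ 2) / 2 + ((n : ℂ) - z₂) * p₁
      + ((n : ℂ) + z₁) * p₂)]
    congr 1
    push_cast
    ring
  have a₆ (ν : ℕ) : qpow h (-(ν : ℂ) * (2 * (p₁ + w₁) + 2 * (p₂ + w₂) - n + 1))
      = qpow h (-(ν : ℂ) * (2 * p₁ + 2 * p₂ - n + 1)) := by
    rw [← qpow_add_period (hp (-(2 * ν)) (-(2 * ν))) (-(ν : ℂ) * (2 * p₁ + 2 * p₂ - n + 1))]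
    congr 1
    push_cast
    ring
  simp only [cgPP, cgOn, a₁, a₂, a₃, a₄, a₅, a₆]

theorem gfun_add_period (n : ℕ) (u : ℂ) :
    gfun h (p₁ + w₁) (p₂ + w₂) n u = gfun h p₁ p₂ n u := by
  have hp := qpow_period_combination hw₁ hw₂
  rw [gfun, gfun]
  congr 1
  refine prod_congr rfl fun k _ => ?_
  rw [← qnum_add_period (hp 1 1) (u + p₁ + p₂ - k), ← qnum_add_period (hp (-1) (-1)) (u - p₁ - p₂ + k)]
  congr 2 <;> (push_cast; ring)

theorem RPP_add_period (u : ℂ) : RPP h s (p₁ + w₁) (p₂ + w₂) u = RPP h s p₁ p₂ u := by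
  ext a b
  simp only [RPP, Matrix.of_apply, termPP, gfun_add_period hw₁ hw₂, cgPP_add_period s hw₁ hw₂,
    cgPP_add_period s hw₂ hw₁]

end

theorem vertexWeight_congr {h : ℂ} (s : ℂ → ℂ) {p₁ p₂ p₁' p₂' : ℂ} (u : ℂ)
    (h₁ : qpow h p₁ = qpow h p₁') (h₂ : qpow h p₂ = qpow h p₂') :
    vertexWeight h s p₁ p₂ u = vertexWeight h s p₁' p₂' u := by
  have hw {p p' : ℂ} (hp : qpow h p = qpow h p') : qpow h (p' - p) = 1 := by
    rw [qpow_sub, hp, mul_inv_cancel₀ (qpow_ne_zero _ _)]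
  ext a b c d
  have := RPP_add_period s (hw h₂) (hw h₁) p₂ p₁ u
  rw [add_sub_cancel, add_sub_cancel] at this
  rw [vertexWeight, vertexWeight, this]

end

end ColoredVertex

namespace ColoredVertex

noncomputable section

open Finset Filter Topology

/-! ### A color representation and a spin representation -/

section

variable {h : ℂ} {s : ℂ → ℂ} (hs : ∀ z : ℂ, s z ^ 2 = z) {m : ℕ}

include hs

/-- The product reaches the factor s([0]), and s(0)² = 0 forces s(0) = 0. The extra bounds on ν for
a spin thus only discard terms that vanish anyway. -/
theorem sqrtFall_spin_eq_zero {k n : ℕ} (hk : k ≤ m) (hn : m - k < n) :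
    sqrtFall h s (2 * ((m : ℂ) / 2) - k) n = 0 := by
  refine prod_eq_zero (mem_range.2 hn) ?_
  rw [Nat.cast_sub hk, show 2 * ((m : ℂ) / 2) - k - (m - k) = 0 by ring, qnum_zero]
  exact pow_eq_zero_iff two_ne_zero |>.1 (hs 0)

theorem cgPJ_eq_cgPP (p₁ : ℂ) (n z₁ : ℕ) {z₂ : ℕ} (z₃ : ℕ) (hz : z₂ ≤ m) :
    cgPJ h s p₁ m n z₁ z₂ z₃ = cgPP h s p₁ ((m : ℂ) / 2) n z₁ z₂ z₃ := by
  rw [cgPJ, cgPP, cgOn, cgOn]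
  congr 2
  refine sum_subset (fun ν hν => ?_) fun ν hν hν' => ?_
  · rw [mem_Icc] at *
    omega
  · rw [mem_Icc] at *
    rw [sqrtFall_spin_eq_zero hs hz (n := ν) (by omega)]
    simp

theorem cgJP_eq_cgPP (p₂ : ℂ) (n : ℕ) {z₁ : ℕ} (z₂ z₃ : ℕ) (hz : z₁ ≤ m) :
    cgJP h s m p₂ n z₁ z₂ z₃ = cgPP h s ((m : ℂ) / 2) p₂ n z₁ z₂ z₃ := by
  rw [cgJP, cgPP, cgOn, cgOn]
  congr 2
  refine sum_subset (fun ν hν => ?_) fun ν hν hν' => ?_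
  · rw [mem_Icc] at *
    omega
  · rw [mem_Icc] at *
    rw [sqrtFall_spin_eq_zero hs hz (n := n - ν) (by omega)]
    simp

theorem cgPP_spin_right_eq_zero (p₁ : ℂ) {n z₁ z₂ z₃ : ℕ}
    (hz : (n ≤ m ∧ m < z₂) ∨ (z₂ ≤ m ∧ m < n)) :
    cgPP h s p₁ ((m : ℂ) / 2) n z₁ z₂ z₃ = 0 := by
  rw [cgPP, cgOn]
  split_ifs with he
  · rw [sum_eq_zero, mul_zero]
    intro ν hν
    rw [mem_Icc] at hν
    rcases hz with hz | hz
    · rw [sqrtFall_spin_eq_zero hs hz.1 (n := z₂ + ν - n) (by omega)]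
      simp
    · rw [sqrtFall_spin_eq_zero hs hz.1 (n := ν) (by omega)]
      simp
  · rfl

theorem cgPP_spin_left_eq_zero (p₂ : ℂ) {n z₁ z₂ z₃ : ℕ}
    (hz : (n ≤ m ∧ m < z₁) ∨ (z₁ ≤ m ∧ m < n)) :
    cgPP h s ((m : ℂ) / 2) p₂ n z₁ z₂ z₃ = 0 := by
  rw [cgPP, cgOn]
  split_ifs with he
  · rw [sum_eq_zero, mul_zero]
    intro ν hν
    rw [mem_Icc] at hν
    rcases hz with hz | hz
    · rw [sqrtFall_spin_eq_zero hs hz.1 (n := z₁ - ν) (by omega)]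
      simp
    · rw [sqrtFall_spin_eq_zero hs hz.1 (n := n - ν) (by omega)]
      simp
  · rfl

/-- R at p₂ = m/2 is block diagonal for the splitting of the second index at m. For n ≤ m the
Clebsch-Gordan factor with the outside index vanishes, for n > m the one with the inside index. -/
theorem RPP_spin_eq_zero (p₁ u : ℂ) {a b : ℕ × ℕ}
    (hab : (a.2 ≤ m ∧ m < b.2) ∨ (b.2 ≤ m ∧ m < a.2)) :
    RPP h s p₁ ((m : ℂ) / 2) u a b = 0 := by
  rw [RPP, Matrix.of_apply]
  refine (finsum_congr fun x => ?_).trans finsum_zero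
  rw [termPP]
  by_cases hn : x.1 ≤ m
  · rcases hab with hab | hab
    · rw [cgPP_spin_right_eq_zero hs _ (Or.inl ⟨hn, hab.2⟩), mul_zero, zero_mul]
    · rw [cgPP_spin_left_eq_zero hs _ (Or.inl ⟨hn, hab.2⟩), mul_zero]
  · rcases hab with hab | hab
    · rw [cgPP_spin_left_eq_zero hs _ (Or.inr ⟨hab.1, by omega⟩), mul_zero]
    · rw [cgPP_spin_right_eq_zero hs _ (Or.inr ⟨hab.1, by omega⟩), mul_zero, zero_mul]

theorem termPJ_eq_termPP (p₁ u : ℂ) (a b : ℕ × Fin (m + 1)) (x : Fin (m + 1) × ℕ) :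
    termPJ h s p₁ m u a b x
      = termPP h s p₁ ((m : ℂ) / 2) u (a.1, a.2) (b.1, b.2) (x.1, x.2) := by
  rw [termPJ, termPP, cgPJ_eq_cgPP hs _ _ _ _ (by omega), cgJP_eq_cgPP hs _ _ _ _ (by omega)]

theorem RPJ_eq_RPP (p₁ u : ℂ) (a b : ℕ × Fin (m + 1)) :
    RPJ h s p₁ m u a b = RPP h s p₁ ((m : ℂ) / 2) u (a.1, a.2) (b.1, b.2) := by
  classical
  rw [RPJ, Matrix.of_apply, RPP, Matrix.of_apply]
  let φ : Fin (m + 1) × ℕ → ℕ × ℕ := fun x => (x.1, x.2)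
  have hφ : Function.Injective φ := fun x y hxy => by
    simp only [φ, Prod.mk.injEq] at hxy
    exact Prod.ext (Fin.ext hxy.1) hxy.2
  rw [finsum_congr fun x => termPJ_eq_termPP hs p₁ u a b x]
  refine (finsum_mem_range (f := termPP h s p₁ ((m : ℂ) / 2) u (a.1, a.2) (b.1, b.2)) hφ).symm.trans
    (finsum_congr fun y => ?_)
  by_cases hy : y ∈ Set.range φ
  · rw [finsum_eq_if, if_pos hy]
  · rw [finsum_eq_if, if_neg hy, termPP, cgPP_spin_right_eq_zero hs _ (Or.inr ⟨by simp; omega, ?_⟩),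
      mul_zero, zero_mul]
    by_contra hlt
    exact hy ⟨(⟨y.1, by omega⟩, y.2), rfl⟩

theorem support_termPJ_subset (p₁ u : ℂ) (a b : ℕ × Fin (m + 1)) :
    Function.support (termPJ h s p₁ m u a b)
      ⊆ (univ ×ˢ range (b.1 + b.2 + 1) : Finset (Fin (m + 1) × ℕ)) := by
  intro x hx
  by_contra hne
  refine hx ?_
  rw [termPJ_eq_termPP hs, termPP_of_ne]
  simp only [coe_product, Set.mem_prod, mem_coe, mem_univ, mem_range, true_and, not_lt] at hne
  simp only
  omega

theorem RPJ_of_ne {p₁ u : ℂ} {a b : ℕ × Fin (m + 1)} (hab : a.1 + (a.2 : ℕ) ≠ b.1 + b.2) :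
    RPJ h s p₁ m u a b = 0 := by
  rw [RPJ_eq_RPP hs, RPP_of_ne hab]

/-- Only n ≤ m occurs, so the m denominators of `GRegularSpin` suffice for continuity in u, although
R for two colors may be singular at u. -/
theorem tendsto_RPJ {p₁ u : ℂ} {ι : Type*} {l : Filter ι} {U : ι → ℂ} (hU : Tendsto U l (𝓝 u))
    (hg : GRegularSpin h p₁ m u) (a b : ℕ × Fin (m + 1)) :
    Tendsto (fun i => RPJ h s p₁ m (U i) a b) l (𝓝 (RPJ h s p₁ m u a b)) := by
  simp only [RPJ, Matrix.of_apply,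
    finsum_eq_sum_of_support_subset _ (support_termPJ_subset hs _ _ a b)]
  exact tendsto_finsetSum _ fun x _ => ((tendsto_gfun tendsto_const_nhds tendsto_const_nhds hU
    fun k hk => hg k (by omega)).mul_const _).mul_const _

end

theorem sum_range_eq_sum_fin {m M : ℕ} (hM : m < M) {f : ℕ → ℂ} (hf : ∀ c, m < c → f c = 0) :
    ∑ c ∈ range M, f c = ∑ c : Fin (m + 1), f c := by
  rw [Fin.sum_univ_eq_sum_range]
  refine (sum_subset (fun c hc => ?_) fun c _ hc => hf c ?_).symm <;> rw [mem_range] at *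
  · omega
  · omega

theorem eventually_GRegular_spectral {h : ℂ} (hq : ∀ n : ℕ, 0 < n → Complex.exp h ^ n ≠ 1)
    (p₁ p₂ u : ℂ) : ∀ᶠ ε in 𝓝 (0 : ℂ) ⊓ cocountable, GRegular h p₁ p₂ (u + ε) := by
  filter_upwards [eventually_qnum_ne_zero hq one_ne_zero (u + p₁ + p₂)] with ε hε k
  rw [show u + ε + p₁ + p₂ - k = 1 * ε + (u + p₁ + p₂) - k by ring]
  exact hε k

section

variable {h : ℂ} {s : ℂ → ℂ} (hq : ∀ n : ℕ, 0 < n → Complex.exp h ^ n ≠ 1)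
  (hs : ∀ z : ℂ, s z ^ 2 = z) {m : ℕ}

include hs in
/-- Restriction of a matrix equation for `R_{p₁ j₂}` to the spin representation. -/
theorem RPJ_sum_of_RPP_sum {p₁ u : ℂ} {A B : Matrix (ℕ × ℕ) (ℕ × ℕ) ℂ} {a b : ℕ × Fin (m + 1)}
    {M : ℕ} (hM : m < M)
    (H : ∑ c ∈ range M ×ˢ range M, RPP h s p₁ ((m : ℂ) / 2) u (a.1, a.2) c * A c (b.1, b.2)
      = ∑ c ∈ range M ×ˢ range M, B (a.1, a.2) c * RPP h s p₁ ((m : ℂ) / 2) u c (b.1, b.2)) :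
    ∑ c ∈ range M ×ˢ (univ : Finset (Fin (m + 1))), RPJ h s p₁ m u a c * A (c.1, c.2) (b.1, b.2)
      = ∑ c ∈ range M ×ˢ (univ : Finset (Fin (m + 1))),
        B (a.1, a.2) (c.1, c.2) * RPJ h s p₁ m u c b := by
  have ha := Fin.is_le a.2
  have hb := Fin.is_le b.2
  rw [sum_product, sum_product] at *
  simp only [RPJ_eq_RPP hs]
  convert H using 2 with c _ c _
  · refine (sum_range_eq_sum_fin hM
      (f := fun d => RPP h s p₁ ((m : ℂ) / 2) u (a.1, a.2) (c, d) * A (c, d) (b.1, b.2))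
      fun d hd => mul_eq_zero_of_left (RPP_spin_eq_zero hs _ _ (Or.inl ⟨ha, hd⟩)) _).symm
  · refine (sum_range_eq_sum_fin hM
      (f := fun d => B (a.1, a.2) (c, d) * RPP h s p₁ ((m : ℂ) / 2) u (c, d) (b.1, b.2))
      fun d hd => mul_eq_zero_of_right _ (RPP_spin_eq_zero hs _ _ (Or.inr ⟨hb, hd⟩))).symm

include hq hs

theorem RPJ_raise_sum {p₁ u : ℂ} (hc : CGRegular h p₁ ((m : ℂ) / 2)) (hg : GRegularSpin h p₁ m u)
    {r t t' : ℂ} (ht : t' = -t)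
    (hrt : (r = 1 ∧ t = 1 / 2) ∨ (r = (qpow h (-2 * u))⁻¹ ∧ t = -(1 / 2)))
    {a b : ℕ × Fin (m + 1)} {M : ℕ} (hM : m + a.1 + a.2 + 1 < M) :
    ∑ c ∈ range M ×ˢ (univ : Finset (Fin (m + 1))), RPJ h s p₁ m u a c
        * (r • ((colorRep h s p₁).Xp ⊗ₖ (spinRep h s m).K t)
          + (colorRep h s p₁).K t' ⊗ₖ (spinRep h s m).Xp) c b
      = ∑ c ∈ range M ×ˢ (univ : Finset (Fin (m + 1))),
        (r • ((colorRep h s p₁).Xp ⊗ₖ (spinRep h s m).K t')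
          + (colorRep h s p₁).K t ⊗ₖ (spinRep h s m).Xp) a c * RPJ h s p₁ m u c b := by
  have hu := tendsto_add_zero u
  have T := tendsto_RPJ hs hu hg
  -- For X_0^- the coefficient x⁻¹ depends on u and must be deformed together with R; for X_1^+ it
  -- stays 1.
  obtain ⟨ρ, hρ, hρt⟩ : ∃ ρ : ℂ → ℂ, (∀ ε, (ρ ε = 1 ∧ t = 1 / 2)
      ∨ (ρ ε = (qpow h (-2 * (u + ε)))⁻¹ ∧ t = -(1 / 2)))
      ∧ Tendsto ρ (𝓝 0 ⊓ cocountable) (𝓝 r) := by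
    rcases hrt with ⟨rfl, ht⟩ | ⟨rfl, ht⟩
    · exact ⟨fun _ => 1, fun _ => Or.inl ⟨rfl, ht⟩, tendsto_const_nhds⟩
    · exact ⟨fun ε => (qpow h (-2 * (u + ε)))⁻¹, fun _ => Or.inr ⟨rfl, ht⟩,
        (tendsto_qpow (hu.const_mul _)).inv₀ (qpow_ne_zero _ _)⟩
  refine tendsto_nhds_unique_of_eventuallyEq
    (tendsto_finsetSum _ fun c _ => (T _ _).mul ((hρt.mul_const _).add tendsto_const_nhds))
    (tendsto_finsetSum _ fun c _ => ((hρt.mul_const _).add tendsto_const_nhds).mul (T _ _)) ?_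
  filter_upwards [eventually_GRegular_spectral hq p₁ (m / 2) u] with ε hε
  exact RPJ_sum_of_RPP_sum hs (by omega) (RPP_raise_sum hq hs hc hε ht (hρ ε) (by simp; omega))

theorem RPJ_lower_sum {p₁ u : ℂ} (hc : CGRegular h p₁ ((m : ℂ) / 2)) (hg : GRegularSpin h p₁ m u)
    {r t t' : ℂ} (ht : t' = -t)
    (hrt : (r = 1 ∧ t = 1 / 2) ∨ (r = qpow h (-2 * u) ∧ t = -(1 / 2)))
    {a b : ℕ × Fin (m + 1)} {M : ℕ} (hM : m + a.1 + a.2 + 1 < M) :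
    ∑ c ∈ range M ×ˢ (univ : Finset (Fin (m + 1))), RPJ h s p₁ m u a c
        * (r • ((colorRep h s p₁).Xm ⊗ₖ (spinRep h s m).K t)
          + (colorRep h s p₁).K t' ⊗ₖ (spinRep h s m).Xm) c b
      = ∑ c ∈ range M ×ˢ (univ : Finset (Fin (m + 1))),
        (r • ((colorRep h s p₁).Xm ⊗ₖ (spinRep h s m).K t')
          + (colorRep h s p₁).K t ⊗ₖ (spinRep h s m).Xm) a c * RPJ h s p₁ m u c b := by
  have hu := tendsto_add_zero u
  have T := tendsto_RPJ hs hu hg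
  obtain ⟨ρ, hρ, hρt⟩ : ∃ ρ : ℂ → ℂ, (∀ ε, (ρ ε = 1 ∧ t = 1 / 2)
      ∨ (ρ ε = qpow h (-2 * (u + ε)) ∧ t = -(1 / 2)))
      ∧ Tendsto ρ (𝓝 0 ⊓ cocountable) (𝓝 r) := by
    rcases hrt with ⟨rfl, ht⟩ | ⟨rfl, ht⟩
    · exact ⟨fun _ => 1, fun _ => Or.inl ⟨rfl, ht⟩, tendsto_const_nhds⟩
    · exact ⟨fun ε => qpow h (-2 * (u + ε)), fun _ => Or.inr ⟨rfl, ht⟩,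
        tendsto_qpow (hu.const_mul _)⟩
  refine tendsto_nhds_unique_of_eventuallyEq
    (tendsto_finsetSum _ fun c _ => (T _ _).mul ((hρt.mul_const _).add tendsto_const_nhds))
    (tendsto_finsetSum _ fun c _ => ((hρt.mul_const _).add tendsto_const_nhds).mul (T _ _)) ?_
  filter_upwards [eventually_GRegular_spectral hq p₁ (m / 2) u] with ε hε
  exact RPJ_sum_of_RPP_sum hs (by omega) (RPP_lower_sum hq hs hc hε ht (hρ ε) (by simp; omega))

theorem RPJ_solvesIntertwining {p₁ u : ℂ} (hc : CGRegular h p₁ ((m : ℂ) / 2))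
    (hg : GRegularSpin h p₁ m u) :
    SolvesIntertwining (qpow h (-2 * u)) (colorRep h s p₁) (spinRep h s m)
      (RPJ h s p₁ m u) := by
  refine solvesIntertwining_of (fun t => ?_) (fun r t t' ht hrt => ?_) fun r t t' ht hrt => ?_
  · have hK : (colorRep h s p₁).K t = Matrix.diagonal fun a : ℕ => qpow h (t * (2 * p₁ - 2 * a)) :=
      rfl
    have hK' : (spinRep h s m).K t = Matrix.diagonal fun a : Fin (m + 1) =>
        qpow h (t * (2 * ((m : ℂ) / 2) - 2 * (a : ℕ))) :=
      Matrix.submatrix_diagonal (fun a : ℕ => qpow h (t * (2 * ((m : ℂ) / 2) - 2 * a))) _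
        Fin.val_injective
    rw [hK, hK', Matrix.diagonal_kronecker_diagonal]
    refine prodEq_diagonal fun a b hab => ?_
    have : a.1 + (a.2 : ℕ) = b.1 + b.2 := by
      by_contra hne
      exact hab (RPJ_of_ne hs hne)
    rw [← qpow_add, ← qpow_add]
    congr 1
    have e : (a.1 : ℂ) + (a.2 : ℕ) = b.1 + (b.2 : ℕ) := by exact_mod_cast this
    linear_combination (-2 * t) * e
  all_goals
    refine prodEq_of_finset fun a b => ⟨range (m + a.1 + a.2 + b.1 + b.2 + 2) ×ˢ univ,
      fun c hc => ?_, fun c hc => ?_, ?_⟩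
    · rw [RPJ_of_ne hs, zero_mul]
      rw [mem_product, mem_range] at hc
      simp only [mem_univ, and_true] at hc
      omega
    · rw [RPJ_of_ne hs, mul_zero]
      rw [mem_product, mem_range] at hc
      simp only [mem_univ, and_true] at hc
      omega
  · exact RPJ_raise_sum hq hs hc hg ht hrt (by omega)
  · exact RPJ_lower_sum hq hs hc hg ht hrt (by omega)

/-- The color equation at p₃ = m/2 with outer indices at most m. A third summation index above m is
excluded by block diagonality of one factor: R₂₃ on the left side, R₁₃ on the right. -/
theorem RPJ_yangBaxter_sum_of_GRegular {p₁ p₂ u v : ℂ} (hc₁₂ : CGRegular h p₁ p₂)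
    (hc₁₃ : CGRegular h p₁ ((m : ℂ) / 2)) (hc₂₃ : CGRegular h p₂ ((m : ℂ) / 2))
    (hg₁₂ : GRegular h p₁ p₂ u) (hg₁₃ : GRegular h p₁ ((m : ℂ) / 2) (u + v))
    (hg₂₃ : GRegular h p₂ ((m : ℂ) / 2) v) {a₁ a₂ b₁ b₂ M : ℕ} {a₃ b₃ : Fin (m + 1)}
    (hM : a₁ + a₂ + a₃ + b₁ + b₂ + b₃ + m < M) :
    ∑ c ∈ range M ×ˢ range M ×ˢ (univ : Finset (Fin (m + 1))),
        RPP h s p₁ p₂ u (c.1, c.2.1) (b₁, b₂) * RPJ h s p₁ m (u + v) (a₁, c.2.2) (c.1, b₃)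
          * RPJ h s p₂ m v (a₂, a₃) (c.2.1, c.2.2)
      = ∑ c ∈ range M ×ˢ range M ×ˢ (univ : Finset (Fin (m + 1))),
        RPP h s p₁ p₂ u (a₁, a₂) (c.1, c.2.1) * RPJ h s p₁ m (u + v) (c.1, a₃) (b₁, c.2.2)
          * RPJ h s p₂ m v (c.2.1, c.2.2) (b₂, b₃) := by
  have ha := Fin.is_le a₃
  have H := RPP_yangBaxter_sum hq hs hc₁₂ hc₁₃ hc₂₃ hg₁₂ hg₁₃ hg₂₃
    (a₁ := a₁) (a₂ := a₂) (a₃ := a₃) (b₁ := b₁) (b₂ := b₂) (b₃ := b₃) (M := M) (by omega)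
  simp only [sum_product] at H ⊢
  simp only [RPJ_eq_RPP hs]
  convert H using 4 with c _ d _ c _ d _
  · refine (sum_range_eq_sum_fin (by omega)
      (f := fun e => RPP h s p₁ p₂ u (c, d) (b₁, b₂)
        * RPP h s p₁ ((m : ℂ) / 2) (u + v) (a₁, e) (c, b₃)
        * RPP h s p₂ ((m : ℂ) / 2) v (a₂, a₃) (d, e)) fun e he =>
      mul_eq_zero_of_right _ (RPP_spin_eq_zero hs p₂ _ (Or.inl ⟨ha, he⟩))).symm
  · refine (sum_range_eq_sum_fin (by omega)
      (f := fun e => RPP h s p₁ p₂ u (a₁, a₂) (c, d)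
        * RPP h s p₁ ((m : ℂ) / 2) (u + v) (c, a₃) (b₁, e)
        * RPP h s p₂ ((m : ℂ) / 2) v (d, e) (b₂, b₃)) fun e he =>
      mul_eq_zero_of_left (mul_eq_zero_of_right _
        (RPP_spin_eq_zero hs p₁ _ (Or.inl ⟨ha, he⟩))) _).symm

/-- Deforming v alone moves both u+v and v while keeping R₁₂ fixed, and makes the two spin R
matrices regular in the stronger sense. -/
theorem RPJ_yangBaxter_sum {p₁ p₂ u v : ℂ} (hc₁₂ : CGRegular h p₁ p₂)
    (hc₁₃ : CGRegular h p₁ ((m : ℂ) / 2)) (hc₂₃ : CGRegular h p₂ ((m : ℂ) / 2))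
    (hg₁₂ : GRegular h p₁ p₂ u) (hg₁₃ : GRegularSpin h p₁ m (u + v))
    (hg₂₃ : GRegularSpin h p₂ m v) {a₁ a₂ b₁ b₂ M : ℕ} {a₃ b₃ : Fin (m + 1)}
    (hM : a₁ + a₂ + a₃ + b₁ + b₂ + b₃ + m < M) :
    ∑ c ∈ range M ×ˢ range M ×ˢ (univ : Finset (Fin (m + 1))),
        RPP h s p₁ p₂ u (c.1, c.2.1) (b₁, b₂) * RPJ h s p₁ m (u + v) (a₁, c.2.2) (c.1, b₃)
          * RPJ h s p₂ m v (a₂, a₃) (c.2.1, c.2.2)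
      = ∑ c ∈ range M ×ˢ range M ×ˢ (univ : Finset (Fin (m + 1))),
        RPP h s p₁ p₂ u (a₁, a₂) (c.1, c.2.1) * RPJ h s p₁ m (u + v) (c.1, a₃) (b₁, c.2.2)
          * RPJ h s p₂ m v (c.2.1, c.2.2) (b₂, b₃) := by
  have T₁₃ := tendsto_RPJ hs ((tendsto_add_zero v).const_add u) hg₁₃
  have T₂₃ := tendsto_RPJ hs (tendsto_add_zero v) hg₂₃
  refine tendsto_nhds_unique_of_eventuallyEq
    (tendsto_finsetSum _ fun c _ => ((T₁₃ _ _).const_mul _).mul (T₂₃ _ _))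
    (tendsto_finsetSum _ fun c _ => ((T₁₃ _ _).const_mul _).mul (T₂₃ _ _)) ?_
  filter_upwards [eventually_GRegular_spectral hq p₁ (m / 2) (u + v),
    eventually_GRegular_spectral hq p₂ (m / 2) v] with ε h₁ h₂
  rw [add_assoc] at h₁
  exact RPJ_yangBaxter_sum_of_GRegular hq hs hc₁₂ hc₁₃ hc₂₃ hg₁₂ h₁ h₂ hM

theorem RPJ_yangBaxter {p₁ p₂ u v : ℂ} (hc₁₂ : CGRegular h p₁ p₂)
    (hc₁₃ : CGRegular h p₁ ((m : ℂ) / 2)) (hc₂₃ : CGRegular h p₂ ((m : ℂ) / 2))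
    (hg₁₂ : GRegular h p₁ p₂ u) (hg₁₃ : GRegularSpin h p₁ m (u + v))
    (hg₂₃ : GRegularSpin h p₂ m v) :
    YangBaxter (RPP h s p₁ p₂ u) (RPJ h s p₁ m (u + v)) (RPJ h s p₂ m v) := by
  intro a₁ b₁ a₂ b₂ a₃ b₃
  obtain ⟨M, hM⟩ : ∃ M, M = a₁ + a₂ + a₃ + b₁ + b₂ + b₃ + m + 1 := ⟨_, rfl⟩
  have e₁ : (Function.support fun c : ℕ × ℕ × Fin (m + 1) => RPP h s p₁ p₂ u (c.1, c.2.1) (b₁, b₂)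
      * RPJ h s p₁ m (u + v) (a₁, c.2.2) (c.1, b₃) * RPJ h s p₂ m v (a₂, a₃) (c.2.1, c.2.2))
      ⊆ (range M ×ˢ range M ×ˢ univ : Finset (ℕ × ℕ × Fin (m + 1))) := by
    intro c hc
    have h₁ := left_ne_zero_of_mul (left_ne_zero_of_mul hc)
    have h₁ : c.1 + c.2.1 = b₁ + b₂ := by
      by_contra hne
      exact h₁ (RPP_of_ne hne)
    simp only [coe_product, Set.mem_prod, mem_coe, mem_range, mem_univ, and_true]
    omega
  have e₂ : (Function.support fun c : ℕ × ℕ × Fin (m + 1) => RPP h s p₁ p₂ u (a₁, a₂) (c.1, c.2.1)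
        * RPJ h s p₁ m (u + v) (c.1, a₃) (b₁, c.2.2)
        * RPJ h s p₂ m v (c.2.1, c.2.2) (b₂, b₃))
      ⊆ (range M ×ˢ range M ×ˢ univ : Finset (ℕ × ℕ × Fin (m + 1))) := by
    intro c hc
    have h₁ := left_ne_zero_of_mul (left_ne_zero_of_mul hc)
    have h₁ : a₁ + a₂ = c.1 + c.2.1 := by
      by_contra hne
      exact h₁ (RPP_of_ne hne)
    simp only [coe_product, Set.mem_prod, mem_coe, mem_range, mem_univ, and_true]
    omega
  refine ⟨(finite_toSet _).subset e₁, (finite_toSet _).subset e₂, ?_⟩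
  rw [finsum_eq_sum_of_support_subset _ e₁, finsum_eq_sum_of_support_subset _ e₂]
  exact RPJ_yangBaxter_sum hq hs hc₁₂ hc₁₃ hc₂₃ hg₁₂ hg₁₃ hg₂₃ (by omega)

end

end

end ColoredVertex

/-! ### The main theorem -/

theorem mainTheorem4
    (h : ℂ) (hgeneric : ∀ n : ℕ, 0 < n → Complex.exp h ^ n ≠ 1)
    (s : ℂ → ℂ) (hs : ∀ z : ℂ, s z ^ 2 = z) :
    -- two color representations: the sum is finite, charge is conserved, linear equations
    (∀ p₁ p₂ u : ℂ, CGRegular h p₁ p₂ → GRegular h p₁ p₂ u →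
      (∀ a b : ℕ × ℕ, (Function.support (termPP h s p₁ p₂ u a b)).Finite) ∧
      (∀ a b : ℕ × ℕ, a.1 + a.2 ≠ b.1 + b.2 → RPP h s p₁ p₂ u a b = 0) ∧
      SolvesIntertwining (qpow h (-2 * u)) (colorRep h s p₁) (colorRep h s p₂)
        (RPP h s p₁ p₂ u)) ∧
    -- Yang-Baxter equation for three color representations
    (∀ p₁ p₂ p₃ u v : ℂ,
      CGRegular h p₁ p₂ → CGRegular h p₁ p₃ → CGRegular h p₂ p₃ →
      GRegular h p₁ p₂ u → GRegular h p₁ p₃ (u + v) → GRegular h p₂ p₃ v →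
      YangBaxter (RPP h s p₁ p₂ u) (RPP h s p₁ p₃ (u + v)) (RPP h s p₂ p₃ v)) ∧
    -- the Boltzmann weights depend only on the colors `q ^ p`
    (∀ p₁ p₂ p₁' p₂' u : ℂ, qpow h p₁ = qpow h p₁' → qpow h p₂ = qpow h p₂' →
      CGRegular h p₁ p₂ → GRegular h p₁ p₂ u →
      vertexWeight h s p₁ p₂ u = vertexWeight h s p₁' p₂' u) ∧
    -- Yang-Baxter relation of the infinite state colored vertex model
    (∀ p₁ p₂ p₃ u₁ u₂ u₃ : ℂ,
      CGRegular h p₁ p₂ → CGRegular h p₁ p₃ → CGRegular h p₂ p₃ →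
      GRegular h p₁ p₂ (u₁ - u₂) → GRegular h p₁ p₃ (u₁ - u₃) → GRegular h p₂ p₃ (u₂ - u₃) →
      VertexYangBaxter (vertexWeight h s) p₁ p₂ p₃ u₁ u₂ u₃) ∧
    -- a color representation and the spin `m / 2` representation
    (∀ (p₁ : ℂ) (m : ℕ) (u : ℂ), CGRegular h p₁ ((m : ℂ) / 2) → GRegularSpin h p₁ m u →
      (∀ a b : ℕ × Fin (m + 1), (Function.support (termPJ h s p₁ m u a b)).Finite) ∧
      (∀ a b : ℕ × Fin (m + 1), a.1 + (a.2 : ℕ) ≠ b.1 + (b.2 : ℕ) → RPJ h s p₁ m u a b = 0) ∧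
      SolvesIntertwining (qpow h (-2 * u)) (colorRep h s p₁) (spinRep h s m)
        (RPJ h s p₁ m u)) ∧
    -- Yang-Baxter equation for two color representations and the spin `m / 2` representation
    (∀ (p₁ p₂ : ℂ) (m : ℕ) (u v : ℂ),
      CGRegular h p₁ p₂ → CGRegular h p₁ ((m : ℂ) / 2) → CGRegular h p₂ ((m : ℂ) / 2) →
      GRegular h p₁ p₂ u → GRegularSpin h p₁ m (u + v) → GRegularSpin h p₂ m v →
      YangBaxter (RPP h s p₁ p₂ u) (RPJ h s p₁ m (u + v)) (RPJ h s p₂ m v)) := by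
  refine ⟨fun p₁ p₂ u hc hg => ⟨fun a b => (Finset.finite_toSet _).subset (support_termPP_subset p₁ p₂ u a b),
    fun a b hab => RPP_of_ne hab, RPP_solvesIntertwining hgeneric hs hc hg⟩,
    fun p₁ p₂ p₃ u v => RPP_yangBaxter hgeneric hs,
    fun p₁ p₂ p₁' p₂' u h₁ h₂ _ _ => vertexWeight_congr s u h₁ h₂,
    fun p₁ p₂ p₃ u₁ u₂ u₃ c₁₂ c₁₃ c₂₃ g₁₂ g₁₃ g₂₃ => ?_,
    fun p₁ m u hc hg => ⟨fun a b => (Finset.finite_toSet _).subset (support_termPJ_subset hs p₁ u a b),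
      fun a b hab => RPJ_of_ne hs hab, RPJ_solvesIntertwining hgeneric hs hc hg⟩,
    fun p₁ p₂ m u v => RPJ_yangBaxter hgeneric hs⟩
  -- With the representations in the order 3, 2, 1, the two spectral arguments are u₂-u₃ and u₁-u₂,
  -- and their sum is the one of R_{p₃p₁}.
  have e : u₂ - u₃ + (u₁ - u₂) = u₁ - u₃ := by ring
  have H := RPP_yangBaxter hgeneric hs c₂₃.symm c₁₃.symm c₁₂.symm g₂₃.symm
    (u := u₂ - u₃) (v := u₁ - u₂) (by rw [e]; exact g₁₃.symm) g₁₂.symm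
  rw [e] at H
  exact vertexYangBaxter_of_yangBaxter H
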